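/- Let $g\ge 1$ and $0\le t<g$ be integers, $n=2\lfloor g/2\rfloor+1$, $N=gn+2g$ and $M=N-t$. Let $|D^m_w\rangle$ be the Dicke state of weight $w$ on $m$ qubits (the normalized uniform superposition of the basis states of Hamming weight $w$), and let the shifted gnu code with shift $\Delta=g$ be spanned by $$|0_L\rangle=\sqrt{2^{-(n-1)}}\sum_{0\le j\le n,\ j\text{ even}}\sqrt{\tbinom nj}\,|D^{N}_{gj+g}\rangle,\qquad |1_L\rangle=\sqrt{2^{-(n-1)}}\sum_{0\le j\le n,\ j\text{ odd}}\sqrt{\tbinom nj}\,|D^{N}_{gj+g}\rangle .$$ A $t$-deletion channel removes $t$ of the $N$ qubits, in positions that are drawn from an arbitrary probability distribution and are not revealed; the others keep their order. A circuit is an adaptive quantum circuit on qubits, with ancillas initially in $|0\rangle$, made of one- and two-qubit unitary gates and one-qubit measurements in the computational basis, later operations being allowed to depend on earlier outcomes; each gate and each measurement is one step, and steps are counted in the worst case over the outcomes. For $0\le s\le t$ put $b_{j,s}=\sqrt{\binom nj\binom{M}{gj+g-s}}\big/\sqrt{2^n\binom{N}{gj+g}}$, $|\pm_s\rangle=\sum_{j=0}^n(\pm1)^j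 b_{j,s}|D^{M}_{gj+g-s}\rangle$, $|0_s\rangle=(|+_s\rangle+|-_s\rangle)/\sqrt2$ and $|1_s\rangle=(|+_s\rangle-|-_s\rangle)/\sqrt2$. Let $R=|0\rangle\langle0|+e^{\pi i/g}|1\rangle\langle1|$ and $X=|0\rangle\langle 1|+|1\rangle\langle 0|$. Let $W_s$ be the unitary that exchanges $|D^M_{gj+g-s}\rangle$ and $|D^M_{g(n-j)+g-s}\rangle$ for $0\le j\le n$ and is the identity on the orthogonal complement of these states. Then there is a constant $C$, independent of $g$ and $t$, such that for all $g\ge1$ and $0\le t<g$ there is a circuit with at most $CN^2$ steps that recovers the qubit: for all $a,b\in\mathbb C$ with $|a|^2+|b|^2=1$ and every $t$-deletion channel $\mathcal D_t$, when it is run on $\mathcal D_t(|\psi\rangle\langle\psi|)$ with $|\psi\rangle=a|0_L\rangle+b|1_L\rangle$, its output qubit is exactly in the state $a|0\rangle+b|1\rangle$. The circuit is the composition of three stages. 1. Phase estimation of $U=(R^2)^{\otimes M}$: circuits that exactly carry out the preparation of the qudit state $\frac1{\sqrt g}\sum_{j=0}^{g-1}|j\rangle$ (its levels being stored as distinct basis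 states of ancilla qubits), the operator $\sum_j|j\rangle\langle j|\otimes U^j$, and the inverse quantum Fourier transform $F^\dagger$ on the qudit, where $F|k\rangle=\frac1{\sqrt g}\sum_j e^{2\pi i jk/g}|j\rangle$; then a measurement of the ancillas, which are reset to $|0\rangle$. From the outcome $k$ the syndrome $s\in\{0,\dots,g-1\}$, $s\equiv-k \pmod g$, is read. The outcomes with $s>t$ have probability $0$, and for $s\le t$ the unnormalized state of the data after outcome $s$ is $\binom ts|\psi_s\rangle\langle\psi_s|$ with $|\psi_s\rangle=a|0_s\rangle+b|1_s\rangle$. 2. Amplitude rebalancing: for each $s\le t$, a circuit that exactly carries out a unitary $G_s$ that is the identity on the orthogonal complement of the symmetric subspace and satisfies $G_s|0_s\rangle=c\,|0'_s\rangle$, $G_s|1_s\rangle=c\,|1'_s\rangle$ for some $c>0$, where $|0'_s\rangle$ is a unit vector in the span of the $|D^M_{gj+g-s}\rangle$ with $j$ even, $0\le j\le n$, and $|1'_s\rangle=W_s|0'_s\rangle$. 3. Logical gate teleportation: the output qubit is brought from $|0\rangle$ to $(|0\rangle+|1\rangle)/\sqrt2$; it controls a CNOT onto each of the $M$ data qubits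 and then a circuit that exactly carries out $|0\rangle\langle0|\otimes 1+|1\rangle\langle1|\otimes S_s$, where, for $s\le t$, $S_s$ is a unitary that is the identity on the orthogonal complement of the symmetric subspace and satisfies $S_s|D^M_w\rangle=|D^M_{w+t-2s}\rangle$ whenever $0\le w\le M$ and $0\le w+t-2s\le M$; then all data qubits are measured (logical $Z$ measurement), and $X$ is applied to the output qubit if $\lfloor(w+s)/g\rfloor$ is even, where $w$ is the measured total weight (equivalently, if $j$ is odd in $w=gj+g-s$). -/

import Mathlib

open scoped Matrix Kronecker

namespace GnuDecoding

noncomputable section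

/-! Registers of qubits. `Q` is the finite set of wires, the computational basis is `Q → Bool`. -/

/-- Operators on a register of qubits, as matrices in the computational basis. -/
abbrev Op (Q : Type) : Type := Matrix (Q → Bool) (Q → Bool) ℂ

/-- The rank-one operator `|v⟩⟨v|`. -/
def proj {ι : Type} (v : ι → ℂ) : Matrix ι ι ℂ := Matrix.vecMulVec v (star v)

/-- A one-qubit matrix acting on wire `i`, tensored with the identity on all other wires. -/
def lift1 {Q : Type} [Fintype Q] [DecidableEq Q] (i : Q) (u : Matrix Bool Bool ℂ) : Op Q :=
  fun x y => if ∀ q, q ≠ i → x q = y q then u (x i) (y i) else 0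

/-- A two-qubit matrix acting on wires `i` and `j` (in this order), tensored with the identity on
all other wires. -/
def lift2 {Q : Type} [Fintype Q] [DecidableEq Q] (i j : Q)
    (u : Matrix (Bool × Bool) (Bool × Bool) ℂ) : Op Q :=
  fun x y => if ∀ q, q ≠ i → q ≠ j → x q = y q then u (x i, x j) (y i, y j) else 0

/-- The projector onto the basis states whose wire `i` has the value `r`. -/
def measProj {Q : Type} [Fintype Q] [DecidableEq Q] (i : Q) (r : Bool) : Op Q :=
  Matrix.diagonal fun x => if x i = r then 1 else 0

/-- Adaptive quantum circuits on the wires `Q` that end with a classical result in `α`: one- and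
two-qubit unitary gates and one-qubit measurements in the computational basis, where everything that
follows a measurement may depend on its outcome. -/
inductive Circuit (Q α : Type) : Type where
  | ret (a : α) : Circuit Q α
  | gate1 (i : Q) (u : Matrix.unitaryGroup Bool ℂ) (next : Circuit Q α) : Circuit Q α
  | gate2 (i j : Q) (hij : i ≠ j) (u : Matrix.unitaryGroup (Bool × Bool) ℂ)
      (next : Circuit Q α) : Circuit Q α
  | meas (i : Q) (next : Bool → Circuit Q α) : Circuit Q α

namespace Circuit

variable {Q α β : Type}

/-- Sequential composition; the second circuit may depend on the classical result of the first. -/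
def bind : Circuit Q α → (α → Circuit Q β) → Circuit Q β
  | ret a, f => f a
  | gate1 i u c, f => gate1 i u (c.bind f)
  | gate2 i j h u c, f => gate2 i j h u (c.bind f)
  | meas i c, f => meas i fun r => (c r).bind f

/-- Number of steps in the worst case over the measurement outcomes: each gate and each one-qubit
measurement is one step. -/
def steps : Circuit Q α → ℕ
  | ret _ => 0
  | gate1 _ _ c => c.steps + 1
  | gate2 _ _ _ _ c => c.steps + 1
  | meas _ c => max (c false).steps (c true).steps + 1

/-- `run c ρ a` is the unnormalized final state of the register on the branches of `c` with classical
result `a`, when `c` is started in `ρ`; its trace is the probability of the result `a`. -/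
def run [Fintype Q] [DecidableEq Q] [DecidableEq α] : Circuit Q α → Op Q → α → Op Q
  | ret a, ρ => Pi.single a ρ
  | gate1 i u c, ρ => c.run (lift1 i u.1 * ρ * (lift1 i u.1)ᴴ)
  | gate2 i j _ u c, ρ => c.run (lift2 i j u.1 * ρ * (lift2 i j u.1)ᴴ)
  | meas i c, ρ => (c false).run (measProj i false * ρ * measProj i false)
      + (c true).run (measProj i true * ρ * measProj i true)

/-- Measure the listed wires one after the other; wires not listed are reported as `false`. -/
def measureList [DecidableEq Q] : List Q → Circuit Q (Q → Bool)
  | [] => ret fun _ => false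
  | q :: l => meas q fun r => (measureList l).bind fun f => ret (Function.update f q r)

end Circuit

/-! Standard gates. -/

/-- The bit flip `X`. -/
def xMat : Matrix Bool Bool ℂ := fun r c => if r = !c then 1 else 0

/-- The Hadamard matrix. -/
def hMat : Matrix Bool Bool ℂ :=
  fun r c => ((1 / Real.sqrt 2 : ℝ) : ℂ) * (if r && c then -1 else 1)

/-- The controlled NOT; the first qubit is the control. -/
def cnotMat : Matrix (Bool × Bool) (Bool × Bool) ℂ :=
  fun r c => if r.1 = c.1 ∧ r.2 = xor c.1 c.2 then 1 else 0

theorem xMat_mem : xMat ∈ Matrix.unitaryGroup Bool ℂ := by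
  rw [Matrix.mem_unitaryGroup_iff]
  ext i j
  cases i <;> cases j <;> simp [xMat, Matrix.mul_apply, Matrix.star_apply]

theorem hMat_mem : hMat ∈ Matrix.unitaryGroup Bool ℂ := by
  have h : ((Real.sqrt 2 : ℝ) : ℂ)⁻¹ * ((Real.sqrt 2 : ℝ) : ℂ)⁻¹ = 1 / 2 := by
    rw [← mul_inv, ← Complex.ofReal_mul, Real.mul_self_sqrt (by norm_num)]
    norm_num
  rw [Matrix.mem_unitaryGroup_iff]
  ext i j
  cases i <;> cases j <;> (simp [hMat, Matrix.mul_apply, Matrix.star_apply, h]; try norm_num)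

theorem cnotMat_mem : cnotMat ∈ Matrix.unitaryGroup (Bool × Bool) ℂ := by
  rw [Matrix.mem_unitaryGroup_iff]
  ext ⟨i, i'⟩ ⟨j, j'⟩
  cases i <;> cases i' <;> cases j <;> cases j' <;>
    simp [cnotMat, Matrix.mul_apply, Matrix.star_apply, Fintype.sum_prod_type]

/-- Flip the listed wires `q` with `f q = true`; this resets measured wires to `|0⟩`. -/
def flipList {Q : Type} (f : Q → Bool) : List Q → Circuit Q Unit
  | [] => .ret ()
  | q :: l => if f q then .gate1 q ⟨xMat, xMat_mem⟩ (flipList f l) else flipList f l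

/-! Dicke states and the shifted gnu code. -/

/-- Hamming weight. -/
def weight {m : ℕ} (x : Fin m → Bool) : ℕ := (Finset.univ.filter fun i => x i = true).card

/-- The Dicke state `|D^m_w⟩`. -/
def dicke (m w : ℕ) : (Fin m → Bool) → ℂ :=
  fun x => if weight x = w then ((1 / Real.sqrt (m.choose w) : ℝ) : ℂ) else 0

/-- The tensor power `A^{⊗ m}`. -/
def tensorPow (m : ℕ) (A : Matrix Bool Bool ℂ) : Op (Fin m) := fun x y => ∏ i, A (x i) (y i)

/-- The parameter `n = 2⌊g/2⌋ + 1`. -/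
def codeN (g : ℕ) : ℕ := 2 * (g / 2) + 1

/-- The length `N = gn + 2g`. -/
def len (g : ℕ) : ℕ := g * codeN g + 2 * g

/-- The logical codeword `|0_L⟩`. -/
def zeroL (g : ℕ) : (Fin (len g) → Bool) → ℂ :=
  ((Real.sqrt (1 / 2 ^ (codeN g - 1)) : ℝ) : ℂ) •
    ∑ j ∈ (Finset.range (codeN g + 1)).filter Even,
      ((Real.sqrt ((codeN g).choose j) : ℝ) : ℂ) • dicke (len g) (g * j + g)

/-- The logical codeword `|1_L⟩`. -/
def oneL (g : ℕ) : (Fin (len g) → Bool) → ℂ :=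
  ((Real.sqrt (1 / 2 ^ (codeN g - 1)) : ℝ) : ℂ) •
    ∑ j ∈ (Finset.range (codeN g + 1)).filter Odd,
      ((Real.sqrt ((codeN g).choose j) : ℝ) : ℂ) • dicke (len g) (g * j + g)

/-- The encoded qubit `a|0_L⟩ + b|1_L⟩`. -/
def encoded (g : ℕ) (a b : ℂ) : (Fin (len g) → Bool) → ℂ := a • zeroL g + b • oneL g

/-- The state of the qubits at the positions `f 0 < f 1 < …` after all other qubits are lost. -/
def survivors {m N : ℕ} (f : Fin m ↪o Fin N) (ρ : Op (Fin N)) : Op (Fin m) :=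
  fun x y => ∑ u : Fin N → Bool, ∑ v : Fin N → Bool,
    if (∀ i, u (f i) = x i) ∧ (∀ i, v (f i) = y i) ∧ (∀ k, k ∉ Set.range f → u k = v k)
    then ρ u v else 0

open Classical in
/-- The deletion channel from `N` to `m` qubits that keeps exactly the positions `f 0 < f 1 < …` with
probability `p f`; the receiver does not learn `f`. -/
def deletion {m N : ℕ} (p : (Fin m ↪o Fin N) → ℝ) (ρ : Op (Fin N)) : Op (Fin m) :=
  ∑ f : Fin m ↪o Fin N, (p f : ℂ) • survivors f ρ

open Classical in
/-- Probability distributions on the positions of the surviving qubits. -/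
def IsDeletionLaw {m N : ℕ} (p : (Fin m ↪o Fin N) → ℝ) : Prop :=
  (∀ f, 0 ≤ p f) ∧ ∑ f : Fin m ↪o Fin N, p f = 1

/-! The states after `t` deletions, with syndrome `s`. -/

/-- The coefficient `b_{j,s}`. -/
def coeff (g t s j : ℕ) : ℝ :=
  Real.sqrt ((codeN g).choose j * (len g - t).choose (g * j + g - s)) /
    Real.sqrt (2 ^ codeN g * (len g).choose (g * j + g))

/-- The unnormalized state `|+_s⟩`. -/
def plusS (g t s : ℕ) : (Fin (len g - t) → Bool) → ℂ :=
  ∑ j ∈ Finset.range (codeN g + 1), (coeff g t s j : ℂ) • dicke (len g - t) (g * j + g - s)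

/-- The unnormalized state `|-_s⟩`. -/
def minusS (g t s : ℕ) : (Fin (len g - t) → Bool) → ℂ :=
  ∑ j ∈ Finset.range (codeN g + 1),
    ((-1) ^ j * (coeff g t s j : ℂ)) • dicke (len g - t) (g * j + g - s)

/-- `|0_s⟩ = (|+_s⟩ + |-_s⟩)/√2`. -/
def zeroS (g t s : ℕ) : (Fin (len g - t) → Bool) → ℂ :=
  ((1 / Real.sqrt 2 : ℝ) : ℂ) • (plusS g t s + minusS g t s)

/-- `|1_s⟩ = (|+_s⟩ - |-_s⟩)/√2`. -/
def oneS (g t s : ℕ) : (Fin (len g - t) → Bool) → ℂ :=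
  ((1 / Real.sqrt 2 : ℝ) : ℂ) • (plusS g t s - minusS g t s)

/-- A unitary that acts non-trivially only on the symmetric subspace. -/
def SymmetricUnitary {m : ℕ} (G : Op (Fin m)) : Prop :=
  G ∈ Matrix.unitaryGroup (Fin m → Bool) ℂ ∧
    ∀ v : (Fin m → Bool) → ℂ, (∀ w ≤ m, star (dicke m w) ⬝ᵥ v = 0) → G *ᵥ v = v

/-- The unitary `W` that interchanges `|D_{gj+g-s}⟩` and `|D_{g(n-j)+g-s}⟩` for `0 ≤ j ≤ n`, and is the
identity on the orthogonal complement of these states. -/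
def interchange (g t s : ℕ) : Op (Fin (len g - t)) :=
  1 + ∑ j ∈ Finset.range (codeN g + 1),
    Matrix.vecMulVec
      (dicke (len g - t) (g * (codeN g - j) + g - s) - dicke (len g - t) (g * j + g - s))
      (star (dicke (len g - t) (g * j + g - s)))

/-- A unitary on the symmetric subspace that changes the weight of the Dicke states by `r`. -/
def IsDickeShift {m : ℕ} (S : Op (Fin m)) (r : ℤ) : Prop :=
  SymmetricUnitary S ∧
    ∀ w w' : ℕ, w ≤ m → w' ≤ m → (w' : ℤ) = w + r → S *ᵥ dicke m w = dicke m w'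

/-! The operators of phase estimation, on an ancilla qudit with levels `Fin g` and the data. -/

/-- `R = |0⟩⟨0| + e^{πi/g}|1⟩⟨1|`. -/
def rMat (g : ℕ) : Matrix Bool Bool ℂ :=
  Matrix.diagonal fun b => if b then Complex.exp (Real.pi * Complex.I / g) else 1

/-- `|ancilla⟩ ⊗ 1`, where `|ancilla⟩ = ∑_j |j⟩/√g`. -/
def ancillaMat (g m : ℕ) : Matrix (Fin g × (Fin m → Bool)) (Fin m → Bool) ℂ :=
  fun r c => if r.2 = c then ((1 / Real.sqrt g : ℝ) : ℂ) else 0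

/-- `V = ∑_j |j⟩⟨j| ⊗ U^j` with `U = (R²)^{⊗ m}`. -/
def ctrlPowMat (g m : ℕ) : Matrix (Fin g × (Fin m → Bool)) (Fin g × (Fin m → Bool)) ℂ :=
  fun r c => if r.1 = c.1 then (tensorPow m (rMat g ^ 2) ^ (r.1 : ℕ)) r.2 c.2 else 0

/-- The quantum Fourier transform `|k⟩ ↦ ∑_j w^{jk}|j⟩/√g` with `w = e^{2πi/g}`. -/
def qft (g : ℕ) : Matrix (Fin g) (Fin g) ℂ := fun j k =>
  ((1 / Real.sqrt g : ℝ) : ℂ) * Complex.exp (2 * Real.pi * Complex.I / g) ^ ((j : ℕ) * (k : ℕ))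

/-- The inverse Fourier transform on the qudit, tensored with the identity on the data. -/
def invQftMat (g m : ℕ) : Matrix (Fin g × (Fin m → Bool)) (Fin g × (Fin m → Bool)) ℂ :=
  (qft g)ᴴ ⊗ₖ (1 : Matrix (Fin m → Bool) (Fin m → Bool) ℂ)

/-- `|0⟩⟨0| ⊗ 1 + |1⟩⟨1| ⊗ S`, on a control qubit and the data. -/
def controlled {m : ℕ} (S : Op (Fin m)) : Matrix (Bool × (Fin m → Bool)) (Bool × (Fin m → Bool)) ℂ :=
  fun r c => if r.1 = c.1 then (if r.1 then S r.2 c.2 else (1 : Op (Fin m)) r.2 c.2) else 0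

/-! The decoder. Its wires are `m` data qubits, one output qubit (the ancilla of the gate
teleportation) and `A` further ancilla qubits. -/

abbrev Wires (m A : ℕ) : Type := Fin m ⊕ (Unit ⊕ Fin A)

/-- The output wire. -/
def outWire {m A : ℕ} : Wires m A := Sum.inr (Sum.inl ())

/-- All data wires. -/
def dataWires (m A : ℕ) : List (Wires m A) := (List.finRange m).map Sum.inl

/-- All ancilla wires other than the output wire. -/
def ancWires (m A : ℕ) : List (Wires m A) := (List.finRange A).map fun k => Sum.inr (Sum.inr k)

/-- The basis state with data `x`, output qubit `o` and ancillas `z`. -/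
def basis {m A : ℕ} (x : Fin m → Bool) (o : Bool) (z : Fin A → Bool) : Wires m A → Bool :=
  Sum.elim x (Sum.elim (fun _ => o) z)

/-- Data `x`; every other wire in `|0⟩`. -/
def atData {m A : ℕ} (x : Fin m → Bool) : Wires m A → Bool := basis x false fun _ => false

/-- Output qubit and data; every ancilla in `|0⟩`. -/
def atOutData {m A : ℕ} (k : Bool × (Fin m → Bool)) : Wires m A → Bool :=
  basis k.2 k.1 fun _ => false

/-- A qudit whose level `j` is stored in the ancillas as the basis state `enc j`, and data. -/
def atQudit {g m A : ℕ} (enc : Fin g → Fin A → Bool) (k : Fin g × (Fin m → Bool)) :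
    Wires m A → Bool := basis k.2 false (enc k.1)

/-- The operator `ρ`, transported to the register along the basis map `e`. -/
def place {ι Q : Type} [Fintype ι] [DecidableEq Q] [Fintype Q] (e : ι → Q → Bool)
    (ρ : Matrix ι ι ℂ) : Op Q :=
  let J : Matrix (Q → Bool) ι ℂ := fun u k => if u = e k then 1 else 0
  J * ρ * Jᴴ

/-- The circuit `c` carries out `T` exactly, from inputs placed by `e` to outputs placed by `e'`. -/
def Realizes {ι κ Q : Type} [Fintype ι] [Fintype κ] [DecidableEq Q] [Fintype Q]
    (c : Circuit Q Unit) (e : ι → Q → Bool) (e' : κ → Q → Bool) (T : Matrix κ ι ℂ) : Prop :=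
  ∀ ρ : Matrix ι ι ℂ, c.run (place e ρ) () = place e' (T * ρ * Tᴴ)

/-- The state of the output qubit; all other wires are traced out. -/
def outputState {m A : ℕ} (ρ : Op (Wires m A)) : Matrix Bool Bool ℂ :=
  fun o o' => ∑ x : Fin m → Bool, ∑ z : Fin A → Bool, ρ (basis x o z) (basis x o' z)

/-- The CNOTs from the output qubit to each of the listed data qubits. -/
def cnots {m A : ℕ} : List (Fin m) → Circuit (Wires m A) Unit
  | [] => .ret ()
  | i :: l => .gate2 outWire (Sum.inl i) Sum.inr_ne_inl ⟨cnotMat, cnotMat_mem⟩ (cnots l)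

/-- The circuits from which a decoder for `t` deletions is assembled: preparation of the ancilla
qudit, the controlled powers of `U`, the inverse Fourier transform, and, for each syndrome, the
rebalancing and the controlled weight shift. -/
structure Scheme (g t : ℕ) where
  A : ℕ
  enc : Fin g → Fin A → Bool
  prepare : Circuit (Wires (len g - t) A) Unit
  ctrlPow : Circuit (Wires (len g - t) A) Unit
  invFourier : Circuit (Wires (len g - t) A) Unit
  rebalance : Fin g → Circuit (Wires (len g - t) A) Unit
  ctrlShift : Fin g → Circuit (Wires (len g - t) A) Unit

namespace Scheme

variable {g t : ℕ} [NeZero g]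

/-- Phase estimation. The outcome `k` of the qudit says that the weight is `k` modulo `g`; since the
weights with syndrome `s` are `gj + g - s`, the syndrome is `-k` modulo `g`. The ancillas are reset. -/
def phaseEstimation (D : Scheme g t) : Circuit (Wires (len g - t) D.A) (Fin g) :=
  D.prepare.bind fun _ => D.ctrlPow.bind fun _ => D.invFourier.bind fun _ =>
    (Circuit.measureList (ancWires (len g - t) D.A)).bind fun f =>
      (flipList f (ancWires (len g - t) D.A)).bind fun _ =>
        .ret (-(Function.invFun D.enc fun k => f (Sum.inr (Sum.inr k))))

/-- Gate teleportation: prepare `(|0⟩+|1⟩)/√2` on the output qubit, apply the logical CNOT to the data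
(CNOTs, then the controlled shift), measure each data qubit, and flip the output qubit if the logical
`Z` measurement says `1`. The measured weight is `w = gj + g - s`, so `e^{πi(w+s)/g} = (-1)^{j+1}`, and
the outcome is `1` if `j = (w+s)/g - 1` is odd. -/
def teleport (D : Scheme g t) (s : Fin g) : Circuit (Wires (len g - t) D.A) Unit :=
  .gate1 outWire ⟨hMat, hMat_mem⟩ <|
    (cnots (List.finRange (len g - t))).bind fun _ => (D.ctrlShift s).bind fun _ =>
      (Circuit.measureList (dataWires (len g - t) D.A)).bind fun f =>
        if Even ((weight (fun i => f (Sum.inl i)) + (s : ℕ)) / g)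
        then .gate1 outWire ⟨xMat, xMat_mem⟩ (.ret ()) else .ret ()

/-- The whole decoder. -/
def decoder (D : Scheme g t) : Circuit (Wires (len g - t) D.A) Unit :=
  D.phaseEstimation.bind fun s => (D.rebalance s).bind fun _ => D.teleport s

/-- The first three circuits carry out the steps of phase estimation on `(R²)^{⊗(N-t)}`. -/
def EstimatesPhase (D : Scheme g t) : Prop :=
  Function.Injective D.enc ∧
  Realizes D.prepare atData (atQudit D.enc) (ancillaMat g (len g - t)) ∧
  Realizes D.ctrlPow (atQudit D.enc) (atQudit D.enc) (ctrlPowMat g (len g - t)) ∧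
  Realizes D.invFourier (atQudit D.enc) (atQudit D.enc) (invQftMat g (len g - t))

/-- The rebalancing for syndrome `s` carries out a unitary `G_s` on the symmetric subspace that takes
`|0_s⟩`, `|1_s⟩`, up to their common norm `c`, to states `|0'_s⟩`, `|1'_s⟩`, where `|0'_s⟩` is a unit vector
supported on `|D_{gj+g-s}⟩` with `j` even, and `|1'_s⟩ = W|0'_s⟩`. -/
def Rebalances (D : Scheme g t) (s : Fin g) : Prop :=
  ∃ (G : Op (Fin (len g - t))) (e₀ e₁ : (Fin (len g - t) → Bool) → ℂ) (c : ℝ),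
    SymmetricUnitary G ∧
    e₀ ∈ Submodule.span ℂ
      {v | ∃ j ≤ codeN g, Even j ∧ v = dicke (len g - t) (g * j + g - (s : ℕ))} ∧
    star e₀ ⬝ᵥ e₀ = 1 ∧
    interchange g t s *ᵥ e₀ = e₁ ∧
    0 < c ∧
    G *ᵥ zeroS g t s = (c : ℂ) • e₀ ∧
    G *ᵥ oneS g t s = (c : ℂ) • e₁ ∧
    Realizes (D.rebalance s) atData atData G

/-- The shift circuit for syndrome `s` carries out, controlled by the output qubit, a shift of the
Dicke weights by `t - 2s`. -/
def Shifts (D : Scheme g t) (s : Fin g) : Prop :=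
  ∃ S : Op (Fin (len g - t)),
    IsDickeShift S ((t : ℤ) - 2 * (s : ℕ)) ∧
    Realizes (D.ctrlShift s) atOutData atOutData (controlled S)

end Scheme

end

end GnuDecoding

open GnuDecoding

/-! Why the decoder recovers the qubit. The codewords depend on the Hamming weight alone, so tracing
out `t` qubits gives the same state for every choice of positions: if `s` of the lost qubits were in
`|1⟩`, a weight `w` becomes `w - s`, and there are `binom(t,s)` such patterns. Every deletion law
therefore produces the mixture of the `|ψ_s⟩` with the factors `binom(t,s)` (`deletion_encoded`).
The weights in `|ψ_s⟩` are congruent to `-s` modulo `g`, and `s ≤ t < g`, so the weight modulo `g`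
tells the components apart without disturbing them. Phase estimation reads it exactly, since `U` has
the eigenvalue `e^{2πiw/g}` on the weight `w` (`run_phaseEstimation`).

For fixed `s` the vectors `|0_s⟩`, `|1_s⟩` are orthogonal by the parity of `j`. They have the same
norm because `b_{j,s}²` is, up to a constant, `binom(n,j)` times a polynomial in `j` of degree at
most `t < n`, so its alternating sum is an `n`-th finite difference and vanishes
(`sum_neg_one_pow_mul_coeff_sq`). Hence a unitary on the Dicke states takes them, up to the common
norm `c`, to the two extreme states `|D_{g-s}⟩` and `|D_{gn+g-s}⟩`, which belong to `j = 0` and to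
the odd index `j = n` (`exists_rebalancing`). On these two, `X^{⊗M}` followed by the weight shift by
`t - 2s` is an exchange, which is the logical `X` that the teleportation needs
(`outputState_teleport`). The branch `s` contributes `binom(t,s) c²` times the desired state, and
these factors add up to one by Vandermonde's identity (`sum_choose_mul_normSqS`).

Why quadratically many steps suffice. Levels are stored one-hot, as the position of a single
excitation. A two-level unitary is then one two-qubit gate that conserves the number of excitations,
and a unitary on `L` levels is a product of at most `L²` two-level ones (`exists_acts`). The Dicke
transform `E`, of `O(M²)` gates, writes the weight of a symmetric state into a one-hot register and
takes everything orthogonal to the symmetric states to kets in which this register is empty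
(`dickeGates_ket`, `dickeRest_mul`). If `T` acts by `V` on the register and fixes the empty
register, then `Eᴴ T E` acts by `V` on the Dicke states and by the identity on their complement
(`conj_dickeTransform`). To control such an operator by the output qubit, only the excitation is
moved to a second register, at a cost of `O(M)` gates (`realizes_controlled_symOp`). -/

namespace GnuDecoding

noncomputable section

set_option linter.unusedSectionVars false

/-! Kets and the action of gates on them. -/

/-- The basis state `|x⟩`. -/
def ket {ι : Type} [DecidableEq ι] (x : ι) : ι → ℂ := Pi.single x 1

theorem ket_apply {ι : Type} [DecidableEq ι] (x y : ι) : ket x y = if y = x then 1 else 0 := by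
  simp [ket, Pi.single_apply]

theorem mulVec_ket {ι κ : Type} [Fintype ι] [DecidableEq ι] (A : Matrix κ ι ℂ) (x : ι) :
    A *ᵥ ket x = A.col x := by
  simp [ket, Matrix.col]

theorem matrix_ext_ket {ι κ : Type} [Fintype ι] [DecidableEq ι] {A B : Matrix κ ι ℂ}
    (h : ∀ x, A *ᵥ ket x = B *ᵥ ket x) : A = B := by
  ext i j
  simpa [mulVec_ket] using congrFun (h j) i

theorem sum_smul_ket {ι : Type} [Fintype ι] [DecidableEq ι] (v : ι → ℂ) :
    ∑ x, v x • ket x = v := by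
  ext i
  simp [ket_apply, Finset.sum_apply]

/-- The matrix with columns `|e k⟩`. -/
def placeMat {ι κ : Type} [DecidableEq κ] (e : ι → κ) : Matrix κ ι ℂ :=
  fun u k => if u = e k then 1 else 0

theorem placeMat_ket {ι κ : Type} [Fintype ι] [DecidableEq ι] [DecidableEq κ] (e : ι → κ)
    (k : ι) : placeMat e *ᵥ ket k = ket (e k) := by
  rw [mulVec_ket]
  ext u
  simp [placeMat, ket_apply]

theorem mulVec_placeMat_mul {ι κ μ : Type} [Fintype ι] [Fintype κ] [DecidableEq ι]
    [DecidableEq κ] [DecidableEq μ] (e : κ → μ) (T : Matrix κ ι ℂ) (k : ι) :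
    (placeMat e * T) *ᵥ ket k = ∑ l, T l k • ket (e l) := by
  rw [← Matrix.mulVec_mulVec, mulVec_ket, ← sum_smul_ket (T.col k), Matrix.mulVec_sum]
  simp [Matrix.mulVec_smul, placeMat_ket]

theorem conjTranspose_placeMat_mulVec {ι κ : Type} [Fintype κ] [DecidableEq κ] (e : ι → κ)
    (v : κ → ℂ) : (placeMat e)ᴴ *ᵥ v = v ∘ e := by
  ext k
  simp [Matrix.mulVec, dotProduct, placeMat, Matrix.conjTranspose_apply, apply_ite star]

theorem conjTranspose_placeMat_mul {ι κ : Type} [Fintype ι] [DecidableEq ι] [Fintype κ]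
    [DecidableEq κ] {e : ι → κ} (he : Function.Injective e) :
    (placeMat e)ᴴ * placeMat e = 1 := by
  refine matrix_ext_ket fun k => ?_
  rw [← Matrix.mulVec_mulVec, placeMat_ket, conjTranspose_placeMat_mulVec, Matrix.one_mulVec]
  ext l
  simp [ket_apply, he.eq_iff]

section Gates

variable {Q : Type} [Fintype Q] [DecidableEq Q]

theorem lift1_ket (i : Q) (u : Matrix Bool Bool ℂ) (y : Q → Bool) :
    lift1 i u *ᵥ ket y = ∑ b, u b (y i) • ket (Function.update y i b) := by
  ext x
  have h : ∀ b, x = Function.update y i b ↔ b = x i ∧ ∀ q, q ≠ i → x q = y q := by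
    intro b
    rw [Function.eq_update_iff]
    exact ⟨fun h => ⟨h.1.symm, h.2⟩, fun h => ⟨h.1.symm, h.2⟩⟩
  rw [mulVec_ket]
  simp only [Matrix.col_apply, lift1, Finset.sum_apply, Pi.smul_apply, ket_apply, h, smul_eq_mul]
  by_cases hx : ∀ q, q ≠ i → x q = y q
  · rw [if_pos hx]
    simp only [and_iff_left hx]
    simp
  · simp only [hx, and_false, if_false, mul_zero, Finset.sum_const_zero]

theorem lift2_ket (i j : Q) (hij : i ≠ j) (u : Matrix (Bool × Bool) (Bool × Bool) ℂ)
    (y : Q → Bool) :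
    lift2 i j u *ᵥ ket y =
      ∑ b, u b (y i, y j) • ket (Function.update (Function.update y i b.1) j b.2) := by
  ext x
  have h : ∀ b : Bool × Bool, x = Function.update (Function.update y i b.1) j b.2 ↔
      b = (x i, x j) ∧ ∀ q, q ≠ i → q ≠ j → x q = y q := by
    rintro ⟨b, b'⟩
    rw [Function.eq_update_iff]
    constructor
    · rintro ⟨h1, h2⟩
      have := h2 i hij
      simp only [Function.update_self] at this
      refine ⟨by simp [h1, this], fun q hq hq' => ?_⟩
      rw [h2 q hq', Function.update_of_ne hq]
    · rintro ⟨h1, h2⟩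
      simp only [Prod.mk.injEq] at h1
      refine ⟨h1.2.symm, fun q hq => ?_⟩
      by_cases hqi : q = i
      · subst hqi; simp [h1.1]
      · rw [Function.update_of_ne hqi, h2 q hqi hq]
  rw [mulVec_ket]
  simp only [Matrix.col_apply, lift2, Finset.sum_apply, Pi.smul_apply, ket_apply, h, smul_eq_mul]
  by_cases hx : ∀ q, q ≠ i → q ≠ j → x q = y q
  · rw [if_pos hx]
    simp only [and_iff_left hx]
    simp
  · simp only [hx, and_false, if_false, mul_zero, Finset.sum_const_zero]

theorem lift1_mul (i : Q) (u v : Matrix Bool Bool ℂ) :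
    lift1 i u * lift1 i v = lift1 i (u * v) := by
  refine matrix_ext_ket fun y => ?_
  rw [← Matrix.mulVec_mulVec, lift1_ket, lift1_ket, Matrix.mulVec_sum]
  simp only [Matrix.mulVec_smul, lift1_ket, Function.update_self, Function.update_idem,
    Finset.smul_sum, smul_smul, Matrix.mul_apply, Finset.sum_smul]
  rw [Finset.sum_comm]
  simp [mul_comm]

theorem lift1_one (i : Q) : lift1 i (1 : Matrix Bool Bool ℂ) = 1 := by
  refine matrix_ext_ket fun y => ?_
  rw [lift1_ket]
  simp [Matrix.one_apply]

theorem lift1_conjTranspose (i : Q) (u : Matrix Bool Bool ℂ) :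
    (lift1 i u)ᴴ = lift1 i uᴴ := by
  ext x y
  simp only [lift1, Matrix.conjTranspose_apply, eq_comm (a := y _) (b := x _)]
  split_ifs <;> simp

theorem lift1_mem (i : Q) (u : Matrix.unitaryGroup Bool ℂ) :
    lift1 i u.1 ∈ Matrix.unitaryGroup (Q → Bool) ℂ := by
  rw [Matrix.mem_unitaryGroup_iff, Matrix.star_eq_conjTranspose, lift1_conjTranspose, lift1_mul,
    ← Matrix.star_eq_conjTranspose, Matrix.mem_unitaryGroup_iff.1 u.2, lift1_one]

theorem lift2_mul (i j : Q) (hij : i ≠ j) (u v : Matrix (Bool × Bool) (Bool × Bool) ℂ) :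
    lift2 i j u * lift2 i j v = lift2 i j (u * v) := by
  refine matrix_ext_ket fun y => ?_
  have h : ∀ b b' : Bool × Bool,
      Function.update (Function.update (Function.update (Function.update y i b.1) j b.2) i b'.1)
        j b'.2 = Function.update (Function.update y i b'.1) j b'.2 := by
    intro b b'
    rw [Function.update_comm hij.symm, Function.update_idem, Function.update_idem]
  rw [← Matrix.mulVec_mulVec, lift2_ket _ _ hij, lift2_ket _ _ hij, Matrix.mulVec_sum]
  simp only [Matrix.mulVec_smul, lift2_ket _ _ hij, Function.update_self, h,
    Function.update_of_ne hij, Finset.smul_sum, smul_smul, Matrix.mul_apply, Finset.sum_smul]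
  rw [Finset.sum_comm]
  simp [mul_comm]

theorem lift2_one (i j : Q) (hij : i ≠ j) :
    lift2 i j (1 : Matrix (Bool × Bool) (Bool × Bool) ℂ) = 1 := by
  refine matrix_ext_ket fun y => ?_
  rw [lift2_ket _ _ hij]
  simp [Matrix.one_apply]

theorem lift2_conjTranspose (i j : Q) (u : Matrix (Bool × Bool) (Bool × Bool) ℂ) :
    (lift2 i j u)ᴴ = lift2 i j uᴴ := by
  ext x y
  simp only [lift2, Matrix.conjTranspose_apply, eq_comm (a := y _) (b := x _)]
  split_ifs <;> simp

theorem lift2_mem (i j : Q) (hij : i ≠ j) (u : Matrix.unitaryGroup (Bool × Bool) ℂ) :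
    lift2 i j u.1 ∈ Matrix.unitaryGroup (Q → Bool) ℂ := by
  rw [Matrix.mem_unitaryGroup_iff, Matrix.star_eq_conjTranspose, lift2_conjTranspose,
    lift2_mul _ _ hij, ← Matrix.star_eq_conjTranspose, Matrix.mem_unitaryGroup_iff.1 u.2,
    lift2_one _ _ hij]

end Gates

/-! Gate lists. -/

/-- A one- or two-qubit unitary gate. -/
inductive Gate (Q : Type) : Type where
  | one (i : Q) (u : Matrix.unitaryGroup Bool ℂ) : Gate Q
  | two (i j : Q) (hij : i ≠ j) (u : Matrix.unitaryGroup (Bool × Bool) ℂ) : Gate Q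

/-- The circuit that applies the listed gates from left to right. -/
def gateCircuit {Q : Type} : List (Gate Q) → Circuit Q Unit
  | [] => .ret ()
  | .one i u :: l => .gate1 i u (gateCircuit l)
  | .two i j h u :: l => .gate2 i j h u (gateCircuit l)

theorem steps_gateCircuit {Q : Type} (l : List (Gate Q)) :
    (gateCircuit l).steps = l.length := by
  induction l with
  | nil => rfl
  | cons g l ih => cases g <;> simp [gateCircuit, Circuit.steps, ih]

section GateLists

variable {Q : Type} [Fintype Q] [DecidableEq Q]

/-- The operator of a gate on the whole register. -/
def Gate.mat : Gate Q → Op Q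
  | .one i u => lift1 i u.1
  | .two i j _ u => lift2 i j u.1

/-- The inverse gate. -/
def Gate.inv : Gate Q → Gate Q
  | .one i u => .one i u⁻¹
  | .two i j h u => .two i j h u⁻¹

theorem Gate.mat_mem (g : Gate Q) : g.mat ∈ Matrix.unitaryGroup (Q → Bool) ℂ := by
  cases g with
  | one i u => exact lift1_mem i u
  | two i j h u => exact lift2_mem i j h u

theorem Gate.mat_inv (g : Gate Q) : g.inv.mat = g.matᴴ := by
  cases g with
  | one i u => simp [Gate.inv, Gate.mat, lift1_conjTranspose, Matrix.star_eq_conjTranspose]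
  | two i j h u => simp [Gate.inv, Gate.mat, lift2_conjTranspose, Matrix.star_eq_conjTranspose]

/-- The operator of a gate list, whose first gate acts first. -/
def listMat : List (Gate Q) → Op Q
  | [] => 1
  | g :: l => listMat l * g.mat

theorem listMat_append (l l' : List (Gate Q)) : listMat (l ++ l') = listMat l' * listMat l := by
  induction l with
  | nil => simp [listMat]
  | cons g l ih => simp [listMat, ih, mul_assoc]

theorem listMat_mem (l : List (Gate Q)) : listMat l ∈ Matrix.unitaryGroup (Q → Bool) ℂ := by
  induction l with
  | nil => exact one_mem _
  | cons g l ih => exact mul_mem ih g.mat_mem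

/-- The gate list that undoes a gate list. -/
def invList (l : List (Gate Q)) : List (Gate Q) := (l.map Gate.inv).reverse

theorem length_invList (l : List (Gate Q)) : (invList l).length = l.length := by
  simp [invList]

theorem listMat_invList (l : List (Gate Q)) : listMat (invList l) = (listMat l)ᴴ := by
  induction l with
  | nil => simp [invList, listMat]
  | cons g l ih =>
    simp only [invList] at ih
    simp [invList, listMat, listMat_append, ih, Gate.mat_inv]

theorem conjTranspose_listMat_mul (l : List (Gate Q)) : (listMat l)ᴴ * listMat l = 1 :=
  Matrix.mem_unitaryGroup_iff'.1 (listMat_mem l)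

theorem run_gateCircuit (l : List (Gate Q)) (ρ : Op Q) :
    (gateCircuit l).run ρ () = listMat l * ρ * (listMat l)ᴴ := by
  induction l generalizing ρ with
  | nil => simp [gateCircuit, listMat, Circuit.run]
  | cons g l ih =>
    cases g <;> simp [gateCircuit, listMat, Circuit.run, ih, Gate.mat, mul_assoc]

theorem place_eq {ι : Type} [Fintype ι] (e : ι → Q → Bool) (ρ : Matrix ι ι ℂ) :
    place e ρ = placeMat e * ρ * (placeMat e)ᴴ := rfl

/-- Without measurements both sides of `Realizes` are conjugations of `ρ`, so a single linear
identity settles all `ρ` at once. -/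
theorem realizes_of_mul {ι κ : Type} [Fintype ι] [Fintype κ] {l : List (Gate Q)}
    {e : ι → Q → Bool} {e' : κ → Q → Bool} {T : Matrix κ ι ℂ}
    (h : listMat l * placeMat e = placeMat e' * T) : Realizes (gateCircuit l) e e' T := by
  intro ρ
  have h' := congrArg Matrix.conjTranspose h
  simp only [Matrix.conjTranspose_mul] at h'
  rw [run_gateCircuit, place_eq, place_eq]
  calc _ = (listMat l * placeMat e) * ρ * ((placeMat e)ᴴ * (listMat l)ᴴ) := by
        simp only [Matrix.mul_assoc]
    _ = _ := by rw [h, h']; simp only [Matrix.mul_assoc]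

theorem realizes_of_ket {ι κ : Type} [Fintype ι] [Fintype κ] [DecidableEq ι] [DecidableEq κ]
    {l : List (Gate Q)} {e : ι → Q → Bool} {e' : κ → Q → Bool} {T : Matrix κ ι ℂ}
    (h : ∀ k, listMat l *ᵥ ket (e k) = ∑ j, T j k • ket (e' j)) :
    Realizes (gateCircuit l) e e' T := by
  refine realizes_of_mul (matrix_ext_ket fun k => ?_)
  rw [← Matrix.mulVec_mulVec, placeMat_ket, h, mulVec_placeMat_mul]

end GateLists

/-! Isometries. -/

section Isometry

variable {ι κ : Type} [Fintype ι] [Fintype κ] [DecidableEq ι] [DecidableEq κ]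

/-- The operator `V` on the range of the isometry `B`, extended by the identity. -/
def extendOp (B : Matrix ι κ ℂ) (V : Matrix κ κ ℂ) : Matrix ι ι ℂ := 1 + B * (V - 1) * Bᴴ

theorem extendOp_mul_self {B : Matrix ι κ ℂ} (hB : Bᴴ * B = 1) (V : Matrix κ κ ℂ) :
    extendOp B V * B = B * V := by
  rw [extendOp, Matrix.add_mul, Matrix.mul_assoc, hB, Matrix.mul_sub, Matrix.one_mul,
    Matrix.mul_one, Matrix.mul_one]
  abel

theorem extendOp_mulVec_of_orthogonal {B : Matrix ι κ ℂ} (V : Matrix κ κ ℂ) {v : ι → ℂ}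
    (hv : Bᴴ *ᵥ v = 0) : extendOp B V *ᵥ v = v := by
  rw [extendOp, Matrix.add_mulVec, ← Matrix.mulVec_mulVec, hv]
  simp

/-- The middle factor `Bᴴ * B` collapses, and `(V - 1) + (W - 1) + (V - 1)(W - 1) = VW - 1`. -/
theorem extendOp_mul {B : Matrix ι κ ℂ} (hB : Bᴴ * B = 1) (V W : Matrix κ κ ℂ) :
    extendOp B V * extendOp B W = extendOp B (V * W) := by
  have : B * (V - 1) * Bᴴ * (B * (W - 1) * Bᴴ) = B * ((V - 1) * (W - 1)) * Bᴴ := by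
    calc _ = B * (V - 1) * (Bᴴ * B) * (W - 1) * Bᴴ := by simp only [Matrix.mul_assoc]
      _ = _ := by rw [hB]; simp only [Matrix.mul_assoc, Matrix.one_mul]
  rw [extendOp, extendOp, extendOp, add_mul, mul_add, one_mul, mul_add, mul_one, this, one_mul,
    add_assoc]
  congr 1
  rw [← add_assoc, ← Matrix.add_mul, ← Matrix.add_mul, ← Matrix.mul_add, ← Matrix.mul_add]
  congr 3
  noncomm_ring

theorem extendOp_conjTranspose (B : Matrix ι κ ℂ) (V : Matrix κ κ ℂ) :
    (extendOp B V)ᴴ = extendOp B Vᴴ := by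
  simp [extendOp, Matrix.mul_assoc]

theorem extendOp_mem {B : Matrix ι κ ℂ} (hB : Bᴴ * B = 1) {V : Matrix κ κ ℂ}
    (hV : V ∈ Matrix.unitaryGroup κ ℂ) : extendOp B V ∈ Matrix.unitaryGroup ι ℂ := by
  rw [Matrix.mem_unitaryGroup_iff, Matrix.star_eq_conjTranspose] at *
  rw [extendOp_conjTranspose, extendOp_mul hB, hV]
  simp [extendOp]

end Isometry

/-! Products of two-level unitaries. -/

section TwoLevel

variable {Λ : Type} [Fintype Λ] [DecidableEq Λ]

/-- This is the adjoint of `extendOp_mul_self`, taken for `uᴴ`. -/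
theorem extendOp_placeMat_mulVec_apply {κ : Type} [Fintype κ] [DecidableEq κ] {f : κ → Λ}
    (hf : Function.Injective f) (u : Matrix κ κ ℂ) (v : Λ → ℂ) (b : κ) :
    (extendOp (placeMat f) u *ᵥ v) (f b) = (u *ᵥ (v ∘ f)) b := by
  have h : (placeMat f)ᴴ *ᵥ (extendOp (placeMat f) u *ᵥ v) = u *ᵥ ((placeMat f)ᴴ *ᵥ v) := by
    have := congrArg Matrix.conjTranspose (extendOp_mul_self (conjTranspose_placeMat_mul hf) uᴴ)
    rw [Matrix.conjTranspose_mul, extendOp_conjTranspose, Matrix.conjTranspose_mul,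
      Matrix.conjTranspose_conjTranspose] at this
    rw [Matrix.mulVec_mulVec, Matrix.mulVec_mulVec, this]
  rw [conjTranspose_placeMat_mulVec, conjTranspose_placeMat_mulVec] at h
  exact congrFun h b

theorem extendOp_placeMat_mulVec_apply_of_notMem {κ : Type} [Fintype κ] [DecidableEq κ]
    {f : κ → Λ} (u : Matrix κ κ ℂ) (v : Λ → ℂ) {k : Λ} (hk : ∀ b, k ≠ f b) :
    (extendOp (placeMat f) u *ᵥ v) k = v k := by
  rw [extendOp, Matrix.add_mulVec, Matrix.mul_assoc, ← Matrix.mulVec_mulVec, Pi.add_apply,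
    Matrix.one_mulVec]
  simp [Matrix.mulVec, dotProduct, placeMat, hk]

theorem extendOp_placeMat_ket {κ : Type} [Fintype κ] [DecidableEq κ]
    {f : κ → Λ} (u : Matrix κ κ ℂ) {k : Λ} (hk : ∀ b, k ≠ f b) :
    extendOp (placeMat f) u *ᵥ ket k = ket k := by
  refine extendOp_mulVec_of_orthogonal _ ?_
  rw [conjTranspose_placeMat_mulVec]
  ext b
  simp [ket_apply, (hk b).symm]

/-- The pair `p, q` as a map from `Bool`. -/
def pair {α : Type} (p q : α) (b : Bool) : α := if b then q else p

theorem pair_injective {α : Type} {p q : α} (h : p ≠ q) : Function.Injective (pair p q) := by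
  intro a b
  cases a <;> cases b <;> simp [pair, h, h.symm]

/-- Products of `k` unitaries each of which acts on one or two levels only. -/
inductive TwoLevelProd : ℕ → Matrix Λ Λ ℂ → Prop
  | one : TwoLevelProd 0 1
  | pair {k : ℕ} {V : Matrix Λ Λ ℂ} (p q : Λ) (h : p ≠ q) (u : Matrix.unitaryGroup Bool ℂ)
      (hV : TwoLevelProd k V) : TwoLevelProd (k + 1) (extendOp (placeMat (pair p q)) u.1 * V)
  | phase {k : ℕ} {V : Matrix Λ Λ ℂ} (p : Λ) (u : Matrix.unitaryGroup Unit ℂ)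
      (hV : TwoLevelProd k V) :
      TwoLevelProd (k + 1) (extendOp (placeMat fun _ : Unit => p) u.1 * V)

theorem TwoLevelProd.mem {k : ℕ} {V : Matrix Λ Λ ℂ} (h : TwoLevelProd k V) :
    V ∈ Matrix.unitaryGroup Λ ℂ := by
  induction h with
  | one => exact one_mem _
  | pair p q h u _ ih =>
    exact mul_mem (extendOp_mem (conjTranspose_placeMat_mul (pair_injective h)) u.2) ih
  | phase p u _ ih =>
    exact mul_mem (extendOp_mem (conjTranspose_placeMat_mul fun _ _ _ => rfl) u.2) ih

theorem TwoLevelProd.mul {k l : ℕ} {V W : Matrix Λ Λ ℂ} (h : TwoLevelProd k V)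
    (h' : TwoLevelProd l W) : TwoLevelProd (k + l) (V * W) := by
  induction h with
  | one => simpa using h'
  | pair p q h u _ ih =>
    rw [Matrix.mul_assoc, add_right_comm]
    exact .pair p q h u ih
  | phase p u _ ih =>
    rw [Matrix.mul_assoc, add_right_comm]
    exact .phase p u ih

theorem dotProduct_mulVec_unitary {V : Matrix Λ Λ ℂ} (h : V ∈ Matrix.unitaryGroup Λ ℂ)
    (v w : Λ → ℂ) : star (V *ᵥ v) ⬝ᵥ (V *ᵥ w) = star v ⬝ᵥ w := by
  rw [Matrix.star_mulVec, ← Matrix.dotProduct_mulVec, Matrix.mulVec_mulVec,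
    ← Matrix.star_eq_conjTranspose, Matrix.mem_unitaryGroup_iff'.1 h, Matrix.one_mulVec]

/-- The lower row is proportional to `(-y, x)` and the upper one to `(x̄, ȳ)`. The case `x = 0` is
separate because the norm could then vanish. -/
theorem exists_rotation (x y : ℂ) :
    ∃ u ∈ Matrix.unitaryGroup Bool ℂ, u true false * x + u true true * y = 0 := by
  by_cases hx : x = 0
  · by_cases hy : y = 0
    · exact ⟨1, one_mem _, by simp [hx, hy]⟩
    · refine ⟨xMat, xMat_mem, by simp [hx, xMat]⟩
  have hr : 0 < ‖x‖ ^ 2 + ‖y‖ ^ 2 := by positivity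
  have h1 : ((‖x‖ ^ 2 + ‖y‖ ^ 2 : ℝ) : ℂ) = x * star x + y * star y := by
    simp only [RCLike.star_def, Complex.mul_conj, Complex.normSq_eq_norm_sq]
    push_cast
    rfl
  set r : ℝ := Real.sqrt (‖x‖ ^ 2 + ‖y‖ ^ 2)
  have hr2 : ((r : ℂ))⁻¹ * (r : ℂ)⁻¹ * (x * star x + y * star y) = 1 := by
    rw [← h1, ← mul_inv, ← Complex.ofReal_mul, Real.mul_self_sqrt hr.le]
    exact inv_mul_cancel₀ (by exact_mod_cast hr.ne')
  refine ⟨Matrix.of fun a b => (r : ℂ)⁻¹ * (if a then (if b then x else -y) else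
    (if b then star y else star x)), ?_, by simp; ring⟩
  rw [Matrix.mem_unitaryGroup_iff]
  ext a b
  simp only [RCLike.star_def] at hr2
  cases a <;> cases b <;> simp [Matrix.mul_apply, Matrix.star_apply] <;>
    first
      | linear_combination hr2
      | ring1

/-- Two-level unitaries move a vector to the level `i`, up to a factor. -/
theorem exists_eliminate (i : Λ) (s : Finset Λ) (hi : i ∉ s) (v : Λ → ℂ) :
    ∃ V, TwoLevelProd s.card V ∧ (∀ k ∈ s, (V *ᵥ v) k = 0) ∧
      (∀ k, k ≠ i → k ∉ s → (V *ᵥ v) k = v k) ∧ ∀ k, k ≠ i → k ∉ s → V *ᵥ ket k = ket k := by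
  induction s using Finset.induction_on with
  | empty => exact ⟨1, .one, by simp, by simp, by simp⟩
  | insert j s hj ih =>
    have hij : i ≠ j := fun h => hi (by simp [h])
    obtain ⟨V, hV, h0, h1, h2⟩ := ih (fun h => hi (by simp [h]))
    obtain ⟨u, hu, hu0⟩ := exists_rotation ((V *ᵥ v) i) ((V *ᵥ v) j)
    have key : ∀ k, k ≠ i → k ≠ j → ∀ b, k ≠ pair i j b := by
      intro k hki hkj b
      cases b <;> simp [pair, hki, hkj]
    rw [Finset.card_insert_of_notMem hj]
    refine ⟨_, .pair i j hij ⟨u, hu⟩ hV, ?_, ?_, ?_⟩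
    · intro k hk
      rw [← Matrix.mulVec_mulVec]
      by_cases hkj : k = j
      · subst hkj
        have := extendOp_placeMat_mulVec_apply (pair_injective hij) u (V *ᵥ v) true
        rw [show pair i k true = k from rfl] at this
        rw [this]
        simpa [Matrix.mulVec, dotProduct, pair, add_comm] using hu0
      · have hks : k ∈ s := by simpa [hkj] using hk
        have hki : k ≠ i := fun h => hi (by simpa [h] using hk)
        rw [extendOp_placeMat_mulVec_apply_of_notMem _ _ (key k hki hkj)]
        exact h0 k hks
    · intro k hki hk
      simp only [Finset.mem_insert, not_or] at hk
      rw [← Matrix.mulVec_mulVec, extendOp_placeMat_mulVec_apply_of_notMem _ _ (key k hki hk.1)]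
      exact h1 k hki hk.2
    · intro k hki hk
      simp only [Finset.mem_insert, not_or] at hk
      rw [← Matrix.mulVec_mulVec, h2 k hki hk.2, extendOp_placeMat_ket _ (key k hki hk.1)]

/-- After the eliminations only the component at `i` is left. It has modulus one by unitarity, so
one further phase factor makes it `1`; hence `s.card + 1`. -/
theorem exists_eliminate_unit (i : Λ) (s : Finset Λ) (hi : i ∉ s) (v : Λ → ℂ)
    (hv : star v ⬝ᵥ v = 1) (h0 : ∀ k, k ≠ i → k ∉ s → v k = 0) :
    ∃ V, TwoLevelProd (s.card + 1) V ∧ V *ᵥ v = ket i ∧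
      ∀ k, k ≠ i → k ∉ s → V *ᵥ ket k = ket k := by
  obtain ⟨V, hV, h1, h2, h3⟩ := exists_eliminate i s hi v
  have hz : ∀ k, k ≠ i → (V *ᵥ v) k = 0 := by
    intro k hk
    by_cases hks : k ∈ s
    · exact h1 k hks
    · rw [h2 k hk hks, h0 k hk hks]
  have hn : star ((V *ᵥ v) i) * (V *ᵥ v) i = 1 := by
    have := dotProduct_mulVec_unitary hV.mem v v
    rw [hv, dotProduct, Finset.sum_eq_single i (fun k _ hk => by simp [hz k hk]) (by simp)] at this
    exact this
  have hu : Matrix.of (fun _ _ => star ((V *ᵥ v) i)) ∈ Matrix.unitaryGroup Unit ℂ := by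
    rw [Matrix.mem_unitaryGroup_iff]
    ext
    simpa [Matrix.mul_apply, Matrix.star_apply] using hn
  refine ⟨_, .phase i ⟨_, hu⟩ hV, ?_, ?_⟩
  · ext k
    rw [← Matrix.mulVec_mulVec]
    by_cases hk : k = i
    · subst hk
      rw [extendOp_placeMat_mulVec_apply (f := fun _ : Unit => k) (fun _ _ _ => rfl) _ _ ()]
      simpa [Matrix.mulVec, dotProduct, ket_apply] using hn
    · rw [extendOp_placeMat_mulVec_apply_of_notMem _ _ (by simpa using hk), hz k hk]
      simp [ket_apply, hk]
  · intro k hk hks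
    rw [← Matrix.mulVec_mulVec, h3 k hk hks, extendOp_placeMat_ket _ (by simpa using hk)]

/-- Induction on the set of levels that `V` may move: `exists_eliminate_unit` returns `V|i⟩` to
`|i⟩` without touching the levels outside, and the product then moves only the levels of the smaller
set. Elimination multiplies on the left, so it yields a left inverse of `V`. -/
theorem exists_twoLevelProd_mul_eq_one (s : Finset Λ) (V : Matrix Λ Λ ℂ)
    (hV : V ∈ Matrix.unitaryGroup Λ ℂ) (h : ∀ k ∉ s, V *ᵥ ket k = ket k) :
    ∃ k ≤ s.card ^ 2, ∃ W, TwoLevelProd k W ∧ W * V = 1 := by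
  induction s using Finset.induction_on generalizing V with
  | empty =>
    exact ⟨0, by simp, 1, .one, matrix_ext_ket fun k => by simp [h k]⟩
  | insert i s hi ih =>
    -- `V` fixes the outer levels, hence so does its adjoint, and `V|i⟩` has no component there.
    have hc : ∀ k, k ≠ i → k ∉ s → (V *ᵥ ket i) k = 0 := by
      intro k hk hks
      have := h k (by simp [hk, hks])
      have h' : Vᴴ *ᵥ ket k = ket k := by
        conv_lhs => rw [← this]
        rw [Matrix.mulVec_mulVec, ← Matrix.star_eq_conjTranspose,
          Matrix.mem_unitaryGroup_iff'.1 hV, Matrix.one_mulVec]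
      have := congrFun h' i
      rw [mulVec_ket] at this ⊢
      simpa [ket_apply, Ne.symm hk] using this
    obtain ⟨C, hC, hC1, hC2⟩ := exists_eliminate_unit i s hi (V *ᵥ ket i)
      (by rw [dotProduct_mulVec_unitary hV]; simp [ket]) hc
    obtain ⟨k, hk, W, hW, hW1⟩ := ih (C * V) (mul_mem hC.mem hV) (by
      intro k hk
      rw [← Matrix.mulVec_mulVec]
      by_cases hki : k = i
      · rw [hki, hC1]
      · rw [h k (by simp [hk, hki]), hC2 k hki hk])
    refine ⟨_, ?_, _, hW.mul hC, by rw [Matrix.mul_assoc, hW1]⟩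
    rw [Finset.card_insert_of_notMem hi]
    -- The count: `#s² + (#s + 1) ≤ (#s + 1)²`.
    nlinarith

/-- Every unitary is a product of quadratically many two-level unitaries. -/
theorem exists_twoLevelProd {V : Matrix Λ Λ ℂ} (hV : V ∈ Matrix.unitaryGroup Λ ℂ) :
    ∃ k ≤ Fintype.card Λ ^ 2, TwoLevelProd k V := by
  obtain ⟨k, hk, W, hW, h⟩ := exists_twoLevelProd_mul_eq_one Finset.univ (star V)
    (Unitary.star_mem hV) (by simp)
  refine ⟨k, hk, ?_⟩
  have : W = V := by
    rw [← Matrix.mul_one W, ← Matrix.mem_unitaryGroup_iff'.1 hV, ← Matrix.mul_assoc, h,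
      Matrix.one_mul]
  exact this ▸ hW

/-- Two orthonormal vectors can be rotated to two given levels. -/
theorem exists_unitary_pair {i j : Λ} (hij : i ≠ j) {v w : Λ → ℂ} (hv : star v ⬝ᵥ v = 1)
    (hw : star w ⬝ᵥ w = 1) (hvw : star v ⬝ᵥ w = 0) :
    ∃ V ∈ Matrix.unitaryGroup Λ ℂ, V *ᵥ v = ket i ∧ V *ᵥ w = ket j := by
  obtain ⟨V, hV, hVv, -⟩ := exists_eliminate_unit i (Finset.univ.erase i) (by simp) v hv
    (by simp +contextual)
  -- Orthogonality survives `V`, so the second elimination can leave the level `i` alone.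
  have h0 : (V *ᵥ w) i = 0 := by
    have := dotProduct_mulVec_unitary hV.mem v w
    rw [hVv, hvw] at this
    simpa [ket] using this
  obtain ⟨W, hW, hWw, hW2⟩ := exists_eliminate_unit j ((Finset.univ.erase i).erase j) (by simp)
    (V *ᵥ w) (by rw [dotProduct_mulVec_unitary hV.mem, hw]) (by
      intro k hk hk'
      simp only [Finset.mem_erase, Finset.mem_univ, hk, ne_eq, not_false_eq_true, and_true,
        true_and, not_not] at hk'
      rw [hk', h0])
  refine ⟨W * V, mul_mem hW.mem hV.mem, ?_, ?_⟩
  · rw [← Matrix.mulVec_mulVec, hVv, hW2 i hij (by simp)]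
  · rw [← Matrix.mulVec_mulVec, hWw]

end TwoLevel

/-! Controlled gates and the Toffoli gate. -/

/-- The controlled `u`; the first qubit is the control. -/
def ctrlMat (u : Matrix Bool Bool ℂ) : Matrix (Bool × Bool) (Bool × Bool) ℂ :=
  fun r c => if r.1 = c.1 then (if c.1 then u r.2 c.2 else if r.2 = c.2 then 1 else 0) else 0

theorem ctrlMat_mem (u : Matrix.unitaryGroup Bool ℂ) :
    ctrlMat u.1 ∈ Matrix.unitaryGroup (Bool × Bool) ℂ := by
  have h := fun i j => congrFun (congrFun (Matrix.mem_unitaryGroup_iff.1 u.2) i) j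
  simp only [Matrix.mul_apply, Matrix.star_apply, Fintype.sum_bool, Matrix.one_apply,
    RCLike.star_def] at h
  rw [Matrix.mem_unitaryGroup_iff]
  ext ⟨i, i'⟩ ⟨j, j'⟩
  cases i <;> cases j <;> simp [ctrlMat, Matrix.mul_apply, Matrix.star_apply,
    Fintype.sum_prod_type, Matrix.one_apply, h] <;>
    cases i' <;> cases j' <;> simp

/-- The particle-number preserving two-qubit unitary that acts by `u` on one particle. -/
def hopMat (u : Matrix Bool Bool ℂ) : Matrix (Bool × Bool) (Bool × Bool) ℂ :=
  fun r c => if r.1 = r.2 ∨ c.1 = c.2 then (if r = c then 1 else 0) else u r.2 c.2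

theorem hopMat_mem (u : Matrix.unitaryGroup Bool ℂ) :
    hopMat u.1 ∈ Matrix.unitaryGroup (Bool × Bool) ℂ := by
  have h := fun i j => congrFun (congrFun (Matrix.mem_unitaryGroup_iff.1 u.2) i) j
  simp only [Matrix.mul_apply, Matrix.star_apply, Fintype.sum_bool, Matrix.one_apply,
    RCLike.star_def] at h
  have h' := fun i j => (add_comm _ _).trans (h i j)
  rw [Matrix.mem_unitaryGroup_iff]
  ext ⟨i, i'⟩ ⟨j, j'⟩
  cases i <;> cases j <;> cases i' <;> cases j' <;> simp [hopMat, Matrix.mul_apply,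
    Matrix.star_apply, Fintype.sum_prod_type, h']

/-- A square root of `X`. -/
def sqrtXMat : Matrix Bool Bool ℂ :=
  Matrix.of fun r c => if r = c then (1 + Complex.I) / 2 else (1 - Complex.I) / 2

theorem sqrtXMat_mul_self : sqrtXMat * sqrtXMat = xMat := by
  have := Complex.I_sq
  ext i j
  cases i <;> cases j <;> simp [sqrtXMat, xMat, Matrix.mul_apply] <;> ring_nf <;> simp [this] <;>
    norm_num

theorem sqrtXMat_mem : sqrtXMat ∈ Matrix.unitaryGroup Bool ℂ := by
  have := Complex.I_sq
  rw [Matrix.mem_unitaryGroup_iff]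
  ext i j
  cases i <;> cases j <;> simp [sqrtXMat, Matrix.mul_apply, Matrix.star_apply] <;> ring_nf <;>
    simp [this, map_ofNat] <;> norm_num

section Kets

variable {Q : Type} [Fintype Q] [DecidableEq Q]

theorem cnot_ket {i j : Q} (hij : i ≠ j) (y : Q → Bool) :
    lift2 i j cnotMat *ᵥ ket y = ket (Function.update y j (xor (y i) (y j))) := by
  rw [lift2_ket _ _ hij, Finset.sum_eq_single (y i, xor (y i) (y j))]
  · simp [cnotMat]
  · rintro ⟨b, b'⟩ - h
    rw [cnotMat, if_neg, zero_smul]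
    rintro ⟨rfl, rfl⟩
    exact h rfl
  · simp

theorem xMat_ket (i : Q) (y : Q → Bool) :
    lift1 i xMat *ᵥ ket y = ket (Function.update y i !(y i)) := by
  rw [lift1_ket, Finset.sum_eq_single (!(y i))]
  · simp [xMat]
  · intro b _ h
    rw [xMat, if_neg h, zero_smul]
  · simp

/-- An operator `v` is already waiting on the target, so successive controlled gates accumulate as a
product of one-qubit matrices that is never expanded into kets. -/
theorem ctrl_lift1_ket {i j : Q} (hij : i ≠ j) (u v : Matrix Bool Bool ℂ) (y : Q → Bool) :
    lift2 i j (ctrlMat u) *ᵥ (lift1 j v *ᵥ ket y) = lift1 j (if y i then u * v else v) *ᵥ ket y := by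
  simp only [lift1_ket, Matrix.mulVec_sum, Matrix.mulVec_smul, lift2_ket _ _ hij,
    Function.update_of_ne hij, Function.update_self]
  simp only [Fintype.sum_prod_type, Fintype.sum_bool]
  have h : ∀ b b' : Bool, Function.update (Function.update (Function.update y j b) i (y i)) j b' =
      Function.update y j b' := by
    intro b b'
    rw [Function.update_comm hij.symm, Function.update_idem, Function.update_eq_self]
  cases hy : y i <;> rw [hy] at h <;> simp [ctrlMat, h, Matrix.mul_apply]
  module

theorem ctrl_ket {i j : Q} (hij : i ≠ j) (u : Matrix Bool Bool ℂ) (y : Q → Bool) :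
    lift2 i j (ctrlMat u) *ᵥ ket y = if y i then lift1 j u *ᵥ ket y else ket y := by
  have := ctrl_lift1_ket hij u 1 y
  rw [lift1_one, Matrix.one_mulVec] at this
  rw [this]
  split_ifs <;> simp [lift1_one]

theorem cnot_lift1_ket {i j k : Q} (hij : i ≠ j) (hik : i ≠ k) (hjk : j ≠ k)
    (v : Matrix Bool Bool ℂ) (y : Q → Bool) :
    lift2 i j cnotMat *ᵥ (lift1 k v *ᵥ ket y) =
      lift1 k v *ᵥ ket (Function.update y j (xor (y i) (y j))) := by
  simp only [lift1_ket, Matrix.mulVec_sum, Matrix.mulVec_smul, cnot_ket hij,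
    Function.update_of_ne hik, Function.update_of_ne hjk, Function.update_of_ne hjk.symm,
    Function.update_comm hjk]

theorem hop_ket_empty {p q : Q} (h : p ≠ q) (u : Matrix Bool Bool ℂ) {y : Q → Bool}
    (hp : y p = false) (hq : y q = false) : lift2 p q (hopMat u) *ᵥ ket y = ket y := by
  rw [lift2_ket _ _ h, Finset.sum_eq_single (false, false)]
  · simp only [hopMat, hp, hq, true_or, if_true, one_smul]
    rw [← hp, Function.update_eq_self, hp, ← hq, Function.update_eq_self]
  · rintro b - hb
    simp [hopMat, hp, hq, hb]
  · simp

/-- `hopMat` indexes `u` by the bit of the second wire, so `false` stands for an excitation on `p`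
and `true` for one on `q`, in agreement with `pair`. -/
theorem hop_ket_single {p q : Q} (h : p ≠ q) (u : Matrix Bool Bool ℂ) {x : Q → Bool}
    (hp : x p = false) (hq : x q = false) (c : Bool) :
    lift2 p q (hopMat u) *ᵥ ket (Function.update x (pair p q c) true) =
      ∑ b, u b c • ket (Function.update x (pair p q b) true) := by
  have e1 : Function.update x q false = x := by rw [← hq, Function.update_eq_self]
  have e2 : Function.update x p false = x := by rw [← hp, Function.update_eq_self]
  have e3 : Function.update (Function.update x p true) q false = Function.update x p true := by
    rw [Function.update_comm h, e1]
  have e4 : Function.update (Function.update (Function.update x q true) p true) q false =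
      Function.update x p true := by
    rw [Function.update_comm h, Function.update_idem, e1]
  have e5 : Function.update (Function.update (Function.update x q true) p false) q true =
      Function.update x q true := by
    rw [Function.update_comm h, Function.update_idem, Function.update_comm h.symm, e2]
  rw [lift2_ket _ _ h]
  cases c <;>
    simp [hopMat, pair, Fintype.sum_prod_type, h, h.symm, hp, hq, e2, e3, e4, e5, add_comm]

/-- The Toffoli gate with controls `a`, `b` and target `t`. -/
def toffoli {a b t : Q} (hab : a ≠ b) (hat : a ≠ t) (hbt : b ≠ t) : List (Gate Q) :=
  [.two b t hbt ⟨_, ctrlMat_mem ⟨_, sqrtXMat_mem⟩⟩, .two a b hab ⟨_, cnotMat_mem⟩,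
    .two b t hbt ⟨_, ctrlMat_mem (⟨_, sqrtXMat_mem⟩⁻¹)⟩, .two a b hab ⟨_, cnotMat_mem⟩,
    .two a t hat ⟨_, ctrlMat_mem ⟨_, sqrtXMat_mem⟩⟩]

/-- With bits read as numbers, the target receives the square root of `X` to the power `b - (a xor
b) + a = 2ab`; the second CNOT restores `b`. -/
theorem toffoli_ket {a b t : Q} (hab : a ≠ b) (hat : a ≠ t) (hbt : b ≠ t) (y : Q → Bool) :
    listMat (toffoli hab hat hbt) *ᵥ ket y = ket (Function.update y t (xor (y t) (y a && y b))) := by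
  have h0 : ket y = lift1 t 1 *ᵥ ket y := by rw [lift1_one, Matrix.one_mulVec]
  have e : ∀ b', b' = y b → Function.update y b b' = y := by
    rintro _ rfl
    exact Function.update_eq_self _ _
  have s1 : sqrtXMat * star sqrtXMat = 1 := Matrix.mem_unitaryGroup_iff.1 sqrtXMat_mem
  have s2 : star sqrtXMat * sqrtXMat = 1 := Matrix.mem_unitaryGroup_iff'.1 sqrtXMat_mem
  rw [h0]
  simp only [toffoli, listMat, Gate.mat, Matrix.one_mul, ← Matrix.mulVec_mulVec]
  rw [ctrl_lift1_ket hbt, cnot_lift1_ket hab hat hbt, ctrl_lift1_ket hbt,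
    cnot_lift1_ket hab hat hbt, ctrl_lift1_ket hat]
  cases ha : y a <;> cases hb : y b <;>
    simp [hab, ha, hb, e, s1, s2, sqrtXMat_mul_self, lift1_one, xMat_ket]

/-- If `a` and `d` are set and `b` is not, move both excitations to one on `b`. -/
def merge {a d b : Q} (had : a ≠ d) (hab : a ≠ b) (hdb : d ≠ b) : List (Gate Q) :=
  toffoli had hab hdb ++ [.two b a hab.symm ⟨_, cnotMat_mem⟩, .two b d hdb.symm ⟨_, cnotMat_mem⟩]

theorem merge_ket_of_not {a d b : Q} (had : a ≠ d) (hab : a ≠ b) (hdb : d ≠ b) {y : Q → Bool}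
    (hb : y b = false) (h : (y a && y d) = false) : listMat (merge had hab hdb) *ᵥ ket y = ket y := by
  rw [merge, listMat_append, ← Matrix.mulVec_mulVec, toffoli_ket, h]
  simp only [listMat, Gate.mat, Matrix.one_mul, ← Matrix.mulVec_mulVec, Bool.xor_false,
    Function.update_eq_self]
  rw [cnot_ket hab.symm, hb, Bool.false_xor, Function.update_eq_self, cnot_ket hdb.symm, hb,
    Bool.false_xor, Function.update_eq_self]

theorem merge_ket {a d b : Q} (had : a ≠ d) (hab : a ≠ b) (hdb : d ≠ b) {x : Q → Bool}
    (ha : x a = false) (hb : x b = false) (hd : x d = true) :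
    listMat (merge had hab hdb) *ᵥ ket (Function.update x a true) =
      ket (Function.update (Function.update x d false) b true) := by
  rw [merge, listMat_append, ← Matrix.mulVec_mulVec, toffoli_ket]
  simp only [listMat, Gate.mat, Matrix.one_mul, ← Matrix.mulVec_mulVec]
  rw [cnot_ket hab.symm, cnot_ket hdb.symm]
  congr 1
  ext q
  by_cases h1 : q = a
  · subst h1; simp [had, hab, hab.symm, ha, hb, hd, had.symm]
  by_cases h2 : q = b
  · subst h2; simp [hab.symm, hdb.symm, hab, hb, hd, had.symm, hdb]
  by_cases h3 : q = d
  · subst h3; simp [hab, hb, hd, had.symm, hdb, hab.symm]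
  · simp [h1, h2, h3]

/-- If `a` and `c` are set and `b` is not, move the excitation from `a` to `b`. -/
def divert {a c b : Q} (hac : a ≠ c) (hab : a ≠ b) (hcb : c ≠ b) : List (Gate Q) :=
  toffoli hac hab hcb ++ [.two b a hab.symm ⟨_, cnotMat_mem⟩]

theorem divert_ket_of_not {a c b : Q} (hac : a ≠ c) (hab : a ≠ b) (hcb : c ≠ b) {y : Q → Bool}
    (hb : y b = false) (h : (y a && y c) = false) :
    listMat (divert hac hab hcb) *ᵥ ket y = ket y := by
  rw [divert, listMat_append, ← Matrix.mulVec_mulVec, toffoli_ket, h]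
  simp only [listMat, Gate.mat, Matrix.one_mul, Bool.xor_false, Function.update_eq_self]
  rw [cnot_ket hab.symm, hb, Bool.false_xor, Function.update_eq_self]

theorem divert_ket {a c b : Q} (hac : a ≠ c) (hab : a ≠ b) (hcb : c ≠ b) {x : Q → Bool}
    (ha : x a = false) (hb : x b = false) (hc : x c = true) :
    listMat (divert hac hab hcb) *ᵥ ket (Function.update x a true) =
      ket (Function.update x b true) := by
  rw [divert, listMat_append, ← Matrix.mulVec_mulVec, toffoli_ket]
  simp only [listMat, Gate.mat, Matrix.one_mul]
  rw [cnot_ket hab.symm]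
  congr 1
  ext q
  by_cases h1 : q = a
  · subst h1; simp [hac.symm, hab, hab.symm, ha, hb, hc]
  by_cases h2 : q = b
  · subst h2; simp [hab.symm, hac.symm, hab, hb, hc]
  · simp [h1, h2]

/-! One-hot registers. -/

section OneHot

variable {Λ : Type} [Fintype Λ] [DecidableEq Λ]

/-- `U` acts by `V` on one excitation of the register `lev`, and fixes the empty register. -/
structure Acts (lev : Λ → Q) (U : Op Q) (V : Matrix Λ Λ ℂ) : Prop where
  empty : ∀ x : Q → Bool, (∀ k, x (lev k) = false) → U *ᵥ ket x = ket x
  single : ∀ x : Q → Bool, (∀ k, x (lev k) = false) → ∀ k,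
    U *ᵥ ket (Function.update x (lev k) true) =
      ∑ l, V l k • ket (Function.update x (lev l) true)

theorem acts_one (lev : Λ → Q) : Acts lev 1 1 where
  empty x _ := Matrix.one_mulVec _
  single x _ k := by simp [Matrix.one_apply]

theorem Acts.mul {lev : Λ → Q} {U U' : Op Q} {V V' : Matrix Λ Λ ℂ} (h : Acts lev U V)
    (h' : Acts lev U' V') : Acts lev (U * U') (V * V') where
  empty x hx := by rw [← Matrix.mulVec_mulVec, h'.empty x hx, h.empty x hx]
  single x hx k := by
    rw [← Matrix.mulVec_mulVec, h'.single x hx k, Matrix.mulVec_sum]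
    simp only [Matrix.mulVec_smul, h.single x hx, Finset.smul_sum, smul_smul, Matrix.mul_apply,
      Finset.sum_smul]
    rw [Finset.sum_comm]
    simp [mul_comm]

/-- In the application `φ l` is the ket with the excitation moved to the level `l`, so this and the
next lemma read off the columns required by `Acts`. -/
theorem sum_extendOp_placeMat_smul {κ E : Type} [Fintype κ] [DecidableEq κ] [AddCommGroup E]
    [Module ℂ E] {f : κ → Λ} (hf : Function.Injective f) (u : Matrix κ κ ℂ) (φ : Λ → E) (c : κ) :
    ∑ l, extendOp (placeMat f) u l (f c) • φ l = ∑ b, u b c • φ (f b) := by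
  have : ∀ l, extendOp (placeMat f) u l (f c) = ∑ b, u b c * (if l = f b then 1 else 0) := by
    intro l
    have h := congrFun (congrArg (fun A => A *ᵥ ket c)
      (extendOp_mul_self (conjTranspose_placeMat_mul hf) u)) l
    rw [mulVec_placeMat_mul] at h
    simp only [← Matrix.mulVec_mulVec, placeMat_ket] at h
    rw [mulVec_ket] at h
    simpa [ket_apply] using h
  simp only [this, Finset.sum_smul]
  rw [Finset.sum_comm]
  simp

theorem sum_extendOp_placeMat_smul_of_notMem {κ E : Type} [Fintype κ] [DecidableEq κ]
    [AddCommGroup E] [Module ℂ E] {f : κ → Λ} (u : Matrix κ κ ℂ) (φ : Λ → E) {k : Λ}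
    (hk : ∀ b, k ≠ f b) : ∑ l, extendOp (placeMat f) u l k • φ l = φ k := by
  have : ∀ l, extendOp (placeMat f) u l k = if l = k then 1 else 0 := by
    intro l
    have h := congrFun (extendOp_placeMat_ket u hk) l
    rw [mulVec_ket] at h
    simpa [ket_apply] using h
  simp [this]

/-- The gate does nothing when both of its wires are empty, so an excitation on any other level is
left alone without any control. -/
theorem acts_hop {lev : Λ → Q} (hl : Function.Injective lev) {p q : Λ} (h : p ≠ q)
    (u : Matrix Bool Bool ℂ) :
    Acts lev (lift2 (lev p) (lev q) (hopMat u)) (extendOp (placeMat (pair p q)) u) where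
  empty x hx := hop_ket_empty (hl.ne h) u (hx p) (hx q)
  single x hx k := by
    have e : ∀ b, lev (pair p q b) = pair (lev p) (lev q) b := by
      intro b
      cases b <;> rfl
    by_cases hk : ∃ c, k = pair p q c
    · obtain ⟨c, rfl⟩ := hk
      rw [sum_extendOp_placeMat_smul (pair_injective h), e,
        hop_ket_single (hl.ne h) u (hx p) (hx q) c]
      simp only [e]
    · push Not at hk
      rw [sum_extendOp_placeMat_smul_of_notMem _ _ hk, hop_ket_empty (hl.ne h)]
      · rw [Function.update_of_ne (hl.ne (Ne.symm (show k ≠ p from hk false))), hx]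
      · rw [Function.update_of_ne (hl.ne (Ne.symm (show k ≠ q from hk true))), hx]

/-- The phase `z` on `|1⟩`. -/
def phaseMat (z : ℂ) : Matrix Bool Bool ℂ := Matrix.diagonal fun b => if b then z else 1

theorem phaseMat_mem {z : ℂ} (hz : z * star z = 1) : phaseMat z ∈ Matrix.unitaryGroup Bool ℂ := by
  rw [Matrix.mem_unitaryGroup_iff, phaseMat, Matrix.star_eq_conjTranspose,
    Matrix.diagonal_conjTranspose, Matrix.diagonal_mul_diagonal, ← Matrix.diagonal_one]
  congr 1
  ext b
  cases b
  · simp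
  · simpa using hz

theorem lift1_phaseMat_ket (i : Q) (z : ℂ) (y : Q → Bool) :
    lift1 i (phaseMat z) *ᵥ ket y = (if y i then z else 1) • ket y := by
  rw [lift1_ket, Finset.sum_eq_single (y i)]
  · simp [phaseMat]
  · intro b _ hb
    simp [phaseMat, hb]
  · simp

theorem acts_phase {lev : Λ → Q} (hl : Function.Injective lev) (p : Λ) (u : Matrix Unit Unit ℂ) :
    Acts lev (lift1 (lev p) (phaseMat (u () ()))) (extendOp (placeMat fun _ : Unit => p) u) where
  empty x hx := by simp [lift1_phaseMat_ket, hx]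
  single x hx k := by
    rw [lift1_phaseMat_ket]
    by_cases hk : k = p
    · subst hk
      rw [sum_extendOp_placeMat_smul (f := fun _ : Unit => k) (fun _ _ _ => rfl) u _ ()]
      simp
    · rw [sum_extendOp_placeMat_smul_of_notMem _ _ (by simpa using hk),
        Function.update_of_ne (hl.ne (Ne.symm hk)), hx]
      simp

/-- This is the gain of the one-hot encoding: each factor costs exactly one gate, a hop for a pair
of levels and a phase for a single level. -/
theorem TwoLevelProd.exists_acts {lev : Λ → Q} (hl : Function.Injective lev) {k : ℕ}
    {V : Matrix Λ Λ ℂ} (h : TwoLevelProd k V) :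
    ∃ l : List (Gate Q), l.length = k ∧ Acts lev (listMat l) V := by
  induction h with
  | one => exact ⟨[], rfl, acts_one lev⟩
  | pair p q h u _ ih =>
    obtain ⟨l, hk, hA⟩ := ih
    refine ⟨l ++ [.two (lev p) (lev q) (hl.ne h) ⟨_, hopMat_mem u⟩], by simp [hk], ?_⟩
    rw [listMat_append]
    simpa [listMat, Gate.mat] using (acts_hop hl h u.1).mul hA
  | phase p u _ ih =>
    obtain ⟨l, hk, hA⟩ := ih
    have hz : u.1 () () * star (u.1 () ()) = 1 := by
      have := congrFun (congrFun (Matrix.mem_unitaryGroup_iff.1 u.2) ()) ()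
      simpa [Matrix.mul_apply, Matrix.star_apply] using this
    refine ⟨l ++ [.one (lev p) ⟨_, phaseMat_mem hz⟩], by simp [hk], ?_⟩
    rw [listMat_append]
    simpa [listMat, Gate.mat] using (acts_phase hl p u.1).mul hA

/-- Every unitary on `L` levels is carried out on a one-hot register by `L²` gates. -/
theorem exists_acts {lev : Λ → Q} (hl : Function.Injective lev) {V : Matrix Λ Λ ℂ}
    (hV : V ∈ Matrix.unitaryGroup Λ ℂ) :
    ∃ l : List (Gate Q), l.length ≤ Fintype.card Λ ^ 2 ∧ Acts lev (listMat l) V := by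
  obtain ⟨k, hk, h⟩ := exists_twoLevelProd hV
  obtain ⟨l, rfl, hA⟩ := h.exists_acts hl
  exact ⟨l, hk, hA⟩

end OneHot

end Kets

/-! ### Gate lists of which at most one member acts -/

section Lists

variable {Q : Type} [Fintype Q] [DecidableEq Q]

theorem listMat_flatMap_mulVec_of_fixed {α : Type} (l : List α) (f : α → List (Gate Q))
    (v : (Q → Bool) → ℂ) (h : ∀ a ∈ l, listMat (f a) *ᵥ v = v) :
    listMat (l.flatMap f) *ᵥ v = v := by
  induction l with
  | nil => simp [listMat]
  | cons a l ih =>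
    rw [List.flatMap_cons, listMat_append, ← Matrix.mulVec_mulVec, h a (by simp),
      ih fun b hb => h b (by simp [hb])]

/-- Members before `a` meet `v` and members after it meet `v'`, so both vectors have to be fixed by
the others. -/
theorem listMat_flatMap_mulVec_of_unique {α : Type} {l : List α} (hl : l.Nodup)
    (f : α → List (Gate Q)) (v v' : (Q → Bool) → ℂ) {a : α} (ha : a ∈ l)
    (hv : ∀ b, b ≠ a → listMat (f b) *ᵥ v = v) (hv' : ∀ b, b ≠ a → listMat (f b) *ᵥ v' = v')
    (h : listMat (f a) *ᵥ v = v') : listMat (l.flatMap f) *ᵥ v = v' := by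
  induction l with
  | nil => simp at ha
  | cons b l ih =>
    rw [List.flatMap_cons, listMat_append, ← Matrix.mulVec_mulVec]
    rw [List.nodup_cons] at hl
    by_cases hb : b = a
    · subst hb
      rw [h]
      exact listMat_flatMap_mulVec_of_fixed _ _ _ fun c hc => hv' c fun e => hl.1 (e ▸ hc)
    · rw [hv b hb]
      exact ih hl.2 ((List.mem_cons.1 ha).resolve_left (Ne.symm hb))

theorem mulVec_eq_self_of_support {ι : Type} [Fintype ι] [DecidableEq ι] {U : Matrix ι ι ℂ}
    {v : ι → ℂ} (h : ∀ y, v y ≠ 0 → U *ᵥ ket y = ket y) : U *ᵥ v = v := by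
  conv_lhs => rw [← sum_smul_ket v, Matrix.mulVec_sum]
  conv_rhs => rw [← sum_smul_ket v]
  refine Finset.sum_congr rfl fun y _ => ?_
  by_cases hy : v y = 0
  · simp [hy]
  · rw [Matrix.mulVec_smul, h y hy]

end Lists

/-! The ancilla register of the decoder. -/

/-- The ancillas: a one-hot register of weights, the wires that collect the non-symmetric part, a
second one-hot register of weights, and the qudit of phase estimation. -/
abbrev Anc (m g : ℕ) : Type := Fin (m + 1) ⊕ (Fin m × Fin m) ⊕ Fin (m + 1) ⊕ Fin g

/-- The number of ancillas. -/
def numAnc (m g : ℕ) : ℕ := Fintype.card (Anc m g)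

/-- The leak wires make this quadratic in `m`. Phase estimation measures and resets every ancilla,
so the number enters the step count. -/
theorem numAnc_eq (m g : ℕ) : numAnc m g = m + 1 + (m * m + (m + 1 + g)) := by
  simp [numAnc]

/-- The position of an ancilla. -/
@[irreducible] def ancIndex {m g : ℕ} : Anc m g ≃ Fin (numAnc m g) := Fintype.equivFin _

section Register

variable {m g : ℕ}

/-- The wire of an ancilla. -/
def slot (p : Anc m g) : Wires m (numAnc m g) := Sum.inr (Sum.inr (ancIndex p))

/-- The wire of a data qubit. -/
def dataWire (i : Fin m) : Wires m (numAnc m g) := Sum.inl i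

/-- The one-hot weight register. -/
def wtWire (w : Fin (m + 1)) : Wires m (numAnc m g) := slot (Sum.inl w)

/-- The wires that collect the non-symmetric part. -/
def leakWire (k w : Fin m) : Wires m (numAnc m g) := slot (Sum.inr (Sum.inl (k, w)))

/-- The second weight register. -/
def wtWire' (w : Fin (m + 1)) : Wires m (numAnc m g) := slot (Sum.inr (Sum.inr (Sum.inl w)))

/-- The qudit of phase estimation. -/
def quditWire (j : Fin g) : Wires m (numAnc m g) := slot (Sum.inr (Sum.inr (Sum.inr j)))

@[simp] theorem slot_inj {p q : Anc m g} : slot p = slot q ↔ p = q := by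
  simp [slot]

@[simp] theorem slot_ne_dataWire (p : Anc m g) (i : Fin m) : slot p ≠ dataWire i := by
  simp [slot, dataWire]

@[simp] theorem slot_ne_outWire (p : Anc m g) : slot p ≠ outWire := by
  simp [slot, outWire]

@[simp] theorem outWire_ne_slot (p : Anc m g) : outWire ≠ slot p := by
  simp [slot, outWire]

@[simp] theorem basis_slot (x : Fin m → Bool) (o : Bool) (z : Fin (numAnc m g) → Bool)
    (p : Anc m g) : basis x o z (slot p) = z (ancIndex p) := rfl

@[simp] theorem basis_dataWire (x : Fin m → Bool) (o : Bool) (z : Fin (numAnc m g) → Bool)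
    (i : Fin m) : basis x o z (dataWire i) = x i := rfl

@[simp] theorem basis_outWire {A : ℕ} (x : Fin m → Bool) (o : Bool) (z : Fin A → Bool) :
    basis x o z outWire = o := rfl

theorem wtWire_ne_dataWire (w : Fin (m + 1)) (i : Fin m) :
    (wtWire w : Wires m (numAnc m g)) ≠ dataWire i := slot_ne_dataWire _ _

theorem wtWire_ne_leakWire (w : Fin (m + 1)) (k l : Fin m) :
    (wtWire w : Wires m (numAnc m g)) ≠ leakWire k l := by
  simp [wtWire, leakWire]

theorem leakWire_ne_dataWire (k l : Fin m) (i : Fin m) :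
    (leakWire k l : Wires m (numAnc m g)) ≠ dataWire i := slot_ne_dataWire _ _

theorem wtWire'_ne_leakWire (w : Fin (m + 1)) (k l : Fin m) :
    (wtWire' w : Wires m (numAnc m g)) ≠ leakWire k l := by
  simp [wtWire', leakWire]

theorem wtWire_ne_wtWire' (w w' : Fin (m + 1)) :
    (wtWire w : Wires m (numAnc m g)) ≠ wtWire' w' := by
  simp [wtWire, wtWire']

theorem leakWire_inj {k l k' l' : Fin m} :
    (leakWire k l : Wires m (numAnc m g)) = leakWire k' l' ↔ k = k' ∧ l = l' := by
  simp [leakWire]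

theorem wtWire_injective : Function.Injective (wtWire : Fin (m + 1) → Wires m (numAnc m g)) :=
  fun _ _ h => by simpa [wtWire] using h

theorem wtWire'_injective : Function.Injective (wtWire' : Fin (m + 1) → Wires m (numAnc m g)) :=
  fun _ _ h => by simpa [wtWire'] using h

theorem quditWire_injective : Function.Injective (quditWire : Fin g → Wires m (numAnc m g)) :=
  fun _ _ h => by simpa [quditWire] using h

/-! The Dicke transform: it writes the weight of a symmetric state into the one-hot register. -/

/-- The amplitude with which an excitation of the current qubit raises the weight. -/
def raiseAmp (k w : ℕ) : ℝ := Real.sqrt (min 1 ((w + 1 : ℝ) / (k + 1)))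

/-- The amplitude with which the weight is kept. -/
def keepAmp (k w : ℕ) : ℝ := Real.sqrt (1 - min 1 ((w + 1 : ℝ) / (k + 1)))

/-- The rotation that merges the two ways to reach the weight `w + 1` with `k + 1` qubits. -/
def mergeMat (k w : ℕ) : Matrix Bool Bool ℂ :=
  Matrix.of fun r c => if r = c then (keepAmp k w : ℂ) else
    if c then (raiseAmp k w : ℂ) else -(raiseAmp k w : ℂ)

theorem mergeMat_mem (k w : ℕ) : mergeMat k w ∈ Matrix.unitaryGroup Bool ℂ := by
  have h : (keepAmp k w : ℂ) * keepAmp k w + (raiseAmp k w : ℂ) * raiseAmp k w = 1 := by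
    have h0 : 0 ≤ min 1 ((w + 1 : ℝ) / (k + 1)) := by positivity
    rw [← Complex.ofReal_mul, ← Complex.ofReal_mul, keepAmp, raiseAmp, Real.mul_self_sqrt h0,
      Real.mul_self_sqrt (by linarith [min_le_left 1 ((w + 1 : ℝ) / (k + 1))])]
    push_cast
    ring
  rw [Matrix.mem_unitaryGroup_iff]
  ext i j
  cases i <;> cases j <;> simp [mergeMat, Matrix.mul_apply, Matrix.star_apply] <;>
    first
      | linear_combination h
      | ring1

/-- If the weight is `w` and the data qubit `k` is excited, move both excitations to a leak wire. -/
def dickeMerge (k w : Fin m) : List (Gate (Wires m (numAnc m g))) :=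
  merge (wtWire_ne_dataWire w.castSucc k) (wtWire_ne_leakWire w.castSucc k w)
    (leakWire_ne_dataWire k w k).symm

/-- Rotate the leak wire into the weight `w + 1`. -/
def dickeHop (k w : Fin m) : List (Gate (Wires m (numAnc m g))) :=
  [.two (wtWire w.succ) (leakWire k w) (wtWire_ne_leakWire _ _ _)
    ⟨_, hopMat_mem ⟨_, mergeMat_mem k w⟩⟩]

theorem listMat_dickeHop (k w : Fin m) :
    listMat (dickeHop k w : List (Gate (Wires m (numAnc m g)))) =
      lift2 (wtWire w.succ) (leakWire k w) (hopMat (mergeMat k w)) := by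
  simp [dickeHop, listMat, Gate.mat]

/-- The gates that process the data qubit `k`. -/
def dickeStep (k : Fin m) : List (Gate (Wires m (numAnc m g))) :=
  (List.finRange m).flatMap (dickeMerge k) ++ (List.finRange m).flatMap (dickeHop k)

/-- The gates that prepare the weight register and process the first `k` data qubits. -/
def dickeGates : ℕ → List (Gate (Wires m (numAnc m g)))
  | 0 => [.one (wtWire 0) ⟨_, xMat_mem⟩]
  | k + 1 => dickeGates k ++ if h : k < m then dickeStep ⟨k, h⟩ else []

/-- For each `w`: five gates of the Toffoli, two CNOTs and one hop. -/
theorem length_dickeStep (k : Fin m) :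
    (dickeStep k : List (Gate (Wires m (numAnc m g)))).length = 8 * m := by
  simp [dickeStep, dickeMerge, dickeHop, merge, toffoli, List.length_flatMap]
  ring

theorem length_dickeGates_le (k : ℕ) :
    (dickeGates k : List (Gate (Wires m (numAnc m g)))).length ≤ 8 * m * k + 1 := by
  induction k with
  | zero => simp [dickeGates]
  | succ k ih =>
    rw [dickeGates, List.length_append]
    split_ifs
    · rw [length_dickeStep]; linarith
    · simp; linarith

theorem dickeMerge_ket_of_not (k w : Fin m) {y : Wires m (numAnc m g) → Bool}
    (hb : y (leakWire k w) = false) (h : y (wtWire w.castSucc) = false ∨ y (dataWire k) = false) :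
    listMat (dickeMerge k w) *ᵥ ket y = ket y := by
  refine merge_ket_of_not _ _ _ hb ?_
  rcases h with h | h <;> simp [h]

theorem dickeHop_ket_of_empty (k w : Fin m) {y : Wires m (numAnc m g) → Bool}
    (ha : y (wtWire w.succ) = false) (hb : y (leakWire k w) = false) :
    listMat (dickeHop k w) *ᵥ ket y = ket y := by
  rw [listMat_dickeHop]
  exact hop_ket_empty (wtWire_ne_leakWire _ _ _) _ ha hb

/-- What has leaked stays where it is in all later steps: merging needs a set weight, and the hops
find both of their wires empty. -/
theorem dickeStep_ket_of_empty (k : Fin m) {y : Wires m (numAnc m g) → Bool}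
    (ha : ∀ w, y (wtWire w) = false) (hb : ∀ w, y (leakWire k w) = false) :
    listMat (dickeStep k) *ᵥ ket y = ket y := by
  have h := listMat_flatMap_mulVec_of_fixed (List.finRange m) (dickeMerge k) (ket y)
    fun w _ => dickeMerge_ket_of_not k w (hb w) (Or.inl (ha _))
  rw [dickeStep, listMat_append, ← Matrix.mulVec_mulVec, h]
  exact listMat_flatMap_mulVec_of_fixed _ _ _ fun w _ => dickeHop_ket_of_empty k w (ha _) (hb w)

theorem dickeHops_ket_wtWire_zero (k : Fin m) {y : Wires m (numAnc m g) → Bool}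
    (ha : ∀ w, y (wtWire w) = false) (hb : ∀ w, y (leakWire k w) = false) :
    listMat ((List.finRange m).flatMap (dickeHop k)) *ᵥ
      ket (Function.update y (wtWire 0) true) = ket (Function.update y (wtWire 0) true) := by
  refine listMat_flatMap_mulVec_of_fixed _ _ _ fun w _ => dickeHop_ket_of_empty k w ?_ ?_
  · rw [Function.update_of_ne (wtWire_injective.ne (Fin.succ_ne_zero w)), ha]
  · rw [Function.update_of_ne (wtWire_ne_leakWire _ _ _).symm, hb]

/-- The hops of one step have pairwise disjoint wires, so a single excitation is seen by only one of
them. -/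
theorem dickeHops_ket (k : Fin m) {y : Wires m (numAnc m g) → Bool}
    (ha : ∀ w, y (wtWire w) = false) (hb : ∀ w, y (leakWire k w) = false) (w : Fin m) (c : Bool) :
    listMat ((List.finRange m).flatMap (dickeHop k)) *ᵥ
        ket (Function.update y (pair (wtWire w.succ) (leakWire k w) c) true) =
      ∑ b, mergeMat k w b c •
        ket (Function.update y (pair (wtWire w.succ) (leakWire k w) b) true) := by
  have hfix : ∀ b : Fin m, b ≠ w → ∀ c : Bool,
      listMat (dickeHop k b) *ᵥ
        ket (Function.update y (pair (wtWire w.succ) (leakWire k w) c) true) =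
        ket (Function.update y (pair (wtWire w.succ) (leakWire k w) c) true) := by
    intro b hbw c
    have h1 : (wtWire b.succ : Wires m (numAnc m g)) ≠ wtWire w.succ :=
      wtWire_injective.ne fun h => hbw (Fin.succ_injective _ h)
    have h2 : (leakWire k b : Wires m (numAnc m g)) ≠ leakWire k w := by
      simp [leakWire_inj, hbw]
    refine dickeHop_ket_of_empty k b ?_ ?_ <;> cases c
    · rw [pair, if_neg (by simp), Function.update_of_ne h1, ha]
    · rw [pair, if_pos rfl, Function.update_of_ne (wtWire_ne_leakWire _ _ _), ha]
    · rw [pair, if_neg (by simp), Function.update_of_ne (wtWire_ne_leakWire _ _ _).symm, hb]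
    · rw [pair, if_pos rfl, Function.update_of_ne h2, hb]
  refine listMat_flatMap_mulVec_of_unique (List.nodup_finRange m) _ _ _ (List.mem_finRange w)
    (fun b hbw => hfix b hbw c) ?_ ?_
  · intro b hbw
    simp only [Matrix.mulVec_sum, Matrix.mulVec_smul, hfix b hbw]
  · rw [listMat_dickeHop]
    exact hop_ket_single (wtWire_ne_leakWire _ _ _) _ (ha _) (hb _) c

theorem dickeMerges_ket_of_not (k : Fin m) {y : Wires m (numAnc m g) → Bool}
    (hb : ∀ w, y (leakWire k w) = false) (hd : y (dataWire k) = false) (w : Fin (m + 1)) :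
    listMat ((List.finRange m).flatMap (dickeMerge k)) *ᵥ
      ket (Function.update y (wtWire w) true) = ket (Function.update y (wtWire w) true) := by
  refine listMat_flatMap_mulVec_of_fixed _ _ _ fun w' _ =>
    dickeMerge_ket_of_not k w' ?_ (Or.inr ?_)
  · rw [Function.update_of_ne (wtWire_ne_leakWire _ _ _).symm, hb]
  · rw [Function.update_of_ne (wtWire_ne_dataWire _ _).symm, hd]

theorem dickeStep_ket_zero (k : Fin m) {y : Wires m (numAnc m g) → Bool}
    (ha : ∀ w, y (wtWire w) = false) (hb : ∀ w, y (leakWire k w) = false)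
    (hd : y (dataWire k) = false) :
    listMat (dickeStep k) *ᵥ ket (Function.update y (wtWire 0) true) =
      ket (Function.update y (wtWire 0) true) := by
  rw [dickeStep, listMat_append, ← Matrix.mulVec_mulVec, dickeMerges_ket_of_not k hb hd,
    dickeHops_ket_wtWire_zero k ha hb]

theorem dickeStep_ket_keep (k : Fin m) {y : Wires m (numAnc m g) → Bool}
    (ha : ∀ w, y (wtWire w) = false) (hb : ∀ w, y (leakWire k w) = false)
    (hd : y (dataWire k) = false) (w : Fin m) :
    listMat (dickeStep k) *ᵥ ket (Function.update y (wtWire w.succ) true) =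
      (keepAmp k w : ℂ) • ket (Function.update y (wtWire w.succ) true) +
      -(raiseAmp k w : ℂ) • ket (Function.update y (leakWire k w) true) := by
  have := dickeHops_ket k ha hb w false
  rw [Fintype.sum_bool, add_comm] at this
  rw [dickeStep, listMat_append, ← Matrix.mulVec_mulVec, dickeMerges_ket_of_not k hb hd]
  exact this

theorem dickeStep_ket_raise (k : Fin m) {y : Wires m (numAnc m g) → Bool}
    (ha : ∀ w, y (wtWire w) = false) (hb : ∀ w, y (leakWire k w) = false)
    (hd : y (dataWire k) = true) (w : Fin m) :
    listMat (dickeStep k) *ᵥ ket (Function.update y (wtWire w.castSucc) true) =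
      (raiseAmp k w : ℂ) •
        ket (Function.update (Function.update y (dataWire k) false) (wtWire w.succ) true) +
      (keepAmp k w : ℂ) •
        ket (Function.update (Function.update y (dataWire k) false) (leakWire k w) true) := by
  have h1 : listMat ((List.finRange m).flatMap (dickeMerge k)) *ᵥ
      ket (Function.update y (wtWire w.castSucc) true) =
      ket (Function.update (Function.update y (dataWire k) false) (leakWire k w) true) := by
    refine listMat_flatMap_mulVec_of_unique (List.nodup_finRange m) _ _ _ (List.mem_finRange w)
      (fun w' hw' => dickeMerge_ket_of_not k w' ?_ (Or.inl ?_))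
      (fun w' hw' => dickeMerge_ket_of_not k w' ?_ (Or.inr ?_)) ?_
    · rw [Function.update_of_ne (wtWire_ne_leakWire _ _ _).symm, hb]
    · rw [Function.update_of_ne (wtWire_injective.ne
        fun h => hw' (Fin.castSucc_injective _ h)), ha]
    · rw [Function.update_of_ne (by simp [leakWire_inj, hw']),
        Function.update_of_ne (leakWire_ne_dataWire _ _ _), hb]
    · rw [Function.update_of_ne (leakWire_ne_dataWire _ _ _).symm, Function.update_self]
    · exact merge_ket _ _ _ (ha _) (hb _) hd
  have := dickeHops_ket k (y := Function.update y (dataWire k) false)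
    (fun w => by rw [Function.update_of_ne (wtWire_ne_dataWire _ _), ha])
    (fun w => by rw [Function.update_of_ne (leakWire_ne_dataWire _ _ _), hb]) w true
  rw [Fintype.sum_bool, add_comm] at this
  rw [dickeStep, listMat_append, ← Matrix.mulVec_mulVec, h1]
  exact this

/-- The weight of the first `k` bits. -/
def prefixWeight (k : ℕ) (x : Fin m → Bool) : ℕ :=
  (Finset.univ.filter fun i : Fin m => (i : ℕ) < k ∧ x i = true).card

theorem prefixWeight_zero (x : Fin m → Bool) : prefixWeight 0 x = 0 := by
  simp [prefixWeight]

theorem prefixWeight_eq_weight (x : Fin m → Bool) : prefixWeight m x = weight x := by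
  simp [prefixWeight, weight]

theorem prefixWeight_succ (x : Fin m → Bool) (k : Fin m) :
    prefixWeight (k + 1) x = prefixWeight k x + if x k then 1 else 0 := by
  rw [prefixWeight, prefixWeight]
  split_ifs with h
  · have : (Finset.univ.filter fun i : Fin m => (i : ℕ) < k + 1 ∧ x i = true) =
        insert k (Finset.univ.filter fun i : Fin m => (i : ℕ) < k ∧ x i = true) := by
      ext i
      simp only [Finset.mem_filter, Finset.mem_univ, true_and, Finset.mem_insert, Fin.ext_iff]
      constructor
      · rintro ⟨h1, h2⟩
        by_cases hi : (i : ℕ) = k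
        · exact Or.inl hi
        · exact Or.inr ⟨by omega, h2⟩
      · rintro (h1 | h1)
        · exact ⟨by omega, by rwa [Fin.ext h1]⟩
        · exact ⟨by omega, h1.2⟩
    rw [this, Finset.card_insert_of_notMem (by simp)]
  · rw [add_zero]
    congr 1
    ext i
    simp only [Finset.mem_filter, Finset.mem_univ, true_and]
    constructor
    · rintro ⟨h1, h2⟩
      refine ⟨?_, h2⟩
      by_contra h3
      have : i = k := Fin.ext (by omega)
      exact h (this ▸ h2)
    · rintro ⟨h1, h2⟩
      exact ⟨by omega, h2⟩

theorem prefixWeight_le (k : ℕ) (x : Fin m → Bool) : prefixWeight k x ≤ k := by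
  have : (Finset.univ.filter fun i : Fin m => (i : ℕ) < k ∧ x i = true).card ≤
      (Finset.range k).card :=
    Finset.card_le_card_of_injOn (fun i => (i : ℕ)) (by intro i; simp +contextual)
      (fun i _ j _ h => Fin.ext h)
  simpa [prefixWeight] using this

/-- Data whose first `k` bits are cleared, and no ancilla excited. -/
def cleared (o : Bool) (k : ℕ) (x : Fin m → Bool) : Wires m (numAnc m g) → Bool :=
  basis (fun i => if (i : ℕ) < k then false else x i) o fun _ => false

/-- Basis states without an excitation in the weight registers or in the wires that the qubits from
`k` on leak into. -/
def Residual (k : ℕ) (y : Wires m (numAnc m g) → Bool) : Prop :=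
  (∀ w, y (wtWire w) = false) ∧ (∀ w, y (wtWire' w) = false) ∧
    ∀ k' : Fin m, k ≤ k' → ∀ w, y (leakWire k' w) = false

theorem update_cleared (o : Bool) (k : Fin m) (x : Fin m → Bool) :
    Function.update (cleared o k x : Wires m (numAnc m g) → Bool) (dataWire k) false =
      cleared o (k + 1) x := by
  ext q
  rw [Function.update_apply]
  rcases q with i | q
  · simp only [cleared, basis, Sum.elim_inl, dataWire, Sum.inl.injEq, Fin.ext_iff]
    by_cases h : (i : ℕ) = k
    · simp [h]
    · have : (i : ℕ) < k + 1 ↔ (i : ℕ) < k := by omega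
      simp [h, this]
  · simp [cleared, basis, dataWire]

theorem cleared_succ_of_not (o : Bool) (k : Fin m) (x : Fin m → Bool) (h : x k = false) :
    (cleared o (k + 1) x : Wires m (numAnc m g) → Bool) = cleared o k x := by
  rw [← update_cleared, Function.update_eq_self_iff]
  simp [cleared, h]

theorem residual_leak (o : Bool) (k : Fin m) (x : Fin m → Bool) (w : Fin m) :
    Residual (k + 1) (Function.update (cleared o (k + 1) x : Wires m (numAnc m g) → Bool)
      (leakWire k w) true) := by
  refine ⟨fun w' => ?_, fun w' => ?_, fun k' hk' w' => ?_⟩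
  · rw [Function.update_of_ne (wtWire_ne_leakWire _ _ _)]; rfl
  · rw [Function.update_of_ne (wtWire'_ne_leakWire _ _ _)]; rfl
  · rw [Function.update_of_ne]
    · rfl
    · rw [Ne, leakWire_inj]
      rintro ⟨rfl, -⟩
      omega

theorem Residual.mono {k k' : ℕ} (h : k ≤ k') {y : Wires m (numAnc m g) → Bool}
    (hy : Residual k y) : Residual k' y :=
  ⟨hy.1, hy.2.1, fun l hl => hy.2.2 l (h.trans hl)⟩

/-- Together with `raiseAmp_div` this keeps the amplitude of a bit string equal to its amplitude in
the Dicke state of the bits read so far, whichever value the new bit has. The identity behind it is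
`binom(k,w+1) (k+1) = binom(k+1,w+1) (k-w)`. -/
theorem keepAmp_div (k w : ℕ) (h : w < k) :
    1 / Real.sqrt (k.choose (w + 1)) * keepAmp k w = 1 / Real.sqrt ((k + 1).choose (w + 1)) := by
  -- Here the minimum in the amplitude is the quotient. The bound by `1` only makes `mergeMat`
  -- unitary for pairs `w > k`, which no weight of `k` bits reaches.
  have hw : ((w + 1 : ℝ)) / (k + 1) ≤ 1 := by
    rw [div_le_one (by positivity)]
    exact_mod_cast Nat.succ_le_succ h.le
  have h1 : (0 : ℝ) < k.choose (w + 1) := by exact_mod_cast Nat.choose_pos h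
  have h2 : (0 : ℝ) < (k + 1).choose (w + 1) := by exact_mod_cast Nat.choose_pos (by omega)
  have h3 := Nat.choose_mul_succ_eq k (w + 1)
  have h3' : (k.choose (w + 1) : ℝ) * (k + 1) = (k + 1).choose (w + 1) * (k - w) := by
    have : ((k + 1 - (w + 1) : ℕ) : ℝ) = k - w := by
      rw [Nat.add_sub_add_right, Nat.cast_sub h.le]
    rw [← this]
    exact_mod_cast h3
  rw [keepAmp, min_eq_right hw, one_div, one_div, ← Real.sqrt_inv, ← Real.sqrt_inv,
    ← Real.sqrt_mul (by positivity)]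
  congr 1
  field_simp
  linarith

theorem raiseAmp_div (k w : ℕ) (h : w ≤ k) :
    1 / Real.sqrt (k.choose w) * raiseAmp k w = 1 / Real.sqrt ((k + 1).choose (w + 1)) := by
  have hw : ((w + 1 : ℝ)) / (k + 1) ≤ 1 := by
    rw [div_le_one (by positivity)]
    exact_mod_cast Nat.succ_le_succ h
  have h1 : (0 : ℝ) < k.choose w := by exact_mod_cast Nat.choose_pos h
  have h2 : (0 : ℝ) < (k + 1).choose (w + 1) := by exact_mod_cast Nat.choose_pos (by omega)
  have h3 : ((k : ℝ) + 1) * k.choose w = (k + 1).choose (w + 1) * (w + 1) := by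
    exact_mod_cast Nat.add_one_mul_choose_eq k w
  rw [raiseAmp, min_eq_right hw, one_div, one_div, ← Real.sqrt_inv, ← Real.sqrt_inv,
    ← Real.sqrt_mul (by positivity)]
  congr 1
  field_simp
  linarith

/-- The invariant of the Dicke transform. The bits already read are cleared, the register holds
their weight with the amplitude of a Dicke state of `k` qubits, and the rest `z` is out of reach of
the later steps. For `k = m` the amplitude is the entry of `(dickeMat m)ᴴ` at `x`. -/
theorem dickeGates_ket (o : Bool) (x : Fin m → Bool) (k : ℕ) (hk : k ≤ m) :
    ∃ z : (Wires m (numAnc m g) → Bool) → ℂ, (∀ y, z y ≠ 0 → Residual k y) ∧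
      listMat (dickeGates k) *ᵥ ket (atOutData (o, x)) =
        ((1 / Real.sqrt (k.choose (prefixWeight k x)) : ℝ) : ℂ) •
          ket (Function.update (cleared o k x) (wtWire (Fin.ofNat _ (prefixWeight k x))) true) +
        z := by
  induction k with
  | zero =>
    refine ⟨0, by simp, ?_⟩
    simp only [dickeGates, listMat, Gate.mat, Matrix.one_mul, prefixWeight_zero]
    rw [xMat_ket]
    simp [cleared, atOutData, wtWire]
  | succ k ih =>
    obtain ⟨z, hz, hE⟩ := ih (by omega)
    obtain ⟨k, rfl⟩ : ∃ k' : Fin m, k = (k' : ℕ) := ⟨⟨k, hk⟩, rfl⟩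
    have hzfix : listMat (dickeStep k) *ᵥ z = z := by
      refine mulVec_eq_self_of_support fun y hy => ?_
      exact dickeStep_ket_of_empty k (hz y hy).1 ((hz y hy).2.2 k le_rfl)
    have ha : ∀ w, (cleared o k x : Wires m (numAnc m g) → Bool) (wtWire w) = false := by
      simp [cleared, wtWire]
    have hb : ∀ w, (cleared o k x : Wires m (numAnc m g) → Bool) (leakWire k w) = false := by
      simp [cleared, leakWire]
    have hd : (cleared o k x : Wires m (numAnc m g) → Bool) (dataWire k) = x k := by
      simp [cleared]
    have hle := prefixWeight_le k x
    -- The newly leaked component sits on `leakWire k w`, which `Residual (k + 1)` no longer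
    -- restricts.
    have hadd : ∀ (c : ℂ) (w : Fin m) (y : Wires m (numAnc m g) → Bool),
        (c • ket (Function.update (cleared o (k + 1) x) (leakWire k w) true) + z :
          (Wires m (numAnc m g) → Bool) → ℂ) y ≠ 0 → Residual (k + 1) y := by
      intro c w y hy
      by_cases hy' : y = Function.update (cleared o (k + 1) x) (leakWire k w) true
      · exact hy' ▸ residual_leak o k x w
      · refine Residual.mono (Nat.le_succ k) (hz y ?_)
        simpa [ket_apply, hy'] using hy
    rw [dickeGates, dif_pos k.2, Fin.eta, listMat_append, ← Matrix.mulVec_mulVec, hE,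
      Matrix.mulVec_add, hzfix, Matrix.mulVec_smul, prefixWeight_succ]
    cases hx : x k with
    | false =>
      rw [hx] at hd
      rw [cleared_succ_of_not o k x hx] at *
      simp only [Bool.false_eq_true, if_false, add_zero]
      -- Weight zero can be reached in one way only, so nothing is rotated, and both binomial
      -- coefficients are `1`.
      rcases hw : prefixWeight k x with _ | w
      · refine ⟨z, fun y hy => Residual.mono (Nat.le_succ k) (hz y hy), ?_⟩
        rw [show (Fin.ofNat (m + 1) 0) = 0 from rfl, dickeStep_ket_zero k ha hb hd]
        simp
      · have hwm : w < m := by omega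
        have : Fin.ofNat (m + 1) (w + 1) = (⟨w, hwm⟩ : Fin m).succ := by
          ext; simp [Nat.mod_eq_of_lt (show w + 1 < m + 1 by omega)]
        rw [this, dickeStep_ket_keep k ha hb hd, ← keepAmp_div k w (by omega)]
        refine ⟨_, hadd (((1 / Real.sqrt ((k : ℕ).choose (w + 1)) : ℝ) : ℂ) * -(raiseAmp k w : ℂ))
          ⟨w, hwm⟩, ?_⟩
        push_cast
        module
    | true =>
      rw [hx] at hd
      have hwm : prefixWeight k x < m := by omega
      have h1 : Fin.ofNat (m + 1) (prefixWeight k x) =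
          (⟨prefixWeight k x, hwm⟩ : Fin m).castSucc := by
        ext; simp [Nat.mod_eq_of_lt (show prefixWeight k x < m + 1 by omega)]
      have h2 : Fin.ofNat (m + 1) (prefixWeight k x + 1) =
          (⟨prefixWeight k x, hwm⟩ : Fin m).succ := by
        ext; simp [Nat.mod_eq_of_lt (show prefixWeight k x + 1 < m + 1 by omega)]
      simp only [if_true]
      rw [h1, h2, dickeStep_ket_raise k ha hb hd, update_cleared,
        ← raiseAmp_div k _ hle]
      refine ⟨_, hadd (((1 / Real.sqrt ((k : ℕ).choose (prefixWeight k x)) : ℝ) : ℂ) *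
        (keepAmp k (prefixWeight k x) : ℂ)) ⟨_, hwm⟩, ?_⟩
      push_cast
      module

end Register

/-! Dicke states. -/

theorem sum_card_true {ι E : Type} [Fintype ι] [DecidableEq ι] [AddCommMonoid E] (F : ℕ → E) :
    ∑ x : ι → Bool, F (Finset.univ.filter fun i => x i = true).card =
      ∑ w ∈ Finset.range (Fintype.card ι + 1), (Fintype.card ι).choose w • F w := by
  rw [← Finset.card_univ, ← Finset.sum_powerset_apply_card, Finset.powerset_univ]
  refine Fintype.sum_bijective (fun x : ι → Bool => Finset.univ.filter fun i => x i = true)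
    ⟨fun x y h => ?_, fun s => ⟨fun i => decide (i ∈ s), by simp⟩⟩ _ _ fun _ => rfl
  ext i
  have := Finset.ext_iff.1 h i
  simp only [Finset.mem_filter, Finset.mem_univ, true_and] at this
  exact Bool.eq_iff_iff.2 this

theorem sum_weight {m : ℕ} {E : Type} [AddCommMonoid E] (F : ℕ → E) :
    ∑ x : Fin m → Bool, F (weight x) = ∑ w ∈ Finset.range (m + 1), m.choose w • F w := by
  have := sum_card_true (ι := Fin m) F
  rw [Fintype.card_fin] at this
  exact this

theorem weight_le {m : ℕ} (x : Fin m → Bool) : weight x ≤ m := by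
  simpa [weight] using Finset.card_filter_le (Finset.univ : Finset (Fin m)) fun i => x i = true

theorem dicke_dotProduct {m w w' : ℕ} (hw : w ≤ m) :
    star (dicke m w) ⬝ᵥ dicke m w' = if w = w' then 1 else 0 := by
  have h0 : (0 : ℝ) < m.choose w := by exact_mod_cast Nat.choose_pos hw
  rw [dotProduct]
  set F : ℕ → ℂ := fun v =>
    if v = w then (if w = w' then ((1 / (m.choose w : ℝ) : ℝ) : ℂ) else 0) else 0 with hF
  have : ∀ x : Fin m → Bool, star (dicke m w) x * dicke m w' x = F (weight x) := by
    intro x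
    by_cases h : weight x = w
    · subst h
      by_cases h' : weight x = w'
      · subst h'
        simp only [hF, dicke, Pi.star_apply, if_true, RCLike.star_def, Complex.conj_ofReal,
          ← Complex.ofReal_mul]
        rw [div_mul_div_comm, Real.mul_self_sqrt h0.le, one_mul]
      · simp [hF, dicke, h']
    · simp [hF, dicke, h]
  rw [Finset.sum_congr rfl fun x _ => this x]
  rw [sum_weight, Finset.sum_eq_single w (fun v _ hv => by simp [hF, hv])
    (fun h => absurd (Finset.mem_range.2 (by omega)) h)]
  by_cases h : w = w'
  · have : (m.choose w : ℂ) ≠ 0 := by exact_mod_cast h0.ne'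
    rw [hF, ← h]
    simp [this]
  · simp [hF, h]

/-- The Dicke states as the columns of a matrix. -/
def dickeMat (m : ℕ) : Matrix (Fin m → Bool) (Fin (m + 1)) ℂ := Matrix.of fun x w => dicke m w x

theorem dickeMat_ket {m : ℕ} (w : Fin (m + 1)) : dickeMat m *ᵥ ket w = dicke m w := by
  rw [mulVec_ket]
  rfl

theorem conjTranspose_dickeMat_mulVec {m : ℕ} (v : (Fin m → Bool) → ℂ) (w : Fin (m + 1)) :
    ((dickeMat m)ᴴ *ᵥ v) w = star (dicke m w) ⬝ᵥ v := rfl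

theorem conjTranspose_dickeMat_mul (m : ℕ) : (dickeMat m)ᴴ * dickeMat m = 1 := by
  refine matrix_ext_ket fun w => ?_
  rw [← Matrix.mulVec_mulVec, dickeMat_ket, Matrix.one_mulVec]
  ext w'
  rw [conjTranspose_dickeMat_mulVec, dicke_dotProduct (by omega)]
  simp [ket_apply, Fin.ext_iff]

/-- The operator `V` on the Dicke states, extended by the identity. -/
def symOp {m : ℕ} (V : Matrix (Fin (m + 1)) (Fin (m + 1)) ℂ) : Op (Fin m) :=
  extendOp (dickeMat m) V

theorem symmetricUnitary_symOp {m : ℕ} {V : Matrix (Fin (m + 1)) (Fin (m + 1)) ℂ}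
    (hV : V ∈ Matrix.unitaryGroup (Fin (m + 1)) ℂ) : SymmetricUnitary (symOp V) := by
  refine ⟨extendOp_mem (conjTranspose_dickeMat_mul m) hV, fun v hv => ?_⟩
  refine extendOp_mulVec_of_orthogonal _ ?_
  ext w
  exact hv w (by omega)

theorem symOp_mulVec {m : ℕ} (V : Matrix (Fin (m + 1)) (Fin (m + 1)) ℂ) (z : Fin (m + 1) → ℂ) :
    symOp V *ᵥ (dickeMat m *ᵥ z) = dickeMat m *ᵥ (V *ᵥ z) := by
  rw [symOp, Matrix.mulVec_mulVec, extendOp_mul_self (conjTranspose_dickeMat_mul m),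
    Matrix.mulVec_mulVec]

/-! ### Operators on the symmetric subspace by conjugation with the Dicke transform -/

section Register

variable {m g : ℕ}

/-- No excitation, except possibly of the output qubit. -/
def blank (o : Bool) : Wires m (numAnc m g) → Bool := basis (fun _ => false) o fun _ => false

/-- No excitation, except possibly of the output qubit, and the weight `w` in the register. -/
def blankWeight (o : Bool) (w : Fin (m + 1)) : Wires m (numAnc m g) → Bool :=
  Function.update (blank o) (wtWire w) true

theorem blankWeight_injective (o : Bool) :
    Function.Injective (blankWeight o : Fin (m + 1) → Wires m (numAnc m g) → Bool) := by
  intro w w' h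
  have := congrFun h (wtWire w)
  rw [blankWeight, blankWeight, Function.update_self, Function.update_apply] at this
  by_contra hne
  rw [if_neg (wtWire_injective.ne hne)] at this
  simp [blank, wtWire] at this

variable (m g) in
/-- The data, with a given value of the output qubit. -/
abbrev dataPlace (o : Bool) : Matrix (Wires m (numAnc m g) → Bool) (Fin m → Bool) ℂ :=
  placeMat fun x => atOutData (o, x)

theorem dataPlace_isometry (o : Bool) :
    (dataPlace m g o)ᴴ * dataPlace m g o = 1 := by
  refine conjTranspose_placeMat_mul fun x y h => ?_
  ext i
  exact congrFun h (dataWire i)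

variable (m g) in
/-- The weight register, with a given value of the output qubit and no data. -/
abbrev weightPlace (o : Bool) : Matrix (Wires m (numAnc m g) → Bool) (Fin (m + 1)) ℂ :=
  placeMat (blankWeight o)

variable (m g) in
/-- The Dicke transform on all data qubits. -/
def dickeTransform : Matrix (Wires m (numAnc m g) → Bool) (Wires m (numAnc m g) → Bool) ℂ :=
  listMat (dickeGates m)

variable (m g) in
/-- What the Dicke transform leaves outside of the weight register. -/
def dickeRest (o : Bool) : Matrix (Wires m (numAnc m g) → Bool) (Fin m → Bool) ℂ :=
  dickeTransform m g * dataPlace m g o - weightPlace m g o * (dickeMat m)ᴴ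

theorem dickeRest_support (o : Bool) (x : Fin m → Bool) (y : Wires m (numAnc m g) → Bool)
    (h : dickeRest m g o y x ≠ 0) : Residual m y := by
  obtain ⟨z, hz, hE⟩ := dickeGates_ket (g := g) o x m le_rfl
  refine hz y ?_
  have h1 : (dickeTransform m g * dataPlace m g o) *ᵥ ket x =
      (weightPlace m g o * (dickeMat m)ᴴ) *ᵥ ket x + z := by
    rw [← Matrix.mulVec_mulVec, placeMat_ket, dickeTransform, hE, prefixWeight_eq_weight,
      mulVec_placeMat_mul]
    congr 1
    have hx : (cleared o m x : Wires m (numAnc m g) → Bool) = blank o := by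
      simp [cleared, blank]
    rw [hx, Finset.sum_eq_single (Fin.ofNat _ (weight x))]
    · have : weight x % (m + 1) = weight x :=
        Nat.mod_eq_of_lt (by have := weight_le x; omega)
      simp [blankWeight, dickeMat, dicke, this]
    · intro w _ hw
      have : weight x ≠ w := by
        intro h
        refine hw (Fin.ext ?_)
        simp [h]
      simp [dickeMat, dicke, this]
    · simp
  have h2 : dickeRest m g o *ᵥ ket x = z := by
    rw [dickeRest, Matrix.sub_mulVec, h1]
    simp
  rw [mulVec_ket] at h2
  rw [← h2]
  exact h

theorem dickeTransform_mul (o : Bool) :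
    dickeTransform m g * dataPlace m g o =
      weightPlace m g o * (dickeMat m)ᴴ + dickeRest m g o := by
  simp [dickeRest]

theorem conjTranspose_placeMat_mul_dickeRest (o : Bool) :
    (weightPlace m g o)ᴴ * dickeRest m g o = 0 := by
  refine matrix_ext_ket fun x => ?_
  rw [← Matrix.mulVec_mulVec, conjTranspose_placeMat_mulVec, mulVec_ket, Matrix.zero_mulVec]
  ext w
  by_contra h
  have := (dickeRest_support o x _ h).1 w
  simp [blankWeight] at this

/-- Symmetric states leak nothing, and this follows from unitarity alone. The transform takes the
Dicke states to the columns of `K + Z`, where `K` is the isometry onto the weight register and `Kᴴ *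
Z = 0`. Both `K` and `K + Z` are isometries, so `Zᴴ * Z = 0`. -/
theorem dickeRest_mul (o : Bool) :
    dickeRest m g o * dickeMat m = 0 := by
  have hK : (weightPlace m g o)ᴴ * weightPlace m g o = 1 :=
    conjTranspose_placeMat_mul (blankWeight_injective o)
  have hKZ := conjTranspose_placeMat_mul_dickeRest (m := m) (g := g) o
  have hB := conjTranspose_dickeMat_mul m
  have h1 : dickeTransform m g * dataPlace m g o * dickeMat m =
      weightPlace m g o + dickeRest m g o *
        dickeMat m := by
    rw [dickeTransform_mul, Matrix.add_mul, Matrix.mul_assoc, hB, Matrix.mul_one]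
  set Z := dickeRest m g o * dickeMat m with hZ
  set K := weightPlace m g o
  have hKZ' : Kᴴ * Z = 0 := by rw [hZ, ← Matrix.mul_assoc, hKZ, Matrix.zero_mul]
  have hZK : Zᴴ * K = 0 := by
    have := congrArg Matrix.conjTranspose hKZ'
    simpa using this
  have h2 : (K + Z)ᴴ * (K + Z) = 1 := by
    rw [← h1]
    simp only [Matrix.conjTranspose_mul]
    calc _ = (dickeMat m)ᴴ * ((dataPlace m g o)ᴴ * ((dickeTransform m g)ᴴ * dickeTransform m g) *
          dataPlace m g o) * dickeMat m := by simp only [Matrix.mul_assoc]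
      _ = 1 := by
        rw [dickeTransform, conjTranspose_listMat_mul, Matrix.mul_one, dataPlace_isometry,
          Matrix.mul_one, hB]
  rw [Matrix.conjTranspose_add, Matrix.add_mul, Matrix.mul_add, Matrix.mul_add, hK, hKZ', hZK,
    add_zero, zero_add, add_eq_left] at h2
  open scoped ComplexOrder in exact Matrix.conjTranspose_mul_self_eq_zero.1 h2

/-- An operator on the weight register, conjugated by the Dicke transform. -/
theorem conj_dickeTransform (o : Bool)
    {T : Matrix (Wires m (numAnc m g) → Bool) (Wires m (numAnc m g) → Bool) ℂ}
    {V : Matrix (Fin (m + 1)) (Fin (m + 1)) ℂ}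
    (hK : T * weightPlace m g o = weightPlace m g o * V)
    (hT : ∀ y, Residual m y → T *ᵥ ket y = ket y) :
    (dickeTransform m g)ᴴ * (T * (dickeTransform m g * dataPlace m g o)) =
      dataPlace m g o * symOp V := by
  have hZ : T * dickeRest m g o = dickeRest m g o := by
    refine matrix_ext_ket fun x => ?_
    rw [← Matrix.mulVec_mulVec]
    refine mulVec_eq_self_of_support fun y hy => hT y (dickeRest_support o x y ?_)
    rwa [mulVec_ket] at hy
  have hE : (dickeTransform m g)ᴴ * dickeTransform m g = 1 :=
    conjTranspose_listMat_mul _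
  have hEB : dickeTransform m g * dataPlace m g o * dickeMat m =
      weightPlace m g o := by
    rw [dickeTransform_mul, Matrix.add_mul, Matrix.mul_assoc, conjTranspose_dickeMat_mul,
      Matrix.mul_one, dickeRest_mul, add_zero]
  -- With `E` the transform on the data, `B` the Dicke states, `K` the weight register and `Z` the
  -- rest, `E = K Bᴴ + Z` and `K = E B`. So `T E = K V Bᴴ + Z = E + K (V - 1) Bᴴ = E (1 + B (V - 1)
  -- Bᴴ)`.
  have h1 : T * (dickeTransform m g * dataPlace m g o) = dickeTransform m g * dataPlace m g o * symOp V := by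
    rw [symOp, extendOp, Matrix.mul_add, Matrix.mul_one, ← Matrix.mul_assoc (_ * _),
      ← Matrix.mul_assoc (_ * _), hEB]
    rw [dickeTransform_mul, Matrix.mul_add, hZ, ← Matrix.mul_assoc, hK, Matrix.mul_sub,
      Matrix.sub_mul, Matrix.mul_one]
    abel
  rw [h1, Matrix.mul_assoc (dickeTransform m g), ← Matrix.mul_assoc, hE, Matrix.one_mul]

/-- The gates that carry out `l` on the weight register. -/
def onWeights (l : List (Gate (Wires m (numAnc m g)))) : List (Gate (Wires m (numAnc m g))) :=
  dickeGates m ++ l ++ invList (dickeGates m)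

theorem length_onWeights_le (l : List (Gate (Wires m (numAnc m g)))) :
    (onWeights l).length ≤ l.length + 16 * m ^ 2 + 2 := by
  have := length_dickeGates_le (m := m) (g := g) m
  simp only [onWeights, List.length_append, length_invList]
  nlinarith

theorem listMat_onWeights (l : List (Gate (Wires m (numAnc m g)))) :
    listMat (onWeights l) = (dickeTransform m g)ᴴ * (listMat l * dickeTransform m g) := by
  simp [onWeights, listMat_append, listMat_invList, dickeTransform, Matrix.mul_assoc]

/-- The `empty` field of `Acts` is what makes the operator trivial on the leaked states, that is,
off the symmetric subspace. -/
theorem realizes_symOp {l : List (Gate (Wires m (numAnc m g)))}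
    {V : Matrix (Fin (m + 1)) (Fin (m + 1)) ℂ} (h : Acts wtWire (listMat l) V) :
    Realizes (gateCircuit (onWeights l)) atData atData (symOp V) := by
  refine realizes_of_mul ?_
  have := conj_dickeTransform (g := g) false (T := listMat l) (V := V) ?_ ?_
  · rw [listMat_onWeights, Matrix.mul_assoc, Matrix.mul_assoc]
    exact this
  · refine matrix_ext_ket fun w => ?_
    rw [← Matrix.mulVec_mulVec, placeMat_ket, mulVec_placeMat_mul, blankWeight,
      h.single _ fun _ => rfl]
    rfl
  · exact fun y hy => h.empty y hy.1

/-- If the output qubit is set, move the weight to the second register. -/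
def divertAll : List (Gate (Wires m (numAnc m g))) :=
  (List.finRange (m + 1)).flatMap fun w =>
    divert (a := wtWire w) (c := outWire) (b := wtWire' w) (slot_ne_outWire _)
      (wtWire_ne_wtWire' _ _) (outWire_ne_slot _)

theorem length_divertAll :
    (divertAll : List (Gate (Wires m (numAnc m g)))).length = 6 * (m + 1) := by
  simp [divertAll, divert, toffoli, List.length_flatMap]
  ring

theorem divertAll_ket_of_not {y : Wires m (numAnc m g) → Bool} (hb : ∀ w, y (wtWire' w) = false)
    (h : (∀ w, y (wtWire w) = false) ∨ y outWire = false) :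
    listMat divertAll *ᵥ ket y = ket y := by
  refine listMat_flatMap_mulVec_of_fixed _ _ _ fun w _ => divert_ket_of_not _ _ _ (hb w) ?_
  rcases h with h | h <;> simp [h]

theorem divertAll_ket (w : Fin (m + 1)) :
    listMat divertAll *ᵥ ket (blankWeight true w : Wires m (numAnc m g) → Bool) =
      ket (Function.update (blank true) (wtWire' w) true) := by
  refine listMat_flatMap_mulVec_of_unique (List.nodup_finRange _) _ _ _ (List.mem_finRange w)
    (fun w' hw' => divert_ket_of_not _ _ _ ?_ ?_) (fun w' hw' => divert_ket_of_not _ _ _ ?_ ?_) ?_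
  · rw [blankWeight, Function.update_of_ne (wtWire_ne_wtWire' _ _).symm]; rfl
  · rw [blankWeight, Function.update_of_ne (wtWire_injective.ne hw')]; rfl
  · rw [Function.update_of_ne (wtWire'_injective.ne hw')]; rfl
  · rw [Function.update_of_ne (wtWire_ne_wtWire' _ _)]; rfl
  · exact divert_ket _ _ _ rfl rfl rfl

/-- The gates that carry out `l` on the weight register if the output qubit is set; the gates of `l`
act on the second register. -/
def controlledOnWeights (l : List (Gate (Wires m (numAnc m g)))) :
    List (Gate (Wires m (numAnc m g))) :=
  onWeights (divertAll ++ l ++ invList divertAll)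

theorem length_controlledOnWeights_le (l : List (Gate (Wires m (numAnc m g)))) :
    (controlledOnWeights l).length ≤ l.length + 16 * m ^ 2 + 12 * m + 14 := by
  refine (length_onWeights_le _).trans ?_
  simp only [List.length_append, length_invList, length_divertAll]
  omega

/-- No gate of `l` is controlled. The excitation reaches the second register only if the output
qubit is set; otherwise `l` acts on an empty register and does nothing. -/
theorem realizes_controlled_symOp {l : List (Gate (Wires m (numAnc m g)))}
    {V : Matrix (Fin (m + 1)) (Fin (m + 1)) ℂ} (h : Acts wtWire' (listMat l) V) :
    Realizes (gateCircuit (controlledOnWeights l)) atOutData atOutData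
      (controlled (symOp V)) := by
  set D : Matrix (Wires m (numAnc m g) → Bool) (Wires m (numAnc m g) → Bool) ℂ := listMat divertAll with hD
  have hDD : Dᴴ * D = 1 := conjTranspose_listMat_mul _
  have hDinv : ∀ {y y' : Wires m (numAnc m g) → Bool}, D *ᵥ ket y = ket y' →
      Dᴴ *ᵥ ket y' = ket y := by
    intro y y' hy
    rw [← hy, Matrix.mulVec_mulVec, hDD, Matrix.one_mulVec]
  have hT : listMat (divertAll ++ l ++ invList divertAll) = Dᴴ * (listMat l * D) := by
    simp [listMat_append, listMat_invList, hD, Matrix.mul_assoc]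
  have hfix : ∀ y : Wires m (numAnc m g) → Bool, (∀ w, y (wtWire' w) = false) →
      ((∀ w, y (wtWire w) = false) ∨ y outWire = false) →
      (Dᴴ * (listMat l * D)) *ᵥ ket y = ket y := by
    intro y h1 h2
    have := divertAll_ket_of_not h1 h2
    rw [← Matrix.mulVec_mulVec, ← Matrix.mulVec_mulVec, this, h.empty y h1]
    exact hDinv this
  have hres : ∀ y : Wires m (numAnc m g) → Bool, Residual m y →
      (Dᴴ * (listMat l * D)) *ᵥ ket y = ket y := fun y hy => hfix y hy.2.1 (Or.inl hy.1)
  -- A clear output qubit corresponds to `V = 1` on the weights, and `symOp 1 = 1`.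
  have hf := conj_dickeTransform (g := g) false (T := Dᴴ * (listMat l * D)) (V := 1) (by
    refine matrix_ext_ket fun w => ?_
    rw [← Matrix.mulVec_mulVec, placeMat_ket, Matrix.mul_one, placeMat_ket]
    refine hfix _ (fun w' => ?_) (Or.inr ?_)
    · rw [blankWeight, Function.update_of_ne (wtWire_ne_wtWire' _ _).symm]; rfl
    · exact Function.update_of_ne (slot_ne_outWire (Sum.inl w)).symm _ _) hres
  have ht := conj_dickeTransform (g := g) true (T := Dᴴ * (listMat l * D)) (V := V) (by
    refine matrix_ext_ket fun w => ?_
    rw [← Matrix.mulVec_mulVec, placeMat_ket, mulVec_placeMat_mul, ← Matrix.mulVec_mulVec,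
      ← Matrix.mulVec_mulVec, divertAll_ket, h.single _ (fun _ => rfl), Matrix.mulVec_sum]
    refine Finset.sum_congr rfl fun w' _ => ?_
    rw [Matrix.mulVec_smul, hDinv (divertAll_ket w')]) hres
  rw [symOp, show extendOp (dickeMat m) 1 = 1 by simp [extendOp], Matrix.mul_one] at hf
  refine realizes_of_ket fun k => ?_
  obtain ⟨o, x⟩ := k
  have hk : listMat (controlledOnWeights l) *ᵥ ket (atOutData (o, x)) =
      ((dickeTransform m g)ᴴ * ((Dᴴ * (listMat l * D)) * (dickeTransform m g * dataPlace m g o))) *ᵥ ket x := by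
    rw [controlledOnWeights, listMat_onWeights, hT]
    simp only [← Matrix.mulVec_mulVec, placeMat_ket]
  rw [hk, Fintype.sum_prod_type, Fintype.sum_bool]
  cases o
  · rw [hf, placeMat_ket]
    simp [controlled, Matrix.one_apply]
  · rw [ht, mulVec_placeMat_mul]
    simp [controlled]

end Register

/-! The circuits of phase estimation. -/

/-- The entries are geometric sums of the powers of `ω^{k'-k}`, a root of unity that is `1` only for
`k = k'`. -/
theorem qft_conjTranspose_mul (g : ℕ) [NeZero g] : (qft g)ᴴ * qft g = 1 := by
  have hg : (g : ℂ) ≠ 0 := by exact_mod_cast NeZero.ne g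
  have hω := Complex.isPrimitiveRoot_exp g (NeZero.ne g)
  have hconj : (starRingEnd ℂ) (Complex.exp (2 * Real.pi * Complex.I / g)) =
      (Complex.exp (2 * Real.pi * Complex.I / g))⁻¹ := by
    rw [← Complex.exp_conj, ← Complex.exp_neg]
    congr 1
    simp [neg_div, map_ofNat]
  set ω := Complex.exp (2 * Real.pi * Complex.I / g) with hωd
  have hω0 : ω ≠ 0 := Complex.exp_ne_zero _
  have hs : ((1 / Real.sqrt g : ℝ) : ℂ) * ((1 / Real.sqrt g : ℝ) : ℂ) = (g : ℂ)⁻¹ := by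
    rw [← Complex.ofReal_mul, div_mul_div_comm, Real.mul_self_sqrt (Nat.cast_nonneg g)]
    simp
  ext k k'
  have h1 : ∀ j : Fin g, (qft g)ᴴ k j * qft g j k' =
      (g : ℂ)⁻¹ * ((ω ^ (k : ℕ))⁻¹ * ω ^ (k' : ℕ)) ^ (j : ℕ) := by
    intro j
    simp only [qft, Matrix.conjTranspose_apply, ← hωd, RCLike.star_def, map_mul, map_pow, hconj,
      Complex.conj_ofReal]
    rw [← hs, mul_pow, ← pow_mul, inv_pow, inv_pow, ← pow_mul]
    rw [mul_comm (k : ℕ), mul_comm (k' : ℕ)]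
    ring
  rw [Matrix.mul_apply, Finset.sum_congr rfl fun j _ => h1 j, ← Finset.mul_sum,
    Fin.sum_univ_eq_sum_range fun j => ((ω ^ (k : ℕ))⁻¹ * ω ^ (k' : ℕ)) ^ j]
  by_cases h : k = k'
  · subst h
    have : (ω ^ (k : ℕ))⁻¹ * ω ^ (k : ℕ) = 1 := inv_mul_cancel₀ (pow_ne_zero _ hω0)
    simp [this, hg]
  · have hz : (ω ^ (k : ℕ))⁻¹ * ω ^ (k' : ℕ) ≠ 1 := by
      intro hz
      have : ω ^ (k' : ℕ) = ω ^ (k : ℕ) := by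
        rw [inv_mul_eq_div, div_eq_one_iff_eq (pow_ne_zero _ hω0)] at hz
        exact hz
      exact h (Fin.ext (hω.pow_inj k'.2 k.2 this).symm)
    have hzg : ((ω ^ (k : ℕ))⁻¹ * ω ^ (k' : ℕ)) ^ g = 1 := by
      rw [mul_pow, inv_pow, ← pow_mul, ← pow_mul, mul_comm, mul_comm (k : ℕ), mul_comm (k' : ℕ),
        pow_mul, pow_mul, hω.pow_eq_one]
      simp
    rw [geom_sum_eq hz, hzg]
    simp [h]

theorem qft_mem (g : ℕ) [NeZero g] : qft g ∈ Matrix.unitaryGroup (Fin g) ℂ :=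
  Matrix.mem_unitaryGroup_iff'.2 (qft_conjTranspose_mul g)

section Register

variable {m g : ℕ}

theorem quditWire_ne_dataWire (j : Fin g) (i : Fin m) :
    (quditWire j : Wires m (numAnc m g)) ≠ dataWire i := slot_ne_dataWire _ _

/-- The one-hot encoding of the qudit levels. -/
def oneHot (j : Fin g) : Fin (numAnc m g) → Bool :=
  fun k => decide (k = ancIndex (Sum.inr (Sum.inr (Sum.inr j))))

theorem oneHot_injective :
    Function.Injective (oneHot : Fin g → Fin (numAnc m g) → Bool) := by
  intro j j' h
  have := congrFun h (ancIndex (Sum.inr (Sum.inr (Sum.inr j))))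
  simpa [oneHot] using this

theorem atQudit_oneHot (j : Fin g) (x : Fin m → Bool) :
    (atQudit oneHot (j, x) : Wires m (numAnc m g) → Bool) =
      Function.update (atData x) (quditWire j) true := by
  ext q
  rcases q with i | ⟨⟨⟩⟩ | k
  · simp [atQudit, atData, basis, quditWire, slot]
  · simp [atQudit, atData, basis, quditWire, slot]
  · simp only [atQudit, atData, basis, Function.update_apply, quditWire, slot, Sum.elim_inr, oneHot,
      Sum.inr.injEq]
    split_ifs <;> simp_all

/-- The column `0` of the Fourier matrix is the uniform superposition, so one excitation on the
level `0` followed by the transform prepares it. -/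
theorem realizes_prepare [NeZero g] {l : List (Gate (Wires m (numAnc m g)))}
    (h : Acts quditWire (listMat l) (qft g)) :
    Realizes (gateCircuit (.one (quditWire 0) ⟨_, xMat_mem⟩ :: l)) atData (atQudit oneHot)
      (ancillaMat g m) := by
  refine realizes_of_ket fun x => ?_
  rw [listMat, ← Matrix.mulVec_mulVec, Gate.mat, xMat_ket,
    show (!(atData x : Wires m (numAnc m g) → Bool) (quditWire 0)) = true from rfl,
    h.single _ fun _ => rfl, Fintype.sum_prod_type]
  refine Finset.sum_congr rfl fun j _ => ?_
  rw [Finset.sum_eq_single x (fun y _ hy => by simp [ancillaMat, hy]) (by simp), atQudit_oneHot]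
  simp [ancillaMat, qft]

theorem realizes_invFourier {l : List (Gate (Wires m (numAnc m g)))}
    (h : Acts quditWire (listMat l) (qft g)ᴴ) :
    Realizes (gateCircuit l) (atQudit oneHot) (atQudit oneHot) (invQftMat g m) := by
  refine realizes_of_ket fun k => ?_
  obtain ⟨j, x⟩ := k
  rw [atQudit_oneHot, h.single _ fun _ => rfl, Fintype.sum_prod_type]
  refine Finset.sum_congr rfl fun j' _ => ?_
  rw [Finset.sum_eq_single x (fun y _ hy => by simp [invQftMat, hy]) (by simp),
    atQudit_oneHot]
  simp [invQftMat]

/-- The phase that the level `j` of the qudit puts on an excited data qubit. -/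
def levelPhase (g j : ℕ) : ℂ := (Complex.exp (Real.pi * Complex.I / g) ^ 2) ^ j

theorem levelPhase_mul_star (g j : ℕ) : levelPhase g j * star (levelPhase g j) = 1 := by
  have : ‖levelPhase g j‖ = 1 := by
    rw [levelPhase, norm_pow, norm_pow, show (Real.pi * Complex.I / g : ℂ) =
      ((Real.pi / g : ℝ) : ℂ) * Complex.I by push_cast; ring, Complex.norm_exp_ofReal_mul_I]
    simp
  rw [RCLike.star_def, Complex.mul_conj, Complex.normSq_eq_norm_sq, this]
  simp

variable (m g) in
/-- Controlled phases between every qudit wire and every data qubit. -/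
def ctrlPowGates : List (Gate (Wires m (numAnc m g))) :=
  (List.finRange g).flatMap fun j => (List.finRange m).flatMap fun i =>
    [.two (quditWire j) (dataWire i) (quditWire_ne_dataWire _ _)
      ⟨_, ctrlMat_mem ⟨_, phaseMat_mem (levelPhase_mul_star g j)⟩⟩]

theorem length_ctrlPowGates : (ctrlPowGates m g).length = g * m := by
  simp [ctrlPowGates, List.length_flatMap]

theorem listMat_flatMap_mulVec_of_smul {Q α : Type} [Fintype Q] [DecidableEq Q] (l : List α)
    (f : α → List (Gate Q)) (v : (Q → Bool) → ℂ) (c : α → ℂ)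
    (h : ∀ a, listMat (f a) *ᵥ v = c a • v) :
    listMat (l.flatMap f) *ᵥ v = (l.map c).prod • v := by
  induction l with
  | nil => simp [listMat]
  | cons a l ih =>
    rw [List.flatMap_cons, listMat_append, ← Matrix.mulVec_mulVec, h, Matrix.mulVec_smul, ih,
      smul_smul, List.map_cons, List.prod_cons]

/-- `U^j` is a tensor power of a diagonal matrix, so it is a phase on each data qubit; of the qudit
wires only the `j`-th is set, and it alone triggers its phases. -/
theorem ctrlPowGates_ket (j : Fin g) (x : Fin m → Bool) :
    listMat (ctrlPowGates m g) *ᵥ ket (atQudit oneHot (j, x)) =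
      (∏ i, if x i then levelPhase g j else 1) • ket (atQudit oneHot (j, x)) := by
  have h1 : ∀ j' : Fin g, (atQudit oneHot (j, x) : Wires m (numAnc m g) → Bool) (quditWire j') =
      decide (j' = j) := by
    intro j'
    simp [atQudit, quditWire, oneHot]
  have h2 : ∀ i : Fin m, (atQudit oneHot (j, x) : Wires m (numAnc m g) → Bool) (dataWire i) =
      x i := fun i => rfl
  have h := listMat_flatMap_mulVec_of_smul (List.finRange g) (fun j' => (List.finRange m).flatMap
    fun i => [Gate.two (quditWire j') (dataWire i) (quditWire_ne_dataWire _ _)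
      ⟨_, ctrlMat_mem ⟨_, phaseMat_mem (levelPhase_mul_star g j')⟩⟩])
    (ket (atQudit oneHot (j, x) : Wires m (numAnc m g) → Bool))
    (fun j' => ((List.finRange m).map fun i => if j' = j then
      (if x i then levelPhase g j' else 1) else 1).prod) fun j' => by
        refine listMat_flatMap_mulVec_of_smul _ _ _ _ fun i => ?_
        simp only [listMat, Gate.mat, Matrix.one_mul]
        rw [ctrl_ket (quditWire_ne_dataWire _ _), h1, lift1_phaseMat_ket, h2]
        by_cases hj : j' = j <;> simp [hj]
  rw [ctrlPowGates, h]
  congr 1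
  simp only [← Fin.prod_univ_def]
  rw [Finset.prod_eq_single j (fun j' _ hj => by simp [hj]) (by simp)]
  simp

theorem ctrlPowMat_ket (j : Fin g) (x : Fin m → Bool) :
    ctrlPowMat g m *ᵥ ket (j, x) = (∏ i, if x i then levelPhase g j else 1) • ket (j, x) := by
  have hR : tensorPow m (rMat g ^ 2) = Matrix.diagonal fun x =>
      ∏ i, if x i then Complex.exp (Real.pi * Complex.I / g) ^ 2 else 1 := by
    ext x y
    rw [tensorPow, rMat, Matrix.diagonal_pow, Matrix.diagonal_apply]
    split_ifs with h
    · subst h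
      refine Finset.prod_congr rfl fun i _ => ?_
      rw [Matrix.diagonal_apply_eq]
      by_cases hx : x i <;> simp [hx]
    · obtain ⟨i, hi⟩ := Function.ne_iff.1 h
      exact Finset.prod_eq_zero (Finset.mem_univ i) (Matrix.diagonal_apply_ne _ hi)
  have hp : ∀ x : Fin m → Bool,
      (∏ i, if x i then Complex.exp (Real.pi * Complex.I / g) ^ 2 else 1) ^ (j : ℕ) =
        ∏ i, if x i then levelPhase g j else 1 := by
    intro x
    rw [← Finset.prod_pow]
    refine Finset.prod_congr rfl fun i _ => ?_
    split_ifs <;> simp [levelPhase]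
  rw [mulVec_ket]
  ext ⟨j', y⟩
  rw [Matrix.col_apply, Pi.smul_apply, ket_apply, smul_eq_mul]
  by_cases hj : j' = j
  · subst hj
    by_cases hy : y = x
    · subst hy
      simp only [ctrlPowMat, if_true, hR, Matrix.diagonal_pow, Matrix.diagonal_apply_eq,
        Pi.pow_apply, hp, mul_one]
    · simp [ctrlPowMat, hR, Matrix.diagonal_pow, hy]
  · simp [ctrlPowMat, hj]

theorem realizes_ctrlPow :
    Realizes (gateCircuit (ctrlPowGates m g)) (atQudit oneHot) (atQudit oneHot)
      (ctrlPowMat g m) := by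
  refine realizes_of_mul (matrix_ext_ket fun k => ?_)
  obtain ⟨j, x⟩ := k
  rw [← Matrix.mulVec_mulVec, placeMat_ket, ctrlPowGates_ket, ← Matrix.mulVec_mulVec,
    ctrlPowMat_ket, Matrix.mulVec_smul, placeMat_ket]

end Register

/-! Runs of circuits. -/

namespace Circuit

variable {Q α β : Type} [Fintype Q] [DecidableEq Q]

theorem run_add [DecidableEq α] (c : Circuit Q α) (ρ σ : Op Q) :
    c.run (ρ + σ) = c.run ρ + c.run σ := by
  induction c generalizing ρ σ with
  | ret a => exact Pi.single_add (f := fun _ => Op Q) a ρ σ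
  | gate1 i u c ih => simp only [run, mul_add, add_mul, ih]
  | gate2 i j h u c ih => simp only [run, mul_add, add_mul, ih]
  | meas i c ih =>
    simp only [run, mul_add, add_mul, ih]
    abel

theorem run_smul [DecidableEq α] (c : Circuit Q α) (r : ℂ) (ρ : Op Q) :
    c.run (r • ρ) = r • c.run ρ := by
  induction c generalizing ρ with
  | ret a => exact Pi.single_smul (f := fun _ => Op Q) a r ρ
  | gate1 i u c ih => simp only [run, mul_smul_comm, smul_mul_assoc, ih]
  | gate2 i j h u c ih => simp only [run, mul_smul_comm, smul_mul_assoc, ih]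
  | meas i c ih => simp only [run, mul_smul_comm, smul_mul_assoc, ih, smul_add]

theorem run_zero [DecidableEq α] (c : Circuit Q α) : c.run (0 : Op Q) = 0 := by
  simpa using run_smul c 0 0

theorem run_sum [DecidableEq α] {ι : Type} (c : Circuit Q α) (s : Finset ι) (ρ : ι → Op Q) :
    c.run (∑ i ∈ s, ρ i) = ∑ i ∈ s, c.run (ρ i) := by
  classical
  induction s using Finset.induction_on with
  | empty => simp [run_zero]
  | insert i s hi ih => rw [Finset.sum_insert hi, Finset.sum_insert hi, run_add, ih]

/-- Runs are linear in the state, so branches with the same classical result may be added before the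
second circuit is applied. -/
theorem run_bind [Fintype α] [DecidableEq α] [DecidableEq β] (c : Circuit Q α)
    (f : α → Circuit Q β) (ρ : Op Q) (b : β) :
    (c.bind f).run ρ b = ∑ a, (f a).run (c.run ρ a) b := by
  induction c generalizing ρ with
  | ret a =>
    rw [Finset.sum_eq_single a (fun a' _ h => by simp [run, h, run_zero]) (by simp)]
    simp [bind, run]
  | gate1 i u c ih => exact ih _
  | gate2 i j h u c ih => exact ih _
  | meas i c ih =>
    simp only [bind, run, Pi.add_apply, ih, run_add, Finset.sum_add_distrib]

theorem run_bind_unit [DecidableEq β] (c : Circuit Q Unit) (f : Unit → Circuit Q β) (ρ : Op Q)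
    (b : β) : (c.bind f).run ρ b = (f ()).run (c.run ρ ()) b := by
  rw [run_bind]
  simp

theorem steps_bind_le (c : Circuit Q α) (f : α → Circuit Q β) (K : ℕ)
    (h : ∀ a, (f a).steps ≤ K) : (c.bind f).steps ≤ c.steps + K := by
  induction c with
  | ret a => simpa [bind, steps] using h a
  | gate1 i u c ih => simp only [bind, steps]; omega
  | gate2 i j _ u c ih => simp only [bind, steps]; omega
  | meas i c ih =>
    have h0 := ih false
    have h1 := ih true
    simp only [bind, steps]
    omega

theorem run_meas_apply (i : Q) (r : Bool) (ρ : Op Q) (x y : Q → Bool) :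
    (measProj i r * ρ * measProj i r) x y = if x i = r ∧ y i = r then ρ x y else 0 := by
  rw [measProj, Matrix.mul_diagonal, Matrix.diagonal_mul]
  by_cases hx : x i = r <;> by_cases hy : y i = r <;> simp [hx, hy]

theorem run_measureList {l : List Q} (hl : l.Nodup) (ρ : Op Q) (f : Q → Bool) (x y : Q → Bool) :
    (measureList l).run ρ f x y =
      if (∀ q, q ∉ l → f q = false) ∧ ∀ q ∈ l, x q = f q ∧ y q = f q then ρ x y else 0 := by
  induction l generalizing ρ f with
  | nil =>
    simp only [measureList, run, List.not_mem_nil, not_false_eq_true, forall_true_left,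
      false_imp_iff, implies_true, and_true]
    by_cases hf : f = fun _ => false
    · subst hf; simp
    · rw [Pi.single_eq_of_ne hf, if_neg]
      · rfl
      · exact fun h => hf (funext h)
  | cons q l ih =>
    rw [List.nodup_cons] at hl
    have key : ∀ r : Bool, ((measureList l).bind fun f => ret (Function.update f q r)).run
        (measProj q r * ρ * measProj q r) f x y =
        if r = f q then (if (∀ p, p ∉ q :: l → f p = false) ∧
          ∀ p ∈ q :: l, x p = f p ∧ y p = f p then ρ x y else 0) else 0 := by
      intro r
      -- The tail does not measure `q` and reports it as `false`, so the only outcome of the tail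
      -- that can lead to `f` is `f` with `q` reset to `false`.
      rw [run_bind, Matrix.sum_apply,
        Finset.sum_eq_single (Function.update f q false)]
      · simp only [run, Function.update_idem]
        by_cases hr : r = f q
        · subst hr
          rw [Function.update_eq_self, Pi.single_eq_same, ih hl.2, run_meas_apply, if_pos rfl]
          have h1 : (∀ p, p ∉ l → Function.update f q false p = false) ↔
              ∀ p, p ∉ q :: l → f p = false := by
            refine forall_congr' fun p => ?_
            by_cases hp : p = q
            · subst hp; simp
            · simp [hp]
          have h2 : (∀ p ∈ l, x p = Function.update f q false p ∧
              y p = Function.update f q false p) ↔ ∀ p ∈ l, x p = f p ∧ y p = f p := by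
            refine forall₂_congr fun p hp => ?_
            rw [Function.update_of_ne (ne_of_mem_of_not_mem hp hl.1)]
          simp only [h1, h2, List.forall_mem_cons]
          split_ifs <;> simp_all
        · rw [Pi.single_eq_of_ne, if_neg hr]
          · rfl
          · intro h
            have := congrFun h q
            simp only [Function.update_self] at this
            exact hr this.symm
      · intro f' _ hf'
        rw [run]
        by_cases h : f = Function.update f' q r
        · have hq : f' q = true := by
            by_contra hq
            rw [Bool.not_eq_true] at hq
            refine hf' ?_
            rw [h, Function.update_idem, ← hq, Function.update_eq_self]
          rw [h, Pi.single_eq_same, ih hl.2, if_neg]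
          rintro ⟨h', -⟩
          rw [h' q hl.1] at hq
          exact absurd hq (by simp)
        · rw [Pi.single_eq_of_ne h]
          rfl
      · simp
    rw [measureList, run, Pi.add_apply, Matrix.add_apply, key, key]
    cases f q <;> simp

theorem steps_measureList (l : List Q) : (measureList l).steps ≤ l.length := by
  induction l with
  | nil => simp [measureList, steps]
  | cons q l ih =>
    simp only [measureList, steps, List.length_cons]
    have := fun r : Bool => steps_bind_le (measureList l)
      (fun f => ret (Function.update f q r)) 0 fun _ => le_rfl
    have h0 := this false
    have h1 := this true
    omega

end Circuit

/-! ### States transported to the register -/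

section Place

variable {Q ι κ : Type} [Fintype Q] [DecidableEq Q] [Fintype ι] [Fintype κ]

theorem place_conj [DecidableEq κ] (e : κ → Q → Bool) (f : ι → κ) (ρ : Matrix ι ι ℂ) :
    place e (placeMat f * ρ * (placeMat f)ᴴ) = place (fun i => e (f i)) ρ := by
  classical
  have h : (placeMat e * placeMat f : Matrix (Q → Bool) ι ℂ) = placeMat fun i => e (f i) := by
    refine matrix_ext_ket fun i => ?_
    rw [← Matrix.mulVec_mulVec, placeMat_ket, placeMat_ket, placeMat_ket]
  rw [place_eq, place_eq, ← h, Matrix.conjTranspose_mul]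
  simp only [Matrix.mul_assoc]

theorem place_apply (e : ι → Q → Bool) (ρ : Matrix ι ι ℂ) (u v : Q → Bool) :
    place e ρ u v = ∑ k, ∑ l, if u = e k ∧ v = e l then ρ k l else 0 := by
  rw [place_eq, Matrix.mul_apply, Finset.sum_comm]
  refine Finset.sum_congr rfl fun l _ => ?_
  rw [Matrix.mul_apply, Finset.sum_mul]
  refine Finset.sum_congr rfl fun k _ => ?_
  by_cases h1 : u = e k <;> by_cases h2 : v = e l <;>
    simp [placeMat, Matrix.conjTranspose_apply, h1, h2]

theorem place_smul (e : ι → Q → Bool) (r : ℂ) (ρ : Matrix ι ι ℂ) :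
    place e (r • ρ) = r • place e ρ := by
  simp only [place_eq, Matrix.mul_smul, Matrix.smul_mul]

theorem place_sum {μ : Type} (e : ι → Q → Bool) (s : Finset μ) (ρ : μ → Matrix ι ι ℂ) :
    place e (∑ i ∈ s, ρ i) = ∑ i ∈ s, place e (ρ i) := by
  simp only [place_eq, Matrix.mul_sum, Matrix.sum_mul]

theorem conj_proj (T : Matrix κ ι ℂ) (v : ι → ℂ) : T * proj v * Tᴴ = proj (T *ᵥ v) := by
  rw [proj, proj, Matrix.mul_vecMulVec, Matrix.vecMulVec_mul, Matrix.star_mulVec]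

end Place

/-! Phase estimation. -/

theorem flipList_eq_gateCircuit {Q : Type} (f : Q → Bool) (l : List Q) :
    flipList f l = gateCircuit ((l.filter f).map fun q => .one q ⟨_, xMat_mem⟩) := by
  induction l with
  | nil => rfl
  | cons q l ih =>
    rw [flipList, List.filter_cons]
    split_ifs
    · rw [ih]; rfl
    · exact ih

theorem steps_flipList {Q : Type} (f : Q → Bool) (l : List Q) :
    (flipList f l).steps ≤ l.length := by
  rw [flipList_eq_gateCircuit, steps_gateCircuit, List.length_map]
  exact List.length_filter_le _ _

theorem listMat_flips_ket {Q : Type} [Fintype Q] [DecidableEq Q] (l : List Q) (hl : l.Nodup)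
    (y : Q → Bool) :
    listMat (l.map fun q => Gate.one q ⟨_, xMat_mem⟩) *ᵥ ket y =
      ket fun q => if q ∈ l then !(y q) else y q := by
  induction l generalizing y with
  | nil => simp [listMat]
  | cons p l ih =>
    rw [List.nodup_cons] at hl
    rw [List.map_cons, listMat, ← Matrix.mulVec_mulVec, Gate.mat, xMat_ket, ih hl.2]
    congr 1
    ext q
    by_cases hq : q = p
    · subst hq; simp [hl.1]
    · simp [hq]

section Estimation

variable {m A g : ℕ}

theorem nodup_ancWires : (ancWires m A).Nodup :=
  (List.nodup_finRange A).map fun _ _ h => by simpa using h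

theorem nodup_dataWires : (dataWires m A).Nodup :=
  (List.nodup_finRange m).map fun _ _ h => by simpa using h

theorem mem_ancWires (q : Wires m A) : q ∈ ancWires m A ↔ ∃ k, q = Sum.inr (Sum.inr k) := by
  simp [ancWires, eq_comm]

theorem mem_dataWires (q : Wires m A) : q ∈ dataWires m A ↔ ∃ i, q = Sum.inl i := by
  simp [dataWires, eq_comm]

theorem realizes_reset (z : Fin A → Bool) :
    Realizes (flipList (basis (fun _ => false) false z) (ancWires m A))
      (fun x : Fin m → Bool => basis x false z) atData (1 : Op (Fin m)) := by
  rw [flipList_eq_gateCircuit]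
  refine realizes_of_mul (matrix_ext_ket fun x => ?_)
  rw [← Matrix.mulVec_mulVec, placeMat_ket, listMat_flips_ket _ (nodup_ancWires.filter _),
    Matrix.mul_one, placeMat_ket]
  congr 1
  ext q
  simp only [List.mem_filter, mem_ancWires]
  rcases q with i | ⟨⟨⟩⟩ | k
  · simp [basis, atData]
  · simp [basis, atData]
  · cases hz : z k <;> simp [basis, atData, hz]

theorem run_measure_ancWires (z : Fin A → Bool) (σ : Op (Fin m)) (f : Wires m A → Bool) :
    (Circuit.measureList (ancWires m A)).run
      (place (fun x : Fin m → Bool => basis x false z) σ) f =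
      if f = basis (fun _ => false) false z then
        place (fun x : Fin m → Bool => basis x false z) σ else 0 := by
  ext u v
  rw [Circuit.run_measureList nodup_ancWires]
  by_cases h0 : place (fun x : Fin m → Bool => basis x false z) σ u v = 0
  · by_cases hf : f = basis (fun _ => false) false z <;> simp [h0, hf]
  have huv : ∃ x y, u = basis x false z ∧ v = basis y false z := by
    by_contra hne
    push Not at hne
    refine h0 ?_
    rw [place_apply]
    exact Finset.sum_eq_zero fun x _ => Finset.sum_eq_zero fun y _ =>
      if_neg fun h => hne x y h.1 h.2
  obtain ⟨x, y, rfl, rfl⟩ := huv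
  have : ((∀ q, q ∉ ancWires m A → f q = false) ∧ ∀ q ∈ ancWires m A,
      (basis x false z : Wires m A → Bool) q = f q ∧ (basis y false z : Wires m A → Bool) q = f q) ↔
      f = basis (fun _ => false) false z := by
    constructor
    · rintro ⟨h1, h2⟩
      ext q
      by_cases hq : q ∈ ancWires m A
      · obtain ⟨k, rfl⟩ := (mem_ancWires q).1 hq
        rw [← (h2 _ hq).1]
        rfl
      · rw [h1 q hq]
        rcases q with i | ⟨⟨⟩⟩ | k
        · rfl
        · rfl
        · exact absurd ((mem_ancWires _).2 ⟨k, rfl⟩) hq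
    · rintro rfl
      refine ⟨fun q hq => ?_, fun q hq => ?_⟩
      · rcases q with i | ⟨⟨⟩⟩ | k
        · rfl
        · rfl
        · exact absurd ((mem_ancWires _).2 ⟨k, rfl⟩) hq
      · obtain ⟨k, rfl⟩ := (mem_ancWires q).1 hq
        exact ⟨rfl, rfl⟩
  by_cases hf : f = basis (fun _ => false) false z
  · rw [if_pos (this.2 hf), if_pos hf]
  · rw [if_neg (mt this.1 hf), if_neg hf]
    rfl

theorem prod_ite_weight (c : ℂ) (x : Fin m → Bool) :
    (∏ i, if x i then c else 1) = c ^ weight x := by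
  rw [Finset.prod_ite, Finset.prod_const, Finset.prod_const_one, mul_one]
  rfl

theorem ancillaMat_ket (x : Fin m → Bool) :
    ancillaMat g m *ᵥ ket x = ∑ j, ((1 / Real.sqrt g : ℝ) : ℂ) • ket (j, x) := by
  rw [mulVec_ket]
  ext ⟨j, y⟩
  by_cases h : y = x <;> simp [ancillaMat, ket_apply, h, Finset.sum_apply]

/-- The controlled powers give the level `j` the phase `e^{2πijw/g}`, which depends on `w` modulo
`g` only; the qudit is then in the `k`-th Fourier vector, and the inverse transform returns `|k⟩`.
-/
theorem phaseOperator_ket [NeZero g] (x : Fin m → Bool) (k : Fin g) (h : weight x % g = k) :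
    (invQftMat g m * (ctrlPowMat g m * ancillaMat g m)) *ᵥ ket x = ket (k, x) := by
  have hexp : Complex.exp (2 * Real.pi * Complex.I / g) =
      Complex.exp (Real.pi * Complex.I / g) ^ 2 := by
    rw [← Complex.exp_nat_mul]
    congr 1
    push_cast
    ring
  have hω := (Complex.isPrimitiveRoot_exp g (NeZero.ne g)).pow_eq_one
  have h1 : (ctrlPowMat g m * ancillaMat g m) *ᵥ ket x = ∑ j, qft g j k • ket (j, x) := by
    rw [← Matrix.mulVec_mulVec, ancillaMat_ket, Matrix.mulVec_sum]
    refine Finset.sum_congr rfl fun j _ => ?_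
    rw [Matrix.mulVec_smul, ctrlPowMat_ket, prod_ite_weight, smul_smul, qft]
    congr 2
    rw [levelPhase, ← hexp, ← pow_mul, mul_comm (j : ℕ), mul_comm (j : ℕ), pow_mul, pow_mul,
      ← Nat.div_add_mod (weight x) g, pow_add, pow_mul, hω, one_pow, one_mul, h]
  rw [← Matrix.mulVec_mulVec, h1, Matrix.mulVec_sum]
  ext ⟨k', y⟩
  have h2 := congrFun (congrFun (qft_conjTranspose_mul g) k') k
  rw [Matrix.mul_apply, Matrix.one_apply] at h2
  simp only [Matrix.mulVec_smul, mulVec_ket, Finset.sum_apply, Pi.smul_apply, Matrix.col_apply,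
    smul_eq_mul, ket_apply, invQftMat, Matrix.kroneckerMap_apply, Matrix.one_apply, Prod.mk.injEq]
  by_cases hy : y = x
  · simp only [hy, if_true, mul_one, and_true]
    rw [← h2]
    exact Finset.sum_congr rfl fun j _ => mul_comm _ _
  · simp [hy]

/-- All weights of `ψ` have the same residue, so the qudit splits off as `|k⟩`: the outcome is
certain and the superposition in the data survives the measurement. -/
theorem run_phaseEstimation {t : ℕ} [NeZero g] (D : Scheme g t) (hD : D.EstimatesPhase)
    (k : Fin g) (ψ : (Fin (len g - t) → Bool) → ℂ) (hψ : ∀ x, ψ x ≠ 0 → weight x % g = k)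
    (s : Fin g) :
    D.phaseEstimation.run (place atData (proj ψ)) s =
      if s = -k then place atData (proj ψ) else 0 := by
  obtain ⟨hinj, h1, h2, h3⟩ := hD
  have hT : (invQftMat g (len g - t) * (ctrlPowMat g (len g - t) * ancillaMat g (len g - t))) *ᵥ ψ =
      placeMat (fun x => (k, x)) *ᵥ ψ := by
    rw [← sum_smul_ket ψ, Matrix.mulVec_sum, Matrix.mulVec_sum]
    refine Finset.sum_congr rfl fun x _ => ?_
    by_cases hx : ψ x = 0
    · simp [hx]
    · rw [Matrix.mulVec_smul, Matrix.mulVec_smul, phaseOperator_ket x k (hψ x hx), placeMat_ket]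
  have hstate : D.invFourier.run (D.ctrlPow.run (D.prepare.run (place atData (proj ψ)) ()) ()) () =
      place (fun x => basis x false (D.enc k)) (proj ψ) := by
    rw [h1, h2, h3]
    simp only [conj_proj, Matrix.mulVec_mulVec]
    rw [hT, ← conj_proj, place_conj]
    rfl
  rw [Scheme.phaseEstimation, Circuit.run_bind_unit, Circuit.run_bind_unit,
    Circuit.run_bind_unit, hstate, Circuit.run_bind,
    Finset.sum_eq_single (basis (fun _ => false) false (D.enc k))]
  · rw [run_measure_ancWires, if_pos rfl, Circuit.run_bind_unit, realizes_reset]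
    have : (fun j => (basis (fun _ => false) false (D.enc k) : Wires (len g - t) D.A → Bool)
        (Sum.inr (Sum.inr j))) = D.enc k := rfl
    rw [this, Function.leftInverse_invFun hinj k]
    simp [Circuit.run, Pi.single_apply]
  · intro f _ hf
    rw [run_measure_ancWires, if_neg hf, Circuit.run_zero]
    rfl
  · simp

theorem steps_phaseEstimation_le {t : ℕ} [NeZero g] (D : Scheme g t) :
    D.phaseEstimation.steps ≤
      D.prepare.steps + (D.ctrlPow.steps + (D.invFourier.steps + (D.A + D.A))) := by
  refine Circuit.steps_bind_le _ _ _ fun _ => Circuit.steps_bind_le _ _ _ fun _ =>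
    Circuit.steps_bind_le _ _ _ fun _ => ?_
  have hlen : (ancWires (len g - t) D.A).length = D.A := by simp [ancWires]
  refine (Circuit.steps_bind_le _ _ D.A fun f => ?_).trans
    (Nat.add_le_add_right ((Circuit.steps_measureList _).trans hlen.le) _)
  refine (Circuit.steps_bind_le _ _ 0 fun _ => le_rfl).trans ?_
  exact (steps_flipList _ _).trans hlen.le

end Estimation

/-! Binomial identities. -/

/-- It shows that `binom(N-t,w-s) / binom(N,w)` is a polynomial in `w` of degree at most `t`: a
falling factorial in the ones times a falling factorial in the zeros, up to a constant. -/
theorem choose_sub_mul_descFactorial {N t w s : ℕ} (hst : s ≤ t) (hsw : s ≤ w)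
    (hw : w + t ≤ N + s) :
    (N - t).choose (w - s) * N.descFactorial t =
      N.choose w * (w.descFactorial s * (N - w).descFactorial (t - s)) := by
  have h1 := Nat.choose_mul_factorial_mul_factorial (show w - s ≤ N - t by omega)
  have h2 := Nat.choose_mul_factorial_mul_factorial (show w ≤ N by omega)
  have h3 := Nat.factorial_mul_descFactorial (show t ≤ N by omega)
  have h4 := Nat.factorial_mul_descFactorial hsw
  have h5 := Nat.factorial_mul_descFactorial (show t - s ≤ N - w by omega)
  rw [show N - w - (t - s) = N - t - (w - s) by omega] at h5
  have hpos : 0 < (w - s).factorial * (N - t - (w - s)).factorial := by positivity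
  refine Nat.eq_of_mul_eq_mul_right hpos ?_
  calc _ = ((N - t).choose (w - s) * (w - s).factorial * (N - t - (w - s)).factorial) *
        N.descFactorial t := by ring
    _ = N.choose w * ((w - s).factorial * w.descFactorial s) *
        ((N - t - (w - s)).factorial * (N - w).descFactorial (t - s)) := by
      rw [h1, h3, h4, h5, h2]
    _ = _ := by ring

/-- Vandermonde's identity; the terms with `s > t` vanish. -/
theorem sum_choose_mul_choose_sub {N t w : ℕ} (htN : t ≤ N) (htw : t ≤ w) :
    ∑ s ∈ Finset.range (t + 1), t.choose s * (N - t).choose (w - s) = N.choose w := by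
  have h := Nat.add_choose_eq t (N - t) w
  rw [Nat.add_sub_cancel' htN, Finset.Nat.sum_antidiagonal_eq_sum_range_succ_mk] at h
  rw [h]
  refine Finset.sum_subset (Finset.range_subset_range.2 (by omega)) fun s _ hs => ?_
  rw [Finset.mem_range, not_lt] at hs
  rw [Nat.choose_eq_zero_of_lt (by omega), zero_mul]

open Polynomial in
-- Up to sign the sum is the `n`-th forward difference of `P` at `0`.
theorem sum_neg_one_pow_mul_choose_mul_eval {n : ℕ} (P : ℝ[X]) (hP : P.natDegree < n) :
    ∑ j ∈ Finset.range (n + 1), (-1 : ℝ) ^ j * n.choose j * P.eval (j : ℝ) = 0 := by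
  have h := congrFun (Polynomial.fwdDiff_iter_eq_zero_of_degree_lt hP) 0
  rw [fwdDiff_iter_eq_sum_shift] at h
  have h' : ∑ j ∈ Finset.range (n + 1), (-1 : ℝ) ^ j * n.choose j * P.eval (j : ℝ) =
      (-1) ^ n * ∑ k ∈ Finset.range (n + 1),
        ((-1 : ℤ) ^ (n - k) * (n.choose k : ℤ)) • P.eval (0 + k • (1 : ℝ)) := by
    rw [Finset.mul_sum]
    refine Finset.sum_congr rfl fun j hj => ?_
    have hjn : j ≤ n := Nat.lt_succ_iff.1 (Finset.mem_range.1 hj)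
    have hs : (-1 : ℝ) ^ j = (-1) ^ n * (-1) ^ (n - j) := by
      rw [← pow_add, show n + (n - j) = j + 2 * (n - j) by omega, pow_add, pow_mul]
      simp
    rw [hs]
    simp only [zsmul_eq_mul, nsmul_eq_mul, mul_one, zero_add]
    push_cast
    ring
  rw [h', h]
  simp

/-! The logical states. -/

/-- `n` is the least odd number that is at least `g`. -/
theorem lt_codeN {g t : ℕ} (h : t < g) : t < codeN g := by
  rw [codeN]; omega

theorem position_le {g j : ℕ} (hj : j ≤ codeN g) : g * j + g ≤ g * codeN g + g :=
  Nat.add_le_add_right (Nat.mul_le_mul_left g hj) g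

/-- The length `gn + 2g` exceeds the greatest weight `gn + g` by `g > t`, so the weights still fit
on `N - t` qubits. -/
theorem position_sub_le {g t s j : ℕ} (ht : t < g) (hj : j ≤ codeN g) :
    g * j + g - s ≤ len g - t := by
  have := position_le hj
  rw [len]
  omega

theorem position_sub_inj {g t s i j : ℕ} (ht : t < g) (hs : s ≤ t) :
    g * i + g - s = g * j + g - s ↔ i = j := by
  constructor
  · intro h
    have : g * i = g * j := by omega
    exact Nat.eq_of_mul_eq_mul_left (by omega) this
  · rintro rfl; rfl

theorem coeff_sq {g t s j : ℕ} : coeff g t s j ^ 2 =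
    (codeN g).choose j * (len g - t).choose (g * j + g - s) /
      (2 ^ codeN g * (len g).choose (g * j + g)) := by
  rw [coeff, div_pow, Real.sq_sqrt (by positivity), Real.sq_sqrt (by positivity)]

/-- The even and the odd positions carry the same total weight, which is why `|0_s⟩` and `|1_s⟩`
have equal norms. This is where `t < n` is needed. -/
theorem sum_neg_one_pow_mul_coeff_sq {g t s : ℕ} (ht : t < g) (hs : s ≤ t) :
    ∑ j ∈ Finset.range (codeN g + 1), (-1 : ℝ) ^ j * coeff g t s j ^ 2 = 0 := by
  set n := codeN g with hn
  set N := len g with hN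
  have hNe : N = g * n + 2 * g := rfl
  -- At `j` this is the falling factorial of order `s` of `gj + g`, times that of order `t - s` of
  -- `N - (gj + g)`.
  let P : Polynomial ℝ := ((descPochhammer ℝ s).comp (Polynomial.C (g : ℝ) * Polynomial.X +
    Polynomial.C (g : ℝ))) * ((descPochhammer ℝ (t - s)).comp
      (Polynomial.C (-(g : ℝ)) * Polynomial.X + Polynomial.C ((N : ℝ) - g)))
  have hdeg : P.natDegree < n := by
    refine lt_of_le_of_lt ?_ (lt_codeN ht)
    refine Polynomial.natDegree_mul_le.trans ?_
    have h1 := Polynomial.natDegree_comp_le (p := descPochhammer ℝ s)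
      (q := Polynomial.C (g : ℝ) * Polynomial.X + Polynomial.C (g : ℝ))
    have h2 := Polynomial.natDegree_comp_le (p := descPochhammer ℝ (t - s))
      (q := Polynomial.C (-(g : ℝ)) * Polynomial.X + Polynomial.C ((N : ℝ) - g))
    rw [descPochhammer_natDegree] at h1 h2
    have h3 := Polynomial.natDegree_linear_le (a := (g : ℝ)) (b := (g : ℝ))
    have h4 := Polynomial.natDegree_linear_le (a := -(g : ℝ)) (b := (N : ℝ) - g)
    have h5 := h1.trans (Nat.mul_le_mul_left s h3)
    have h6 := h2.trans (Nat.mul_le_mul_left (t - s) h4)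
    omega
  have hdf : (0 : ℝ) < N.descFactorial t := by
    exact_mod_cast Nat.descFactorial_pos.2 (by omega)
  have hterm : ∀ j ∈ Finset.range (n + 1), (-1 : ℝ) ^ j * coeff g t s j ^ 2 =
      (1 / (2 ^ n * N.descFactorial t)) * ((-1 : ℝ) ^ j * n.choose j * P.eval (j : ℝ)) := by
    intro j hj
    have hjn : j ≤ n := Nat.lt_succ_iff.1 (Finset.mem_range.1 hj)
    have hpos : g * j + g ≤ g * n + g := position_le hjn
    have hle : g * j + g ≤ N := by omega
    have hP : P.eval (j : ℝ) = ((g * j + g).descFactorial s : ℝ) *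
        ((N - (g * j + g)).descFactorial (t - s) : ℝ) := by
      simp only [P, Polynomial.eval_mul, Polynomial.eval_comp, Polynomial.eval_add,
        Polynomial.eval_C, Polynomial.eval_X]
      rw [← descPochhammer_eval_eq_descFactorial, ← descPochhammer_eval_eq_descFactorial,
        Nat.cast_sub hle]
      push_cast
      congr 2
      ring
    have hch := choose_sub_mul_descFactorial (N := N) (w := g * j + g) hs (by omega) (by omega)
    have hch' : ((N - t).choose (g * j + g - s) : ℝ) * N.descFactorial t =
        N.choose (g * j + g) * (((g * j + g).descFactorial s : ℝ) *
          ((N - (g * j + g)).descFactorial (t - s) : ℝ)) := by exact_mod_cast hch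
    have hc : (0 : ℝ) < N.choose (g * j + g) := by exact_mod_cast Nat.choose_pos hle
    rw [coeff_sq, hP, ← hn, ← hN]
    field_simp
    rw [mul_assoc, mul_assoc, mul_assoc, hch']
  rw [Finset.sum_congr rfl hterm, ← Finset.mul_sum, sum_neg_one_pow_mul_choose_mul_eval P hdeg,
    mul_zero]

/-- The common squared norm of `|0_s⟩` and `|1_s⟩`. -/
def normSqS (g t s : ℕ) : ℝ := ∑ j ∈ Finset.range (codeN g + 1), coeff g t s j ^ 2

theorem normSqS_pos {g t s : ℕ} (ht : t < g) : 0 < normSqS g t s := by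
  refine Finset.sum_pos (fun j hj => ?_) ⟨0, by simp⟩
  have hjn : j ≤ codeN g := Nat.lt_succ_iff.1 (Finset.mem_range.1 hj)
  have h1 : (0 : ℝ) < (codeN g).choose j := by exact_mod_cast Nat.choose_pos hjn
  have h2 : (0 : ℝ) < (len g - t).choose (g * j + g - s) := by
    exact_mod_cast Nat.choose_pos (position_sub_le ht hjn)
  have h3 : (0 : ℝ) < (len g).choose (g * j + g) := by
    have := position_le hjn
    exact_mod_cast Nat.choose_pos (by rw [len]; omega)
  rw [coeff_sq]
  positivity

/-- For each `j`, Vandermonde's identity over `s` leaves `binom(n,j) / 2^n`, and these add up to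
one. So the probabilities of the syndromes `s ≤ t` sum to one. -/
theorem sum_choose_mul_normSqS {g t : ℕ} (ht : t < g) :
    ∑ s ∈ Finset.range (t + 1), (t.choose s : ℝ) * normSqS g t s = 1 := by
  simp only [normSqS, Finset.mul_sum]
  rw [Finset.sum_comm]
  have hN : len g = g * codeN g + 2 * g := rfl
  have h : ∀ j ∈ Finset.range (codeN g + 1),
      ∑ s ∈ Finset.range (t + 1), (t.choose s : ℝ) * coeff g t s j ^ 2 =
        (codeN g).choose j / 2 ^ codeN g := by
    intro j hj
    have hjn : j ≤ codeN g := Nat.lt_succ_iff.1 (Finset.mem_range.1 hj)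
    have hle := position_le (g := g) hjn
    have h3 : (0 : ℝ) < (len g).choose (g * j + g) := by
      exact_mod_cast Nat.choose_pos (by omega)
    have hv : ∑ s ∈ Finset.range (t + 1), (t.choose s : ℝ) * (len g - t).choose (g * j + g - s) =
        (len g).choose (g * j + g) := by
      exact_mod_cast sum_choose_mul_choose_sub (N := len g) (t := t) (w := g * j + g)
        (by omega) (by omega)
    have he : ∀ s ∈ Finset.range (t + 1), (t.choose s : ℝ) * coeff g t s j ^ 2 =
        (codeN g).choose j / (2 ^ codeN g * (len g).choose (g * j + g)) *
          ((t.choose s : ℝ) * (len g - t).choose (g * j + g - s)) := by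
      intro s _
      rw [coeff_sq]
      ring
    rw [Finset.sum_congr rfl he, ← Finset.mul_sum, hv]
    field_simp
  rw [Finset.sum_congr rfl h, ← Finset.sum_div]
  have := Nat.sum_range_choose (codeN g)
  have h2 : (∑ j ∈ Finset.range (codeN g + 1), ((codeN g).choose j : ℝ)) = 2 ^ codeN g := by
    exact_mod_cast this
  rw [h2, div_self (by positivity)]

/-- The logical amplitude of the positions with the parity of `j`. -/
def parityAmp (a b : ℂ) (j : ℕ) : ℂ := if Even j then a else b

theorem smul_zeroS_add_smul_oneS (g t s : ℕ) (a b : ℂ) :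
    a • zeroS g t s + b • oneS g t s = ∑ j ∈ Finset.range (codeN g + 1),
      (((Real.sqrt 2 : ℝ) : ℂ) * parityAmp a b j * (coeff g t s j : ℂ)) •
        dicke (len g - t) (g * j + g - s) := by
  have h2 : ((1 / Real.sqrt 2 : ℝ) : ℂ) * 2 = ((Real.sqrt 2 : ℝ) : ℂ) := by
    rw [show (2 : ℂ) = ((2 : ℝ) : ℂ) by push_cast; rfl, ← Complex.ofReal_mul]
    congr 1
    rw [one_div, inv_mul_eq_div, Real.div_sqrt]
  rw [zeroS, oneS, plusS, minusS, ← Finset.sum_add_distrib, ← Finset.sum_sub_distrib,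
    Finset.smul_sum, Finset.smul_sum, Finset.smul_sum, Finset.smul_sum, ← Finset.sum_add_distrib]
  refine Finset.sum_congr rfl fun j _ => ?_
  rw [← h2, parityAmp]
  by_cases hj : Even j
  · rw [hj.neg_one_pow, if_pos hj]
    module
  · rw [(Nat.not_even_iff_odd.1 hj).neg_one_pow, if_neg hj]
    module

theorem sum_dicke_dotProduct {g t s : ℕ} (ht : t < g) (hs : s ≤ t) (p q : ℕ → ℂ) :
    star (∑ j ∈ Finset.range (codeN g + 1), p j • dicke (len g - t) (g * j + g - s)) ⬝ᵥ
      (∑ j ∈ Finset.range (codeN g + 1), q j • dicke (len g - t) (g * j + g - s)) =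
      ∑ j ∈ Finset.range (codeN g + 1), star (p j) * q j := by
  rw [star_sum, sum_dotProduct]
  refine Finset.sum_congr rfl fun i hi => ?_
  have hin : i ≤ codeN g := Nat.lt_succ_iff.1 (Finset.mem_range.1 hi)
  rw [dotProduct_sum, Finset.sum_eq_single i]
  · rw [star_smul, smul_dotProduct, dotProduct_smul, dicke_dotProduct (position_sub_le ht hin)]
    simp
  · intro j _ hj
    rw [star_smul, smul_dotProduct, dotProduct_smul, dicke_dotProduct (position_sub_le ht hin),
      if_neg fun h => hj ((position_sub_inj ht hs).1 h).symm]
    simp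
  · exact fun h => absurd hi h

theorem logicalS_dotProduct {g t s : ℕ} (ht : t < g) (hs : s ≤ t) (a b a' b' : ℂ) :
    star (a • zeroS g t s + b • oneS g t s) ⬝ᵥ (a' • zeroS g t s + b' • oneS g t s) =
      (star a * a' + star b * b') * normSqS g t s := by
  have h2 : ((Real.sqrt 2 : ℝ) : ℂ) * ((Real.sqrt 2 : ℝ) : ℂ) = 2 := by
    rw [← Complex.ofReal_mul, Real.mul_self_sqrt (by norm_num)]
    push_cast
    rfl
  have h0 : ∑ j ∈ Finset.range (codeN g + 1), (-1 : ℂ) ^ j * (coeff g t s j : ℂ) ^ 2 = 0 := by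
    exact_mod_cast congrArg (fun r : ℝ => (r : ℂ)) (sum_neg_one_pow_mul_coeff_sq ht hs)
  rw [smul_zeroS_add_smul_oneS, smul_zeroS_add_smul_oneS, sum_dicke_dotProduct ht hs]
  -- `2[j even] = 1 + (-1)^j` and `2[j odd] = 1 - (-1)^j` turn sums over one parity into a full sum
  -- and an alternating one.
  have hterm : ∀ j, star (((Real.sqrt 2 : ℝ) : ℂ) * parityAmp a b j * (coeff g t s j : ℂ)) *
      (((Real.sqrt 2 : ℝ) : ℂ) * parityAmp a' b' j * (coeff g t s j : ℂ)) =
      (star a * a' + star b * b') * (coeff g t s j : ℂ) ^ 2 +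
      (star a * a' - star b * b') * ((-1 : ℂ) ^ j * (coeff g t s j : ℂ) ^ 2) := by
    intro j
    simp only [star_mul', RCLike.star_def, Complex.conj_ofReal, parityAmp]
    by_cases hj : Even j
    · rw [hj.neg_one_pow, if_pos hj, if_pos hj]
      linear_combination (starRingEnd ℂ a * a' * (coeff g t s j : ℂ) ^ 2) * h2
    · rw [(Nat.not_even_iff_odd.1 hj).neg_one_pow, if_neg hj, if_neg hj]
      linear_combination (starRingEnd ℂ b * b' * (coeff g t s j : ℂ) ^ 2) * h2
  rw [Finset.sum_congr rfl fun j _ => hterm j, Finset.sum_add_distrib, ← Finset.mul_sum,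
    ← Finset.mul_sum, h0, mul_zero, add_zero, normSqS]
  push_cast
  rfl

/-! The deletion channel. -/

/-- A bit string splits into a kept and a lost part, and its weight into the two weights. Only the
number `s` of lost ones enters the amplitude, so the strings on the lost qubits are counted by
`binom(N-M,s)`, and the positions `f` drop out. -/
theorem survivors_proj_weight {M N : ℕ} (f : Fin M ↪o Fin N) (Φ : ℕ → ℂ) :
    survivors f (proj fun u => Φ (weight u)) = ∑ s ∈ Finset.range (N - M + 1),
      ((N - M).choose s : ℂ) • proj fun x : Fin M → Bool => Φ (weight x + s) := by
  classical
  set K := {k // k ∉ Set.range f} with hK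
  have hcard : Fintype.card K = N - M := by
    rw [Fintype.card_subtype_compl, Fintype.card_fin]
    congr 1
    exact (Set.card_range_of_injective f.injective).trans (Fintype.card_fin M)
  let e : (Fin N → Bool) → (Fin M → Bool) × (K → Bool) := fun u => (u ∘ f, fun k => u k)
  have he : Function.Bijective e := by
    constructor
    · intro u v h
      ext k
      by_cases hk : k ∈ Set.range f
      · obtain ⟨i, rfl⟩ := hk
        exact congrFun (congrArg Prod.fst h) i
      · exact congrFun (congrArg Prod.snd h) ⟨k, hk⟩
    · rintro ⟨x, r⟩
      refine ⟨fun k => if h : k ∈ Set.range f then x h.choose else r ⟨k, h⟩, ?_⟩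
      refine Prod.ext ?_ ?_
      · ext i
        have h : f i ∈ Set.range f := ⟨i, rfl⟩
        simp only [e, Function.comp_apply, dif_pos h]
        rw [f.injective h.choose_spec]
      · ext k
        simp only [e, dif_neg k.2]
        rfl
  let E := Equiv.ofBijective e he
  have hfst : ∀ p i, E.symm p (f i) = p.1 i := fun p i =>
    congrFun (congrArg Prod.fst (E.apply_symm_apply p)) i
  have hsnd : ∀ p (k : K), E.symm p k = p.2 k := fun p k =>
    congrFun (congrArg Prod.snd (E.apply_symm_apply p)) k
  have hw : ∀ x r, weight (E.symm (x, r)) =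
      weight x + (Finset.univ.filter fun k : K => r k = true).card := by
    intro x r
    have hsplit : (Finset.univ.filter fun i => E.symm (x, r) i = true) =
        ((Finset.univ.filter fun i => x i = true).map f.toEmbedding) ∪
        ((Finset.univ.filter fun k : K => r k = true).map (Function.Embedding.subtype _)) := by
      ext k
      simp only [Finset.mem_filter, Finset.mem_univ, true_and, Finset.mem_union, Finset.mem_map]
      by_cases hk : k ∈ Set.range f
      · obtain ⟨i, rfl⟩ := hk
        rw [hfst]
        constructor
        · exact fun h => Or.inl ⟨i, h, rfl⟩
        · rintro (⟨i', h, h'⟩ | ⟨k, h, h'⟩)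
          · rwa [← f.injective h']
          · exact absurd ⟨i, h'.symm⟩ k.2
      · rw [show E.symm (x, r) k = r ⟨k, hk⟩ from hsnd (x, r) ⟨k, hk⟩]
        constructor
        · exact fun h => Or.inr ⟨⟨k, hk⟩, h, rfl⟩
        · rintro (⟨i', h, h'⟩ | ⟨k', h, h'⟩)
          · exact absurd ⟨i', h'⟩ hk
          · have : k' = ⟨k, hk⟩ := Subtype.ext h'
            rwa [← this]
    rw [weight, hsplit, Finset.card_union_of_disjoint, Finset.card_map, Finset.card_map]
    · rfl
    · rw [Finset.disjoint_left]
      intro k h1 h2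
      obtain ⟨i, -, rfl⟩ := Finset.mem_map.1 h1
      obtain ⟨k', -, h⟩ := Finset.mem_map.1 h2
      exact k'.2 ⟨i, h.symm⟩
  ext x y
  have hcond : ∀ p q : (Fin M → Bool) × (K → Bool),
      ((∀ i, E.symm p (f i) = x i) ∧ (∀ i, E.symm q (f i) = y i) ∧
        ∀ k, k ∉ Set.range f → E.symm p k = E.symm q k) ↔ p.1 = x ∧ q.1 = y ∧ p.2 = q.2 := by
    intro p q
    simp only [hfst, funext_iff]
    refine and_congr_right fun _ => and_congr_right fun _ => ⟨fun h k => ?_, fun h k hk => ?_⟩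
    · rw [← hsnd, ← hsnd]
      exact h k k.2
    · rw [show E.symm p k = p.2 ⟨k, hk⟩ from hsnd p ⟨k, hk⟩,
        show E.symm q k = q.2 ⟨k, hk⟩ from hsnd q ⟨k, hk⟩]
      exact h ⟨k, hk⟩
  have hsum : survivors f (proj fun u => Φ (weight u)) x y =
      ∑ r : K → Bool, Φ (weight x + (Finset.univ.filter fun k : K => r k = true).card) *
        star (Φ (weight y + (Finset.univ.filter fun k : K => r k = true).card)) := by
    rw [survivors, ← E.symm.sum_comp]
    have hin : ∀ p : (Fin M → Bool) × (K → Bool), (∑ v : Fin N → Bool,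
        if (∀ i, E.symm p (f i) = x i) ∧ (∀ i, v (f i) = y i) ∧
          (∀ k, k ∉ Set.range f → E.symm p k = v k)
        then (proj fun u : Fin N → Bool => Φ (weight u)) (E.symm p) v else 0) =
        if p.1 = x then Φ (weight (E.symm p)) * star (Φ (weight (E.symm (y, p.2)))) else 0 := by
      intro p
      rw [← E.symm.sum_comp, Finset.sum_eq_single (y, p.2)]
      · by_cases hp : p.1 = x
        · rw [if_pos ((hcond p (y, p.2)).2 ⟨hp, rfl, rfl⟩), if_pos hp]
          rfl
        · rw [if_neg fun h => hp ((hcond p (y, p.2)).1 h).1, if_neg hp]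
      · intro q _ hq
        rw [if_neg fun h => hq (Prod.ext ((hcond p q).1 h).2.1 ((hcond p q).1 h).2.2.symm)]
      · simp
    rw [Finset.sum_congr rfl fun p _ => hin p, Fintype.sum_prod_type,
      Finset.sum_eq_single x (fun x' _ hx' => by simp [hx']) (by simp)]
    refine Finset.sum_congr rfl fun r _ => ?_
    rw [if_pos rfl, hw, hw]
  rw [hsum, sum_card_true (fun s => Φ (weight x + s) * star (Φ (weight y + s))), hcard,
    Matrix.sum_apply]
  refine Finset.sum_congr rfl fun s _ => ?_
  rw [Matrix.smul_apply, nsmul_eq_mul, smul_eq_mul]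
  rfl

theorem encoded_eq_sum (g : ℕ) (a b : ℂ) :
    encoded g a b = ∑ j ∈ Finset.range (codeN g + 1),
      (((Real.sqrt (1 / 2 ^ (codeN g - 1)) : ℝ) : ℂ) * parityAmp a b j *
        ((Real.sqrt ((codeN g).choose j) : ℝ) : ℂ)) • dicke (len g) (g * j + g) := by
  rw [encoded, zeroL, oneL, Finset.sum_filter, Finset.sum_filter, smul_smul, smul_smul,
    Finset.smul_sum, Finset.smul_sum, ← Finset.sum_add_distrib]
  refine Finset.sum_congr rfl fun j _ => ?_
  rw [parityAmp]
  by_cases hj : Even j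
  · rw [if_pos hj, if_pos hj, if_neg (Nat.not_odd_iff_even.2 hj)]
    module
  · rw [if_neg hj, if_neg hj, if_pos (Nat.not_even_iff_odd.1 hj)]
    module

/-- Deletion keeps the amplitude of each bit string, and `b_{j,s}` rewrites it in terms of the
shorter Dicke state; the factor `√2` comes from the normalization of `|0_s⟩` and `|1_s⟩`. -/
theorem coeff_div_sqrt {g t s j : ℕ} (ht : t < g) (hj : j ≤ codeN g) :
    Real.sqrt (1 / 2 ^ (codeN g - 1)) * Real.sqrt ((codeN g).choose j) *
      (1 / Real.sqrt ((len g).choose (g * j + g))) =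
    Real.sqrt 2 * coeff g t s j * (1 / Real.sqrt ((len g - t).choose (g * j + g - s))) := by
  have h2 : (0 : ℝ) < (len g - t).choose (g * j + g - s) := by
    exact_mod_cast Nat.choose_pos (position_sub_le ht hj)
  have hn : 0 < codeN g := by rw [codeN]; omega
  have hp : (2 : ℝ) ^ codeN g = 2 * 2 ^ (codeN g - 1) := by
    rw [← pow_succ', Nat.sub_add_cancel hn]
  rw [coeff, hp, Real.sqrt_mul (by positivity), Real.sqrt_mul (by positivity),
    Real.sqrt_mul (by positivity), one_div (2 ^ _ : ℝ), Real.sqrt_inv]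
  have h3 : Real.sqrt ((len g - t).choose (g * j + g - s)) ≠ 0 := (Real.sqrt_pos.2 h2).ne'
  have h4 : Real.sqrt 2 ≠ 0 := by positivity
  field_simp

theorem deletion_encoded {g t : ℕ} (ht : t < g) (p : (Fin (len g - t) ↪o Fin (len g)) → ℝ)
    (hp : IsDeletionLaw p) (a b : ℂ) :
    deletion p (proj (encoded g a b)) = ∑ s ∈ Finset.range (t + 1),
      (t.choose s : ℂ) • proj (a • zeroS g t s + b • oneS g t s) := by
  have hN : len g = g * codeN g + 2 * g := rfl
  let Φ : ℕ → ℂ := fun w => ∑ j ∈ Finset.range (codeN g + 1),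
      (((Real.sqrt (1 / 2 ^ (codeN g - 1)) : ℝ) : ℂ) * parityAmp a b j *
        ((Real.sqrt ((codeN g).choose j) : ℝ) : ℂ)) *
        (if w = g * j + g then ((1 / Real.sqrt ((len g).choose (g * j + g)) : ℝ) : ℂ) else 0)
  have henc : encoded g a b = fun u => Φ (weight u) := by
    rw [encoded_eq_sum]
    ext u
    simp only [Finset.sum_apply, Pi.smul_apply, smul_eq_mul, dicke, Φ]
  have hΦ : ∀ s ≤ t, (fun x : Fin (len g - t) → Bool => Φ (weight x + s)) =
      a • zeroS g t s + b • oneS g t s := by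
    intro s hs
    rw [smul_zeroS_add_smul_oneS]
    ext x
    simp only [Finset.sum_apply, Pi.smul_apply, smul_eq_mul, dicke, Φ]
    refine Finset.sum_congr rfl fun j hj => ?_
    have hjn : j ≤ codeN g := Nat.lt_succ_iff.1 (Finset.mem_range.1 hj)
    have hiff : weight x + s = g * j + g ↔ weight x = g * j + g - s := by omega
    by_cases h : weight x = g * j + g - s
    · rw [if_pos (hiff.2 h), if_pos h]
      have := congrArg (fun r : ℝ => (r : ℂ)) (coeff_div_sqrt (s := s) ht hjn)
      simp only [Complex.ofReal_mul] at this
      linear_combination parityAmp a b j * this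
    · rw [if_neg (mt hiff.1 h), if_neg h, mul_zero, mul_zero]
  have hsurv : ∀ f : Fin (len g - t) ↪o Fin (len g), survivors f (proj (encoded g a b)) =
      ∑ s ∈ Finset.range (t + 1), (t.choose s : ℂ) • proj (a • zeroS g t s + b • oneS g t s) := by
    intro f
    rw [henc, survivors_proj_weight, show len g - (len g - t) = t by omega]
    refine Finset.sum_congr rfl fun s hs => ?_
    rw [hΦ s (Nat.lt_succ_iff.1 (Finset.mem_range.1 hs))]
  rw [deletion]
  simp only [hsurv]
  rw [← Finset.sum_smul, ← Complex.ofReal_sum, hp.2, Complex.ofReal_one, one_smul]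

/-! Gate teleportation. -/

section Teleportation

variable {m A : ℕ}

theorem outWire_ne_inl (i : Fin m) : (outWire : Wires m A) ≠ Sum.inl i := Sum.inr_ne_inl

/-- The gates of `cnots`. -/
def cnotGates (l : List (Fin m)) : List (Gate (Wires m A)) :=
  l.map fun i => .two outWire (Sum.inl i) (outWire_ne_inl i) ⟨cnotMat, cnotMat_mem⟩

theorem cnots_eq_gateCircuit (l : List (Fin m)) :
    (cnots l : Circuit (Wires m A) Unit) = gateCircuit (cnotGates l) := by
  induction l with
  | nil => rfl
  | cons i l ih => rw [cnots, ih]; rfl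

theorem cnotGates_ket {l : List (Fin m)} (hl : l.Nodup) (x : Fin m → Bool) (o : Bool)
    (z : Fin A → Bool) :
    listMat (cnotGates l) *ᵥ ket (basis x o z) =
      ket (basis (fun i => if i ∈ l then xor o (x i) else x i) o z) := by
  induction l generalizing x with
  | nil => simp [cnotGates, listMat]
  | cons j l ih =>
    rw [List.nodup_cons] at hl
    have hupd : Function.update (basis x o z : Wires m A → Bool) (Sum.inl j)
        (xor ((basis x o z : Wires m A → Bool) outWire)
          ((basis x o z : Wires m A → Bool) (Sum.inl j))) =
        basis (Function.update x j (xor o (x j))) o z := by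
      ext q
      rcases q with i | q
      · by_cases hi : i = j
        · subst hi; simp [basis, outWire]
        · simp [basis, hi]
      · simp [basis]
    rw [cnotGates, List.map_cons, listMat, ← Matrix.mulVec_mulVec,
      show Gate.mat (.two outWire (Sum.inl j) (outWire_ne_inl j) ⟨cnotMat, cnotMat_mem⟩) =
        lift2 outWire (Sum.inl j) cnotMat from rfl, cnot_ket (outWire_ne_inl j), hupd]
    refine (ih hl.2 _).trans ?_
    congr 2
    ext i
    by_cases hi : i = j
    · subst hi; simp [hl.1]
    · simp [hi]

/-- Flip all bits if `o` is set. -/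
def flipBits (o : Bool) (x : Fin m → Bool) : Fin m → Bool := fun i => xor o (x i)

theorem flipBits_flipBits (o : Bool) (x : Fin m → Bool) : flipBits o (flipBits o x) = x := by
  ext i
  simp [flipBits]

/-- The isometry `|x⟩ ↦ (|0⟩|x⟩ + |1⟩ X^{⊗ m}|x⟩)/√2`. -/
def fanOutMat (m : ℕ) : Matrix (Bool × (Fin m → Bool)) (Fin m → Bool) ℂ :=
  Matrix.of fun k x => if k.2 = flipBits k.1 x then ((1 / Real.sqrt 2 : ℝ) : ℂ) else 0

theorem fanOutMat_mulVec (φ : (Fin m → Bool) → ℂ) (k : Bool × (Fin m → Bool)) :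
    (fanOutMat m *ᵥ φ) k = ((1 / Real.sqrt 2 : ℝ) : ℂ) * φ (flipBits k.1 k.2) := by
  rw [Matrix.mulVec, dotProduct, Finset.sum_eq_single (flipBits k.1 k.2)]
  · simp [fanOutMat, flipBits_flipBits]
  · intro x _ hx
    rw [fanOutMat, Matrix.of_apply, if_neg, zero_mul]
    intro h
    exact hx (by rw [h, flipBits_flipBits])
  · simp

theorem realizes_fanOut :
    Realizes (gateCircuit (.one outWire ⟨hMat, hMat_mem⟩ :: cnotGates (A := A) (List.finRange m)))
      atData atOutData (fanOutMat m) := by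
  refine realizes_of_ket fun x => ?_
  have hupd : ∀ o, Function.update (atData x : Wires m A → Bool) outWire o =
      basis x o fun _ => false := by
    intro o
    ext q
    rcases q with i | ⟨⟨⟩⟩ | k
    · simp [atData, basis, outWire]
    · simp [basis, outWire]
    · simp [atData, basis, outWire]
  rw [listMat, ← Matrix.mulVec_mulVec, Gate.mat, lift1_ket, Matrix.mulVec_sum,
    Fintype.sum_prod_type]
  refine Finset.sum_congr rfl fun o _ => ?_
  rw [Matrix.mulVec_smul, hupd, cnotGates_ket (List.nodup_finRange m),
    Finset.sum_eq_single (flipBits o x)]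
  · have : (atData x : Wires m A → Bool) outWire = false := rfl
    simp [fanOutMat, hMat, this, atOutData]
    rfl
  · intro y _ hy
    rw [fanOutMat, Matrix.of_apply, if_neg hy, zero_smul]
  · simp

theorem controlled_mulVec (S : Op (Fin m)) (Ω : Bool × (Fin m → Bool) → ℂ)
    (k : Bool × (Fin m → Bool)) :
    (controlled S *ᵥ Ω) k = if k.1 then (S *ᵥ fun x => Ω (true, x)) k.2 else Ω k := by
  obtain ⟨o, x⟩ := k
  rw [Matrix.mulVec, dotProduct, Fintype.sum_prod_type, Fintype.sum_bool]
  cases o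
  · simp [controlled, Matrix.one_apply]
  · simp [controlled, Matrix.mulVec, dotProduct]

theorem weight_flipBits (x : Fin m → Bool) : weight (flipBits true x) = m - weight x := by
  have h := Finset.card_filter_add_card_filter_not (s := (Finset.univ : Finset (Fin m)))
    (fun i => x i = true)
  rw [Finset.card_univ, Fintype.card_fin] at h
  have h' : weight (flipBits true x) = (Finset.univ.filter fun i => ¬ x i = true).card := by
    rw [weight]
    congr 1
    ext i
    simp [flipBits]
  rw [h', weight]
  omega

theorem dicke_flipBits {w : ℕ} (hw : w ≤ m) (x : Fin m → Bool) :
    dicke m w (flipBits true x) = dicke m (m - w) x := by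
  have := weight_le x
  rw [dicke, dicke, weight_flipBits, Nat.choose_symm hw]
  congr 1
  exact propext (by omega)

theorem conj_lift1_xMat_apply {Q : Type} [Fintype Q] [DecidableEq Q] (i : Q) (ρ : Op Q)
    (u v : Q → Bool) :
    (lift1 i xMat * ρ * (lift1 i xMat)ᴴ) u v =
      ρ (Function.update u i !(u i)) (Function.update v i !(v i)) := by
  have hinv : ∀ y : Q → Bool, Function.update (Function.update y i !(y i)) i
      (!(Function.update y i (!(y i)) i)) = y := by
    intro y
    simp
  have hmat : lift1 i xMat = placeMat fun y : Q → Bool => Function.update y i !(y i) := by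
    refine matrix_ext_ket fun y => ?_
    rw [xMat_ket, placeMat_ket]
  have hplace := place_apply (fun y : Q → Bool => Function.update y i !(y i)) ρ u v
  rw [place_eq, ← hmat] at hplace
  rw [hplace, Finset.sum_eq_single (Function.update u i !(u i)),
    Finset.sum_eq_single (Function.update v i !(v i))]
  · rw [if_pos ⟨(hinv u).symm, (hinv v).symm⟩]
  · intro y _ hy
    exact if_neg fun h => hy (by rw [h.2, hinv])
  · simp
  · intro y _ hy
    exact Finset.sum_eq_zero fun w _ => if_neg fun h => hy (by rw [h.1, hinv])
  · simp

theorem outputState_sum {ι : Type} (s : Finset ι) (ρ : ι → Op (Wires m A)) :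
    outputState (∑ i ∈ s, ρ i) = ∑ i ∈ s, outputState (ρ i) := by
  ext o o'
  simp only [outputState, Matrix.sum_apply]
  rw [Finset.sum_comm]
  simp only [Finset.sum_comm (s := s)]
  rw [Finset.sum_comm]

theorem outputState_smul (r : ℂ) (ρ : Op (Wires m A)) :
    outputState (r • ρ) = r • outputState ρ := by
  ext o o'
  simp only [outputState, Matrix.smul_apply, smul_eq_mul, Finset.mul_sum]

theorem outputState_zero : outputState (0 : Op (Wires m A)) = 0 := by
  ext o o'
  simp [outputState]

/-- Measure all data qubits and flip the output qubit depending on the outcome. -/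
theorem outputState_measure_flip (P : (Fin m → Bool) → Prop) [DecidablePred P]
    (ρ : Op (Wires m A)) (o o' : Bool) :
    outputState (((Circuit.measureList (dataWires m A)).bind fun f =>
      if P fun i => f (Sum.inl i) then .gate1 outWire ⟨xMat, xMat_mem⟩ (.ret ())
      else .ret ()).run ρ ()) o o' =
    ∑ x : Fin m → Bool, ∑ z : Fin A → Bool,
      ρ (basis x (xor o (decide (P x))) z) (basis x (xor o' (decide (P x))) z) := by
  rw [Circuit.run_bind, outputState_sum, Matrix.sum_apply]
  have hbranch : ∀ f : Wires m A → Bool, outputState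
      ((if P fun i => f (Sum.inl i) then .gate1 outWire ⟨xMat, xMat_mem⟩ (.ret ())
        else .ret () : Circuit (Wires m A) Unit).run
          ((Circuit.measureList (dataWires m A)).run ρ f) ()) o o' =
      ∑ x : Fin m → Bool, if f = basis x false (fun _ => false) then
        ∑ z : Fin A → Bool,
          ρ (basis x (xor o (decide (P x))) z) (basis x (xor o' (decide (P x))) z) else 0 := by
    intro f
    have hiff : ∀ (x : Fin m → Bool) (p p' : Bool) (z : Fin A → Bool),
        ((∀ q, q ∉ dataWires m A → f q = false) ∧ ∀ q ∈ dataWires m A,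
          (basis x p z : Wires m A → Bool) q = f q ∧
          (basis x p' z : Wires m A → Bool) q = f q) ↔
        f = basis x false (fun _ => false) := by
      intro x p p' z
      constructor
      · rintro ⟨h1, h2⟩
        ext q
        rcases q with i | ⟨⟨⟩⟩ | k
        · exact (h2 _ ((mem_dataWires _).2 ⟨i, rfl⟩)).1.symm
        · exact h1 _ fun h => by simp [mem_dataWires] at h
        · exact h1 _ fun h => by simp [mem_dataWires] at h
      · rintro rfl
        refine ⟨fun q hq => ?_, fun q hq => ?_⟩
        · rcases q with i | ⟨⟨⟩⟩ | k
          · exact absurd ((mem_dataWires _).2 ⟨i, rfl⟩) hq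
          · rfl
          · rfl
        · obtain ⟨i, rfl⟩ := (mem_dataWires q).1 hq
          exact ⟨rfl, rfl⟩
    have hupd : ∀ (x : Fin m → Bool) (p p' : Bool) (z : Fin A → Bool),
        Function.update (basis x p z : Wires m A → Bool) outWire p' = basis x p' z := by
      intro x p p' z
      ext q
      rcases q with i | ⟨⟨⟩⟩ | k
      · simp [basis, outWire]
      · simp [basis, outWire]
      · simp [basis, outWire]
    rw [outputState]
    refine Finset.sum_congr rfl fun x _ => ?_
    by_cases hf : f = basis x false (fun _ => false)
    · rw [if_pos hf]
      refine Finset.sum_congr rfl fun z _ => ?_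
      have hx : (fun i => f (Sum.inl i)) = x := by rw [hf]; rfl
      rw [hx]
      by_cases hP : P x
      · rw [if_pos hP, Circuit.run, Circuit.run, Pi.single_eq_same, conj_lift1_xMat_apply,
          basis_outWire, basis_outWire, hupd, hupd,
          Circuit.run_measureList nodup_dataWires, if_pos ((hiff _ _ _ _).2 hf)]
        simp [hP]
      · rw [if_neg hP, Circuit.run, Pi.single_eq_same,
          Circuit.run_measureList nodup_dataWires, if_pos ((hiff _ _ _ _).2 hf)]
        simp [hP]
    · rw [if_neg hf]
      refine Finset.sum_eq_zero fun z _ => ?_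
      split_ifs with hP
      · rw [Circuit.run, Circuit.run, Pi.single_eq_same, conj_lift1_xMat_apply,
          basis_outWire, basis_outWire, hupd, hupd,
          Circuit.run_measureList nodup_dataWires, if_neg (mt (hiff _ _ _ _).1 hf)]
      · rw [Circuit.run, Pi.single_eq_same,
          Circuit.run_measureList nodup_dataWires, if_neg (mt (hiff _ _ _ _).1 hf)]
  rw [Finset.sum_congr rfl fun f _ => hbranch f, Finset.sum_comm]
  refine Finset.sum_congr rfl fun x _ => ?_
  rw [Finset.sum_ite_eq' Finset.univ, if_pos (Finset.mem_univ _)]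

theorem sum_place_atOutData (Ω : Bool × (Fin m → Bool) → ℂ) (x : Fin m → Bool) (p p' : Bool) :
    ∑ z : Fin A → Bool, place atOutData (proj Ω) (basis x p z) (basis x p' z) =
      Ω (p, x) * star (Ω (p', x)) := by
  have hiff : ∀ (p : Bool) (z : Fin A → Bool) (k : Bool × (Fin m → Bool)),
      (basis x p z : Wires m A → Bool) = atOutData k ↔ k = (p, x) ∧ z = fun _ => false := by
    intro p z k
    constructor
    · intro h
      refine ⟨Prod.ext ?_ ?_, ?_⟩
      · exact (congrFun h outWire).symm
      · exact funext fun i => (congrFun h (Sum.inl i)).symm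
      · exact funext fun i => congrFun h (Sum.inr (Sum.inr i))
    · rintro ⟨rfl, rfl⟩
      rfl
  rw [Finset.sum_eq_single fun _ => false]
  · rw [place_apply, Finset.sum_eq_single (p, x), Finset.sum_eq_single (p', x)]
    · rw [if_pos ⟨(hiff _ _ _).2 ⟨rfl, rfl⟩, (hiff _ _ _).2 ⟨rfl, rfl⟩⟩]
      rfl
    · intro k _ hk
      exact if_neg fun h => hk ((hiff _ _ _).1 h.2).1
    · simp
    · intro k _ hk
      exact Finset.sum_eq_zero fun l _ => if_neg fun h => hk ((hiff _ _ _).1 h.1).1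
    · simp
  · intro z _ hz
    rw [place_apply]
    exact Finset.sum_eq_zero fun k _ => Finset.sum_eq_zero fun l _ =>
      if_neg fun h => hz ((hiff _ _ _).1 h.1).2
  · simp

end Teleportation

/-- Gate teleportation takes `c (a |D_{g-s}⟩ + b |D_{gn+g-s}⟩)` to `c (a|0⟩ + b|1⟩)`. -/
theorem outputState_teleport {g t : ℕ} [NeZero g] (ht : t < g) (D : Scheme g t) (s : Fin g)
    (hD : D.Shifts s) (c a b : ℂ) :
    outputState ((D.teleport s).run (place atData (proj (c •
      (a • dicke (len g - t) (g - s) + b • dicke (len g - t) (g * codeN g + g - s))))) ()) =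
      (c * star c) • proj fun o : Bool => if o then b else a := by
  set m := len g - t with hm
  obtain ⟨S, ⟨-, hS⟩, hreal⟩ : ∃ S : Op (Fin m), IsDickeShift S ((t : ℤ) - 2 * (s : ℕ)) ∧
    Realizes (D.ctrlShift s) atOutData atOutData (controlled S) := hD
  set lo := g - (s : ℕ) with hlo
  set hi := g * codeN g + g - s with hhi
  have hN : len g = g * codeN g + 2 * g := rfl
  have hn : 0 < codeN g := by rw [codeN]; omega
  have hgn : g ≤ g * codeN g := Nat.le_mul_of_pos_right g hn
  have hlom : lo ≤ m := by omega
  have hhim : hi ≤ m := by omega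
  have hlohi : lo ≠ hi := by omega
  set r : ℂ := ((1 / Real.sqrt 2 : ℝ) : ℂ) with hr
  have hrr : r * star r * 2 = 1 := by
    rw [hr, RCLike.star_def, Complex.conj_ofReal, ← Complex.ofReal_mul, div_mul_div_comm,
      Real.mul_self_sqrt (by norm_num)]
    push_cast
    norm_num
  set φ : (Fin m → Bool) → ℂ := c • (a • dicke m lo + b • dicke m hi) with hφ
  set Ω : Bool × (Fin m → Bool) → ℂ := controlled S *ᵥ (fanOutMat m *ᵥ φ) with hΩ
  have hΩ_apply : ∀ o x, Ω (o, x) =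
      r * c * (if o then b * dicke m lo x + a * dicke m hi x
        else a * dicke m lo x + b * dicke m hi x) := by
    intro o x
    rw [hΩ, controlled_mulVec]
    cases o
    · simp only [Bool.false_eq_true, if_false, fanOutMat_mulVec]
      have : flipBits false x = x := by ext i; simp [flipBits]
      rw [this, hφ]
      simp only [Pi.smul_apply, Pi.add_apply, smul_eq_mul]
      ring
    · simp only [if_true]
      have hvec : (fun x => (fanOutMat m *ᵥ φ) (true, x)) =
          (r * c) • (a • dicke m (m - lo) + b • dicke m (m - hi)) := by
        ext y
        rw [fanOutMat_mulVec, hφ]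
        simp only [Pi.smul_apply, Pi.add_apply, smul_eq_mul, dicke_flipBits hlom,
          dicke_flipBits hhim]
        ring
      -- `m - lo = gn + g - t + s` and `m - hi = g - t + s`, so the shift by `t - 2s` takes them to
      -- `hi` and `lo`: with the output qubit set, the two Dicke states are exchanged.
      rw [hvec, Matrix.mulVec_smul, Matrix.mulVec_add, Matrix.mulVec_smul, Matrix.mulVec_smul,
        hS (m - lo) hi (by omega) hhim (by omega), hS (m - hi) lo (by omega) hlom (by omega)]
      simp only [Pi.smul_apply, Pi.add_apply, smul_eq_mul]
      ring
  have hrun : (D.teleport s).run (place atData (proj φ)) () =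
      ((Circuit.measureList (dataWires m D.A)).bind fun f =>
        if Even ((weight (fun i => f (Sum.inl i)) + (s : ℕ)) / g)
        then .gate1 outWire ⟨xMat, xMat_mem⟩ (.ret ()) else .ret ()).run
          (place atOutData (proj Ω)) () := by
    have h : D.teleport s = (gateCircuit (.one outWire ⟨hMat, hMat_mem⟩ ::
        cnotGates (A := D.A) (List.finRange m))).bind fun _ => (D.ctrlShift s).bind fun _ =>
          (Circuit.measureList (dataWires m D.A)).bind fun f =>
            if Even ((weight (fun i => f (Sum.inl i)) + (s : ℕ)) / g)
            then .gate1 outWire ⟨xMat, xMat_mem⟩ (.ret ()) else .ret () := by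
      rw [Scheme.teleport, cnots_eq_gateCircuit]
      rfl
    rw [h, Circuit.run_bind_unit, Circuit.run_bind_unit, realizes_fanOut, hreal, conj_proj,
      conj_proj]
  have hlo_div : ∀ x : Fin m → Bool, weight x = lo → ¬ Even ((weight x + s) / g) := by
    intro x hx
    rw [hx, show lo + (s : ℕ) = g by omega, Nat.div_self (by omega)]
    decide
  -- The quotient is `n + 1`, which is even because `n` is odd; for `lo` it is `1`.
  have hhi_div : ∀ x : Fin m → Bool, weight x = hi → Even ((weight x + s) / g) := by
    intro x hx
    rw [hx, show hi + (s : ℕ) = g * (codeN g + 1) by rw [Nat.mul_add]; omega,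
      Nat.mul_div_cancel_left _ (by omega), codeN]
    exact ⟨g / 2 + 1, by omega⟩
  -- After the conditional flip both outcomes leave the same amplitudes on the output qubit, so the
  -- data factor out.
  have hα : ∀ o x, Ω (xor o (decide (Even ((weight x + s) / g))), x) =
      r * c * (if o then b else a) * (dicke m lo x + dicke m hi x) := by
    intro o x
    rw [hΩ_apply]
    by_cases h1 : weight x = lo
    · have h2 : dicke m hi x = 0 := if_neg (by omega)
      rw [decide_eq_false (hlo_div x h1), h2]
      cases o <;> simp <;> ring
    · have h3 : dicke m lo x = 0 := if_neg h1
      rw [h3]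
      by_cases h2 : weight x = hi
      · rw [decide_eq_true (hhi_div x h2)]
        cases o <;> simp <;> ring
      · have h4 : dicke m hi x = 0 := if_neg h2
        simp [h4]
  -- The two Dicke states contribute one each; this `2` cancels the two factors `1/√2` from the
  -- Hadamard gate.
  have hnorm : ∑ x, (dicke m lo x + dicke m hi x) * star (dicke m lo x + dicke m hi x) = 2 := by
    have h : star (dicke m lo + dicke m hi) ⬝ᵥ (dicke m lo + dicke m hi) = 2 := by
      rw [star_add, add_dotProduct, dotProduct_add, dotProduct_add, dicke_dotProduct hlom,
        dicke_dotProduct hlom, dicke_dotProduct hhim, dicke_dotProduct hhim, if_pos rfl,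
        if_neg hlohi, if_neg hlohi.symm, if_pos rfl]
      norm_num
    rw [← h, dotProduct]
    exact Finset.sum_congr rfl fun x _ => mul_comm _ _
  rw [hrun]
  ext o o'
  rw [outputState_measure_flip (fun x => Even ((weight x + (s : ℕ)) / g))]
  simp only [sum_place_atOutData, hα]
  have hterm : ∀ x, r * c * (if o then b else a) * (dicke m lo x + dicke m hi x) *
      star (r * c * (if o' then b else a) * (dicke m lo x + dicke m hi x)) =
      r * star r * (c * star c * ((if o then b else a) * star (if o' then b else a))) *
        ((dicke m lo x + dicke m hi x) * star (dicke m lo x + dicke m hi x)) := by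
    intro x
    simp only [star_mul']
    ring
  rw [Finset.sum_congr rfl fun x _ => hterm x, ← Finset.mul_sum, hnorm, Matrix.smul_apply, proj,
    Matrix.vecMulVec_apply, smul_eq_mul, Pi.star_apply]
  linear_combination (c * star c * ((if o then b else a) * star (if o' then b else a))) * hrr

theorem steps_teleport_le {g t : ℕ} [NeZero g] (D : Scheme g t) (s : Fin g) :
    (D.teleport s).steps ≤ 2 * (len g - t) + (D.ctrlShift s).steps + 2 := by
  have h1 : (cnots (List.finRange (len g - t)) :
      Circuit (Wires (len g - t) D.A) Unit).steps = len g - t := by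
    rw [cnots_eq_gateCircuit, steps_gateCircuit, cnotGates, List.length_map, List.length_finRange]
  have h2 : (Circuit.measureList (dataWires (len g - t) D.A)).steps ≤ len g - t := by
    refine (Circuit.steps_measureList _).trans (le_of_eq ?_)
    simp [dataWires]
  have h3 := Circuit.steps_bind_le (cnots (List.finRange (len g - t)))
    (fun _ => (D.ctrlShift s).bind fun _ =>
      (Circuit.measureList (dataWires (len g - t) D.A)).bind fun f =>
        if Even ((weight (fun i => f (Sum.inl i)) + (s : ℕ)) / g)
        then .gate1 outWire ⟨xMat, xMat_mem⟩ (.ret ()) else .ret ())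
    ((D.ctrlShift s).steps + (len g - t + 1)) fun _ => by
      refine Circuit.steps_bind_le _ _ _ fun _ =>
        (Circuit.steps_bind_le _ _ 1 fun f => ?_).trans (Nat.add_le_add_right h2 1)
      split_ifs <;> simp [Circuit.steps]
  rw [Scheme.teleport, Circuit.steps]
  omega

/-! The unitaries of the decoder on the symmetric subspace. -/

theorem star_mulVec_dotProduct_mulVec {ι κ : Type} [Fintype ι] [Fintype κ] [DecidableEq κ]
    {B : Matrix ι κ ℂ} (hB : Bᴴ * B = 1) (v w : κ → ℂ) :
    star (B *ᵥ v) ⬝ᵥ (B *ᵥ w) = star v ⬝ᵥ w := by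
  rw [Matrix.star_mulVec, ← Matrix.dotProduct_mulVec, Matrix.mulVec_mulVec, hB, Matrix.one_mulVec]

/-- Coordinates in the Dicke basis, so that the rebalancing can be constructed in dimension `len g -
t + 1`. -/
theorem exists_dickeMat_mulVec {g t s : ℕ} (ht : t < g) (a b : ℂ) :
    ∃ y, dickeMat (len g - t) *ᵥ y = a • zeroS g t s + b • oneS g t s := by
  refine ⟨∑ j ∈ Finset.range (codeN g + 1),
    (((Real.sqrt 2 : ℝ) : ℂ) * parityAmp a b j * (coeff g t s j : ℂ)) •
      ket (Fin.ofNat (len g - t + 1) (g * j + g - s)), ?_⟩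
  rw [smul_zeroS_add_smul_oneS, Matrix.mulVec_sum]
  refine Finset.sum_congr rfl fun j hj => ?_
  have hjn : j ≤ codeN g := Nat.lt_succ_iff.1 (Finset.mem_range.1 hj)
  have hpos := position_sub_le (s := s) ht hjn
  rw [Matrix.mulVec_smul, dickeMat_ket, Fin.val_ofNat, Nat.mod_eq_of_lt (by omega)]

/-- Divided by their common norm, the two logical vectors are orthonormal, and `exists_unitary_pair`
rotates them to the levels `g - s` and `gn + g - s`. Any `|0'_s⟩` of even parity would be
admissible; a single Dicke state makes the teleportation a matter of two weights. -/
theorem exists_rebalancing {g t s : ℕ} (ht : t < g) (hs : s ≤ t) :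
    ∃ V ∈ Matrix.unitaryGroup (Fin (len g - t + 1)) ℂ,
      symOp V *ᵥ zeroS g t s =
        ((Real.sqrt (normSqS g t s) : ℝ) : ℂ) • dicke (len g - t) (g - s) ∧
      symOp V *ᵥ oneS g t s =
        ((Real.sqrt (normSqS g t s) : ℝ) : ℂ) • dicke (len g - t) (g * codeN g + g - s) := by
  obtain ⟨y, hy⟩ := exists_dickeMat_mulVec (s := s) ht 1 0
  obtain ⟨y', hy'⟩ := exists_dickeMat_mulVec (s := s) ht 0 1
  have hpos := normSqS_pos (s := s) ht
  set c : ℂ := ((Real.sqrt (normSqS g t s) : ℝ) : ℂ) with hc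
  have hc0 : c ≠ 0 := by
    rw [hc, Complex.ofReal_ne_zero]
    exact (Real.sqrt_pos.2 hpos).ne'
  have hcc : c * c = normSqS g t s := by
    rw [hc, ← Complex.ofReal_mul, Real.mul_self_sqrt hpos.le]
  have hsc : star c = c := Complex.conj_ofReal _
  have hB := conjTranspose_dickeMat_mul (len g - t)
  have hdot : ∀ {a b a' b' : ℂ} {v w : Fin (len g - t + 1) → ℂ},
      dickeMat (len g - t) *ᵥ v = a • zeroS g t s + b • oneS g t s →
      dickeMat (len g - t) *ᵥ w = a' • zeroS g t s + b' • oneS g t s →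
      star (c⁻¹ • v) ⬝ᵥ (c⁻¹ • w) = star a * a' + star b * b' := by
    intro a b a' b' v w hv hw
    rw [star_smul, smul_dotProduct, dotProduct_smul, ← star_mulVec_dotProduct_mulVec hB, hv, hw,
      logicalS_dotProduct ht hs, ← hcc, star_inv₀, hsc, smul_eq_mul, smul_eq_mul]
    field_simp
  have hn : 0 < codeN g := by rw [codeN]; omega
  have hgn : g ≤ g * codeN g := Nat.le_mul_of_pos_right g hn
  have hN : len g = g * codeN g + 2 * g := rfl
  obtain ⟨V, hV, hv, hw⟩ := exists_unitary_pair
    (i := (⟨g - s, by omega⟩ : Fin (len g - t + 1)))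
    (j := (⟨g * codeN g + g - s, by omega⟩ : Fin (len g - t + 1)))
    (fun h => by have := Fin.mk.inj_iff.1 h; omega)
    (v := c⁻¹ • y) (w := c⁻¹ • y')
    (by rw [hdot hy hy]; simp) (by rw [hdot hy' hy']; simp) (by rw [hdot hy hy']; simp)
  have hscale : ∀ {v : Fin (len g - t + 1) → ℂ} {k}, V *ᵥ (c⁻¹ • v) = ket k →
      symOp V *ᵥ (dickeMat (len g - t) *ᵥ v) = c • dicke (len g - t) k := by
    intro v k h
    rw [symOp_mulVec, ← dickeMat_ket, ← h, Matrix.mulVec_smul V, Matrix.mulVec_smul, smul_smul,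
      mul_inv_cancel₀ hc0, one_smul]
  refine ⟨V, hV, ?_, ?_⟩
  · have := hscale hv
    rw [hy] at this
    simpa using this
  · have := hscale hw
    rw [hy'] at this
    simpa using this

/-- Only the summand `j = 0` sees this Dicke state; the others vanish by orthogonality. -/
theorem interchange_mulVec_dicke {g t s : ℕ} (ht : t < g) (hs : s ≤ t) :
    interchange g t s *ᵥ dicke (len g - t) (g - s) =
      dicke (len g - t) (g * codeN g + g - s) := by
  have h0 : g * 0 + g - s = g - s := by omega
  rw [interchange, Matrix.add_mulVec, Matrix.one_mulVec, Matrix.sum_mulVec,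
    Finset.sum_eq_single 0]
  · rw [h0, Matrix.vecMulVec_mulVec, dicke_dotProduct (h0 ▸ position_sub_le ht (Nat.zero_le _)),
      if_pos rfl]
    simp
  · intro j hj hj0
    have hjn : j ≤ codeN g := Nat.lt_succ_iff.1 (Finset.mem_range.1 hj)
    rw [Matrix.vecMulVec_mulVec, dicke_dotProduct (position_sub_le ht hjn),
      if_neg fun h => hj0 ((position_sub_inj ht hs).1 (h.trans h0.symm))]
    simp
  · simp

theorem exists_dickeShift (m : ℕ) (r : ℤ) :
    ∃ V ∈ Matrix.unitaryGroup (Fin (m + 1)) ℂ, IsDickeShift (symOp V) r := by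
  -- The shift is taken cyclically modulo `m + 1`, which makes it a permutation; pairs of weights
  -- that are both in range do not notice the wrap-around.
  set k : ℕ := (r % (m + 1 : ℕ)).toNat with hk
  have hkr : (k : ℤ) = r % (m + 1 : ℕ) :=
    Int.toNat_of_nonneg (Int.emod_nonneg _ (by omega))
  let σ : Fin (m + 1) → Fin (m + 1) := fun w => Fin.ofNat (m + 1) (w + k)
  have hσ : Function.Injective σ := by
    intro w w' h
    have h' : (w + k : ℕ) ≡ w' + k [MOD m + 1] := congrArg Fin.val h
    exact Fin.ext (Nat.ModEq.eq_of_lt_of_lt (Nat.ModEq.add_right_cancel' k h') w.2 w'.2)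
  have hV : (placeMat σ : Matrix _ _ ℂ) ∈ Matrix.unitaryGroup (Fin (m + 1)) ℂ :=
    Matrix.mem_unitaryGroup_iff'.2 (conjTranspose_placeMat_mul hσ)
  refine ⟨placeMat σ, hV, symmetricUnitary_symOp hV, fun w w' hw hw' hww => ?_⟩
  have hval : (w + k) % (m + 1) = w' := by
    zify
    rw [hkr, Nat.cast_succ, Int.add_emod_emod, ← hww]
    exact Int.emod_eq_of_lt (by omega) (by omega)
  have h := symOp_mulVec (placeMat σ) (ket (⟨w, by omega⟩ : Fin (m + 1)))
  rw [dickeMat_ket, placeMat_ket, dickeMat_ket] at h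
  rw [h]
  congr 1

/-! The decoder. -/

theorem weight_mod_of_logicalS {g t s : ℕ} (hsg : s < g) [NeZero g] (a b : ℂ)
    (x : Fin (len g - t) → Bool) (hx : (a • zeroS g t s + b • oneS g t s) x ≠ 0) :
    weight x % g = (-(⟨s, hsg⟩ : Fin g) : Fin g) := by
  rw [smul_zeroS_add_smul_oneS, Finset.sum_apply] at hx
  obtain ⟨j, -, hj⟩ := Finset.exists_ne_zero_of_sum_ne_zero hx
  have hw : weight x = g * j + g - s := by
    by_contra h
    exact hj (by simp [dicke, h])
  rw [hw, Nat.add_sub_assoc hsg.le, Nat.mul_add_mod]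
  rfl

/-- By linearity each component of the mixture can be treated alone, and the one with index `s'`
yields the syndrome `-(-s') = s'` with certainty. -/
theorem run_phaseEstimation_deletion {g t : ℕ} [NeZero g] (ht : t < g) (D : Scheme g t)
    (hD : D.EstimatesPhase) (p : (Fin (len g - t) ↪o Fin (len g)) → ℝ) (hp : IsDeletionLaw p)
    (a b : ℂ) (s : Fin g) :
    D.phaseEstimation.run (place atData (deletion p (proj (encoded g a b)))) s =
      if (s : ℕ) ≤ t then
        place atData ((t.choose s : ℂ) • proj (a • zeroS g t s + b • oneS g t s))
      else 0 := by
  rw [deletion_encoded ht p hp, place_sum, Circuit.run_sum, Finset.sum_apply]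
  have hterm : ∀ s' ∈ Finset.range (t + 1),
      D.phaseEstimation.run (place atData ((t.choose s' : ℂ) •
        proj (a • zeroS g t s' + b • oneS g t s'))) s =
      if s' = (s : ℕ) then place atData ((t.choose s : ℂ) •
        proj (a • zeroS g t s + b • oneS g t s)) else 0 := by
    intro s' hs'
    have hs't : s' ≤ t := Nat.lt_succ_iff.1 (Finset.mem_range.1 hs')
    have hsg : s' < g := hs't.trans_lt ht
    rw [place_smul, Circuit.run_smul, Pi.smul_apply,
      run_phaseEstimation D hD (-⟨s', hsg⟩) _ (weight_mod_of_logicalS hsg a b), neg_neg]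
    by_cases h : s' = (s : ℕ)
    · subst h
      rw [if_pos rfl, if_pos rfl, place_smul]
    · rw [if_neg h, if_neg fun h' => h (by rw [h']), smul_zero]
  rw [Finset.sum_congr rfl hterm, Finset.sum_ite_eq' (Finset.range (t + 1))]
  simp only [Finset.mem_range, Nat.lt_succ_iff]

/-- If the rebalancing leads to the Dicke states of the least and the greatest weight, then the
decoder recovers the qubit. -/
theorem outputState_decoder {g t : ℕ} [NeZero g] (ht : t < g) (D : Scheme g t)
    (hD : D.EstimatesPhase) (hS : ∀ s : Fin g, (s : ℕ) ≤ t → D.Shifts s)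
    (G : Fin g → Op (Fin (len g - t)))
    (hG : ∀ s : Fin g, Realizes (D.rebalance s) atData atData (G s))
    (h0 : ∀ s : Fin g, (s : ℕ) ≤ t → G s *ᵥ zeroS g t s =
      ((Real.sqrt (normSqS g t s) : ℝ) : ℂ) • dicke (len g - t) (g - s))
    (h1 : ∀ s : Fin g, (s : ℕ) ≤ t → G s *ᵥ oneS g t s =
      ((Real.sqrt (normSqS g t s) : ℝ) : ℂ) • dicke (len g - t) (g * codeN g + g - s))
    (p : (Fin (len g - t) ↪o Fin (len g)) → ℝ) (hp : IsDeletionLaw p) (a b : ℂ) :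
    outputState (D.decoder.run (place atData (deletion p (proj (encoded g a b)))) ()) =
      proj (fun o : Bool => if o then b else a) := by
  have hbranch : ∀ s : Fin g, outputState (((D.rebalance s).bind fun _ => D.teleport s).run
      (D.phaseEstimation.run (place atData (deletion p (proj (encoded g a b)))) s) ()) =
      (if (s : ℕ) < t + 1 then (((t.choose s : ℝ) * normSqS g t s : ℝ) : ℂ) else 0) •
        proj (fun o : Bool => if o then b else a) := by
    intro s
    rw [run_phaseEstimation_deletion ht D hD p hp, Circuit.run_bind_unit]
    by_cases hs : (s : ℕ) ≤ t
    · have hψ : G s *ᵥ (a • zeroS g t s + b • oneS g t s) =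
          ((Real.sqrt (normSqS g t s) : ℝ) : ℂ) • (a • dicke (len g - t) (g - s) +
            b • dicke (len g - t) (g * codeN g + g - s)) := by
        rw [Matrix.mulVec_add, Matrix.mulVec_smul, Matrix.mulVec_smul, h0 s hs, h1 s hs]
        module
      rw [if_pos hs, if_pos (Nat.lt_succ_of_le hs), place_smul, Circuit.run_smul, Pi.smul_apply,
        Circuit.run_smul, Pi.smul_apply, outputState_smul, hG, conj_proj, hψ,
        outputState_teleport ht D s (hS s hs), smul_smul, RCLike.star_def, Complex.conj_ofReal,
        ← Complex.ofReal_mul, Real.mul_self_sqrt (normSqS_pos ht).le]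
      push_cast
      rfl
    · rw [if_neg hs, if_neg (mt Nat.lt_succ_iff.1 hs), Circuit.run_zero, Pi.zero_apply,
        Circuit.run_zero, Pi.zero_apply, outputState_zero, zero_smul]
  rw [Scheme.decoder, Circuit.run_bind, outputState_sum, Finset.sum_congr rfl fun s _ => hbranch s,
    ← Finset.sum_smul, Fin.sum_univ_eq_sum_range (fun s => if s < t + 1 then
      (((t.choose s : ℝ) * normSqS g t s : ℝ) : ℂ) else 0) g, ← Finset.sum_filter]
  have hfilter : (Finset.range g).filter (fun s => s < t + 1) = Finset.range (t + 1) := by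
    ext s
    simp only [Finset.mem_filter, Finset.mem_range]
    omega
  rw [hfilter, ← Complex.ofReal_sum, sum_choose_mul_normSqS ht, Complex.ofReal_one, one_smul]

theorem steps_decoder_le {g t : ℕ} [NeZero g] (D : Scheme g t) {K L : ℕ}
    (hK : ∀ s, (D.rebalance s).steps ≤ K) (hL : ∀ s, (D.ctrlShift s).steps ≤ L) :
    D.decoder.steps ≤ D.prepare.steps + (D.ctrlPow.steps + (D.invFourier.steps + (D.A + D.A))) +
      (K + (2 * (len g - t) + L + 2)) := by
  refine (Circuit.steps_bind_le _ _ (K + (2 * (len g - t) + L + 2)) fun s => ?_).trans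
    (Nat.add_le_add_right (steps_phaseEstimation_le D) _)
  refine (Circuit.steps_bind_le _ _ _ fun _ => steps_teleport_le D s).trans ?_
  have := hK s
  have := hL s
  omega

end

end GnuDecoding

theorem mainTheorem2 :
    ∃ C : ℕ, ∀ (g t : ℕ) [NeZero g], t < g → ∃ D : Scheme g t,
      D.EstimatesPhase ∧
      (∀ s : Fin g, (s : ℕ) ≤ t → D.Rebalances s ∧ D.Shifts s) ∧
      D.decoder.steps ≤ C * len g ^ 2 ∧
      ∀ p : (Fin (len g - t) ↪o Fin (len g)) → ℝ, IsDeletionLaw p →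
      ∀ a b : ℂ, ‖a‖ ^ 2 + ‖b‖ ^ 2 = 1 →
        (∀ s : Fin g,
          D.phaseEstimation.run (place atData (deletion p (proj (encoded g a b)))) s =
            if (s : ℕ) ≤ t then
              place atData ((t.choose s : ℂ) • proj (a • zeroS g t s + b • oneS g t s))
            else 0) ∧
        outputState
            (D.decoder.run (place atData (deletion p (proj (encoded g a b)))) ()) =
          proj (fun o : Bool => if o then b else a) := by
  -- With `M = N - t` the bounds below add up to `2g² + gM + 36M² + 22M + 2g + 25`, which is at most
  -- `88 N²`.
  refine ⟨100, fun g t _ ht => ?_⟩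
  obtain ⟨lQ, hlQ, hQ⟩ := exists_acts
    (quditWire_injective (m := len g - t) (g := g)) (qft_mem g)
  obtain ⟨lF, hlF, hF⟩ := exists_acts
    (quditWire_injective (m := len g - t) (g := g)) (Unitary.star_mem (qft_mem g))
  have hrebalance : ∀ s : Fin g, ∃ V ∈ Matrix.unitaryGroup (Fin (len g - t + 1)) ℂ,
      (s : ℕ) ≤ t → symOp V *ᵥ zeroS g t s =
        ((Real.sqrt (normSqS g t s) : ℝ) : ℂ) • dicke (len g - t) (g - s) ∧
      symOp V *ᵥ oneS g t s =
        ((Real.sqrt (normSqS g t s) : ℝ) : ℂ) • dicke (len g - t) (g * codeN g + g - s) := by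
    intro s
    by_cases hs : (s : ℕ) ≤ t
    · obtain ⟨V, hV, h⟩ := exists_rebalancing ht hs
      exact ⟨V, hV, fun _ => h⟩
    -- Syndromes `s > t` have probability zero, but the scheme needs a circuit for each, and the
    -- worst-case step count includes them.
    · exact ⟨1, one_mem _, fun h => absurd h hs⟩
  choose V hV hVs using hrebalance
  choose W hW hWs using fun s : Fin g => exists_dickeShift (len g - t) ((t : ℤ) - 2 * (s : ℕ))
  choose lR hlR hR using fun s =>
    exists_acts (wtWire_injective (m := len g - t) (g := g)) (hV s)
  choose lS hlS hS using fun s =>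
    exists_acts (wtWire'_injective (m := len g - t) (g := g)) (hW s)
  let D : Scheme g t :=
    { A := numAnc (len g - t) g
      enc := oneHot
      prepare := gateCircuit (.one (quditWire 0) ⟨_, xMat_mem⟩ :: lQ)
      ctrlPow := gateCircuit (ctrlPowGates (len g - t) g)
      invFourier := gateCircuit lF
      rebalance := fun s => gateCircuit (onWeights (lR s))
      ctrlShift := fun s => gateCircuit (controlledOnWeights (lS s)) }
  have hD : D.EstimatesPhase :=
    ⟨oneHot_injective, realizes_prepare hQ, realizes_ctrlPow, realizes_invFourier hF⟩
  have hDG : ∀ s, Realizes (D.rebalance s) atData atData (symOp (V s)) :=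
    fun s => realizes_symOp (hR s)
  have hDS : ∀ s, D.Shifts s := fun s =>
    ⟨symOp (W s), hWs s, realizes_controlled_symOp (hS s)⟩
  refine ⟨D, hD, fun s hs => ⟨?_, hDS s⟩, ?_, fun p hp a b _ =>
    ⟨run_phaseEstimation_deletion ht D hD p hp a b, ?_⟩⟩
  -- The vector `|0'_s⟩` is `|D_{g-s}⟩`, the position `j = 0`, and `c` is the common norm of `|0_s⟩`
  -- and `|1_s⟩`.
  · refine ⟨symOp (V s), dicke (len g - t) (g - s), _, Real.sqrt (normSqS g t s),
      symmetricUnitary_symOp (hV s), Submodule.subset_span ⟨0, Nat.zero_le _, Even.zero, ?_⟩, ?_,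
      interchange_mulVec_dicke ht hs, Real.sqrt_pos.2 (normSqS_pos ht), (hVs s hs).1,
      (hVs s hs).2, hDG s⟩
    · rw [Nat.mul_zero, Nat.zero_add]
    · rw [dicke_dotProduct, if_pos rfl]
      simpa using position_sub_le (s := s) (j := 0) ht (Nat.zero_le _)
  · rw [Fintype.card_fin] at hlQ hlF
    simp only [Fintype.card_fin] at hlR hlS
    have hK : ∀ s, (D.rebalance s).steps ≤ (len g - t + 1) ^ 2 + 16 * (len g - t) ^ 2 + 2 := by
      intro s
      have h1 := length_onWeights_le (lR s)
      have h2 := hlR s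
      refine (steps_gateCircuit _).trans_le ?_
      omega
    have hL : ∀ s, (D.ctrlShift s).steps ≤
        (len g - t + 1) ^ 2 + 16 * (len g - t) ^ 2 + 12 * (len g - t) + 14 := by
      intro s
      have h1 := length_controlledOnWeights_le (lS s)
      have h2 := hlS s
      refine (steps_gateCircuit _).trans_le ?_
      omega
    have h := steps_decoder_le D hK hL
    have h1 : D.prepare.steps ≤ g ^ 2 + 1 := by
      refine (steps_gateCircuit _).trans_le ?_
      rw [List.length_cons]
      omega
    have h2 : D.ctrlPow.steps = g * (len g - t) :=
      (steps_gateCircuit _).trans length_ctrlPowGates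
    have h3 : D.invFourier.steps ≤ g ^ 2 := (steps_gateCircuit _).trans_le hlF
    have h4 : D.A = len g - t + 1 + ((len g - t) * (len g - t) + (len g - t + 1 + g)) :=
      numAnc_eq _ _
    have hm : len g - t ≤ len g := Nat.sub_le _ _
    have hg : g ≤ len g := by rw [len]; omega
    have hpos : 1 ≤ len g := by omega
    have hm2 : (len g - t) ^ 2 ≤ len g ^ 2 := Nat.pow_le_pow_left hm 2
    have hg2 : g ^ 2 ≤ len g ^ 2 := Nat.pow_le_pow_left hg 2
    have hgm : g * (len g - t) ≤ len g ^ 2 := by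
      rw [sq]
      exact Nat.mul_le_mul hg hm
    have hN : len g ≤ len g ^ 2 := Nat.le_self_pow (by norm_num) _
    have he : (len g - t + 1) ^ 2 = (len g - t) ^ 2 + 2 * (len g - t) + 1 := by ring
    rw [← sq] at h4
    rw [he] at h
    omega
  · exact outputState_decoder ht D hD (fun s _ => hDS s) (fun s => symOp (V s)) hDG
      (fun s hs => (hVs s hs).1) (fun s hs => (hVs s hs).2) p hp a b
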